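/- **Setting.** Let $\mathcal A\subset M_n(\mathbb C)$ be a unital $*$-subalgebra, $\tau$ the normalized trace on $M_n(\mathbb C)$, and equip $M_n(\mathbb C)$ and its subspace $\mathcal A$ with the inner product $\langle X,Y\rangle=\tau(X^*Y)$. Let $\mathcal S(\mathcal A)=\{\rho\in\mathcal A:\rho\ge 0,\ \tau(\rho)=1\}$, let $\mathcal S_+(\mathcal A)$ be the set of invertible elements of $\mathcal S(\mathcal A)$, and let $\sigma\in\mathcal S_+(\mathcal A)$. Let $(P_t)_{t\ge0}$ be a quantum Markov semigroup on $M_n(\mathbb C)$ (a continuous semigroup of unital completely positive maps) with $P_t\mathcal A\subset\mathcal A$ which satisfies $\sigma$-detailed balance, $\tau((P_tA)^*B\sigma)=\tau(A^*(P_tB)\sigma)$. Let $\mathcal L$ be the generator of $(P_t|_{\mathcal A})$ and assume that $(P_t|_{\mathcal A})$ is ergodic, i.e. $\dim\ker\mathcal L=1$. Fix a finite set $\mathcal J$, real numbers $\omega_j$ and matrices $V_j\in M_n(\mathbb C)$ ($j\in\mathcal J$) with $\tau(V_j^*V_k)=\delta_{jk}$, $\tau(V_j)=0$, $\{V_j\}=\{V_j^*\}$,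 $\sigma V_j\sigma^{-1}=e^{-\omega_j}V_j$ and $$\mathcal L(A)=\sum_{j}\bigl(e^{-\omega_j/2}V_j^*[A,V_j]-e^{\omega_j/2}[A,V_j]V_j^*\bigr)\qquad(A\in\mathcal A).$$ Let $j^*$ be the index with $V_{j^*}=V_j^*$. Fix subspaces $K_j\subset M_n(\mathbb C)$ with $\mathcal AK_j\subset K_j$, $K_j\mathcal A\subset K_j$ and $[V_j,\mathcal A]\subset K_j$ (for instance $K_j=M_n(\mathbb C)$, or $K_j=\mathcal A$ if $[V_j,\mathcal A]\subset\mathcal A$). Let $\nabla A=([V_j,A])_{j}$ for $A\in\mathcal A$, and let $\operatorname{div}\colon\bigoplus_jK_j\to\mathcal A$ be the adjoint of $-\nabla$. An operator connection on an infinite-dimensional Hilbert space $H$ is a map $\Lambda\colon B(H)_+\times B(H)_+\to B(H)_+$ which is jointly monotone, satisfies $C\Lambda(A,B)C\le\Lambda(CAC,CBC)$ for all $A,B,C\in B(H)_+$, and satisfies $\Lambda(A_k,B_k)\searrow\Lambda(A,B)$ whenever $A_k\searrow A$ and $B_k\searrow B$ (decreasing sequences with strong limits). Let $(\Lambda_j)_{j\in\mathcal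 J}$ be non-zero operator connections with $\Lambda_{j^*}(A,B)=\Lambda_j(B,A)$. For $\rho\in\mathcal A_+$ let $[\rho]_{\vec\Lambda}=\bigoplus_j\Lambda_j(L(\rho),R(\rho))$, where the operators $L(\rho)X=\rho X$ and $R(\rho)X=X\rho$ on $M_n(\mathbb C)$ are viewed as operators on $H$ by an arbitrary isometric embedding of $M_n(\mathbb C)$ into $H$ (and extended by zero). Put $\|\mathbf V\|_\rho^2=\langle\mathbf V,[\rho]_{\vec\Lambda}\mathbf V\rangle$. For $\epsilon\ge0$ and $\rho_0,\rho_1\in\mathcal S_+(\mathcal A)$ let $$\mathcal W_{\vec\Lambda,\epsilon}(\rho_0,\rho_1)^2=\inf\int_0^1\langle\mathbf V(t),[\rho(t)]_{\vec\Lambda}^{-1}\mathbf V(t)\rangle\,dt,$$ where the infimum is over all $\rho\in H^1([0,1];\mathcal S_+(\mathcal A))$ and $\mathbf V\in L^2([0,1];\bigoplus_jK_j)$ with $\rho(0)=\rho_0$, $\rho(1)=\rho_1$ and $\dot\rho(t)+\operatorname{div}\mathbf V(t)=\epsilon\mathcal L^\dagger\rho(t)$ for a.e. $t$; here $\mathcal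 L^\dagger$ is the adjoint of $\mathcal L$ on $\mathcal A$. Let $\mathrm{HJB}_{\vec\Lambda,\epsilon}$ be the set of all $A\in H^1((0,1);\mathcal A_h)$, where $\mathcal A_h$ is the self-adjoint part of $\mathcal A$, such that for a.e. $t\in(0,1)$ $$\tau\bigl((\dot A(t)+\epsilon\mathcal LA(t))\rho\bigr)+\tfrac12\|\nabla A(t)\|_\rho^2\le0\qquad\text{for all }\rho\in\mathcal S(\mathcal A).$$ **Theorem (Duality formula).** For all $\rho_0,\rho_1\in\mathcal S_+(\mathcal A)$, the distance $\mathcal W_{\vec\Lambda,\epsilon}(\rho_0,\rho_1)$ is finite and $$\tfrac12\mathcal W_{\vec\Lambda,\epsilon}(\rho_0,\rho_1)^2=\sup_{A\in\mathrm{HJB}_{\vec\Lambda,\epsilon}}\bigl(\tau(A(1)\rho_1)-\tau(A(0)\rho_0)\bigr)=\sup_{A\in\mathrm{HJB}_{\vec\Lambda,\epsilon}\cap C^\infty([0,1];\mathcal A)}\bigl(\tau(A(1)\rho_1)-\tau(A(0)\rho_0)\bigr).$$ The same statement holds if $[\rho]_{\vec\Lambda}$ is replaced throughout by $[\rho]_{\vec\omega}=\bigoplus_j[\rho]_{\omega_j}$,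 $[\rho]_{\alpha}X=\int_0^1e^{\alpha(s-1/2)}\rho^sX\rho^{1-s}\,ds$, that is, for the Carlen--Maas distance ($\epsilon=0$) and its Becker--Li entropic regularization ($\epsilon>0$). -/

import Mathlib

open MeasureTheory Set Filter Topology
open scoped NNReal ENNReal Matrix InnerProductSpace ComplexOrder

noncomputable section

namespace QTransport

/-! ### Matrices, the normalized trace and the GNS Hilbert space -/

/-- Complex `n × n` matrices. -/
abbrev Mat (n : ℕ) := Matrix (Fin n) (Fin n) ℂ

variable {n : ℕ}

/-- The normalized trace. -/
def tau (X : Mat n) : ℂ := X.trace / n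

/-- The vector space of `n × n` matrices, to be equipped with the inner product
`⟨X, Y⟩ = tau (Xᴴ * Y)`. -/
def GNS (n : ℕ) := Mat n

instance : AddCommGroup (GNS n) := inferInstanceAs (AddCommGroup (Mat n))
instance : Module ℂ (GNS n) := inferInstanceAs (Module ℂ (Mat n))
instance : FiniteDimensional ℂ (GNS n) := inferInstanceAs (FiniteDimensional ℂ (Mat n))

/-- The identity map from matrices to the GNS space. -/
def toGNS : Mat n ≃ₗ[ℂ] GNS n := LinearEquiv.refl ℂ (Mat n)

/-- The matrix underlying a vector of the GNS space. -/
def mat (x : GNS n) : Mat n := toGNS.symm x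

/-- The GNS inner product `⟨X, Y⟩ = tau (Xᴴ * Y)`. -/
abbrev gnsCore (n : ℕ) : InnerProductSpace.Core ℂ (GNS n) where
  inner x y := tau ((mat x)ᴴ * mat y)
  conj_inner_symm x y := by
    have h : (((mat y)ᴴ * mat x).trace : ℂ) = star (((mat x)ᴴ * mat y).trace) := by
      rw [← Matrix.trace_conjTranspose, Matrix.conjTranspose_mul,
        Matrix.conjTranspose_conjTranspose]
    simp [tau, h]
  re_inner_nonneg x := by
    have h := (Matrix.posSemidef_conjTranspose_mul_self (mat x)).trace_nonneg
    have h2 : (0 : ℂ) ≤ tau ((mat x)ᴴ * mat x) := by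
      unfold tau
      rw [div_eq_mul_inv]
      exact mul_nonneg h (inv_nonneg.mpr (Nat.cast_nonneg n))
    exact (Complex.le_def.mp h2).1
  add_left x y z := by
    simp [tau, mat, Matrix.conjTranspose_add, add_mul, Matrix.trace_add, add_div]
  smul_left x y r := by
    simp [tau, mat, Matrix.conjTranspose_smul, Matrix.trace_smul, mul_div_assoc]
  definite x h := by
    rcases Nat.eq_zero_or_pos n with hn | hn
    · subst hn
      exact (Subsingleton.elim (α := Mat 0) x 0)
    · have hn' : (n : ℂ) ≠ 0 := by exact_mod_cast hn.ne'
      have h0 : ((mat x)ᴴ * mat x).trace = 0 := by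
        have h1 : ((mat x)ᴴ * mat x).trace / (n : ℂ) = 0 := h
        simpa [hn'] using h1
      exact Matrix.trace_conjTranspose_mul_self_eq_zero_iff.mp h0

instance : NormedAddCommGroup (GNS n) := (gnsCore n).toNormedAddCommGroup
instance : InnerProductSpace ℂ (GNS n) := InnerProductSpace.ofCore (gnsCore n).toCore
instance : CompleteSpace (GNS n) := FiniteDimensional.complete ℂ (GNS n)

theorem gns_inner (x y : GNS n) : ⟪x, y⟫_ℂ = tau ((mat x)ᴴ * mat y) := rfl

/-- A unital `*`-subalgebra `𝒜` of the matrices, as a subspace of the GNS space. This is the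
Hilbert space obtained from `𝒜` and the inner product `tau (Xᴴ * Y)`. -/
def HA (𝒜 : StarSubalgebra ℂ (Mat n)) : Submodule ℂ (GNS n) :=
  (Subalgebra.toSubmodule 𝒜.toSubalgebra).map (toGNS (n := n)).toLinearMap

/-- Left multiplication by `X`. -/
def Lop (X : Mat n) : GNS n →L[ℂ] GNS n :=
  LinearMap.toContinuousLinearMap
    ((toGNS (n := n)).toLinearMap ∘ₗ LinearMap.mulLeft ℂ X ∘ₗ (toGNS (n := n)).symm.toLinearMap)

/-- Right multiplication by `X`. -/
def Rop (X : Mat n) : GNS n →L[ℂ] GNS n :=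
  LinearMap.toContinuousLinearMap
    ((toGNS (n := n)).toLinearMap ∘ₗ LinearMap.mulRight ℂ X ∘ₗ (toGNS (n := n)).symm.toLinearMap)

/-- `X` is a density matrix of `𝒜`. -/
def IsDensity (𝒜 : StarSubalgebra ℂ (Mat n)) (X : Mat n) : Prop :=
  X ∈ 𝒜 ∧ X.PosSemidef ∧ tau X = 1

/-- `X` is an invertible density matrix of `𝒜`. -/
def IsInvDensity (𝒜 : StarSubalgebra ℂ (Mat n)) (X : Mat n) : Prop :=
  IsDensity 𝒜 X ∧ IsUnit X

/-! ### Quantum Markov semigroups -/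

/-- Complete positivity: for every `k`, the entrywise application of `T` to `k × k` block matrices
preserves positivity. -/
def IsCompletelyPositive (T : Mat n →ₗ[ℂ] Mat n) : Prop :=
  ∀ (k : ℕ) (M : Matrix (Fin k) (Fin k) (Mat n)),
    (Matrix.comp (Fin k) (Fin k) (Fin n) (Fin n) ℂ M).PosSemidef →
      (Matrix.comp (Fin k) (Fin k) (Fin n) (Fin n) ℂ (M.map T)).PosSemidef

/-- Quantum Markov semigroups on the full matrix algebra. -/
structure IsQMS (P : ℝ≥0 → Mat n →ₗ[ℂ] Mat n) : Prop where
  map_one : ∀ t, P t 1 = 1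
  completelyPositive : ∀ t, IsCompletelyPositive (P t)
  zero : P 0 = LinearMap.id
  add : ∀ s t, P (s + t) = P s ∘ₗ P t
  continuous : ∀ X, Continuous fun t => P t X

/-- The `σ`-detailed balance condition. -/
def DetailedBalance (σ : Mat n) (P : ℝ≥0 → Mat n →ₗ[ℂ] Mat n) : Prop :=
  ∀ t A B, tau ((P t A)ᴴ * B * σ) = tau (Aᴴ * P t B * σ)

/-- `ℒ` is the generator of the restriction to `𝒜` of the semigroup `P`. -/
def IsGenerator (𝒜 : StarSubalgebra ℂ (Mat n)) (P : ℝ≥0 → Mat n →ₗ[ℂ] Mat n)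
    (ℒ : HA 𝒜 →ₗ[ℂ] HA 𝒜) : Prop :=
  ∀ A : HA 𝒜, Tendsto (fun t : ℝ≥0 => ((t : ℝ) : ℂ)⁻¹ • (P t (mat A) - mat A)) (𝓝[>] 0)
    (𝓝 (mat (ℒ A)))

variable {J : Type*} [Fintype J]

/-- Jump operators `V j` and Bohr frequencies `ω j` representing the generator `ℒ`. -/
structure IsAlicki (𝒜 : StarSubalgebra ℂ (Mat n)) (σ : Mat n) (ℒ : HA 𝒜 →ₗ[ℂ] HA 𝒜)
    (ω : J → ℝ) (V : J → Mat n) : Prop where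
  orthonormal : Orthonormal ℂ fun j => toGNS (V j)
  trace_zero : ∀ j, tau (V j) = 0
  star_closed : range V = range fun j => (V j)ᴴ
  modular : ∀ j, σ * V j * σ⁻¹ = (Real.exp (-ω j) : ℂ) • V j
  generator : ∀ A : HA 𝒜, mat (ℒ A) =
    ∑ j, ((Real.exp (-ω j / 2) : ℂ) • ((V j)ᴴ * (mat A * V j - V j * mat A))
      - (Real.exp (ω j / 2) : ℂ) • ((mat A * V j - V j * mat A) * (V j)ᴴ))

/-! ### Gradient and divergence -/

/-- Vector fields: the orthogonal direct sum of copies of the GNS space indexed by `J`. -/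
abbrev Field (n : ℕ) (J : Type*) := PiLp 2 fun _ : J => GNS n

/-- The gradient `A ↦ ([V j, A])_j` on `𝒜`. -/
def nabla (𝒜 : StarSubalgebra ℂ (Mat n)) (V : J → Mat n) : HA 𝒜 →ₗ[ℂ] Field n J :=
  ((WithLp.linearEquiv 2 ℂ (J → GNS n)).symm : (J → GNS n) →ₗ[ℂ] Field n J) ∘ₗ
    LinearMap.pi fun j => ((Lop (V j) - Rop (V j) : GNS n →L[ℂ] GNS n) : GNS n →ₗ[ℂ] GNS n) ∘ₗ
      (HA 𝒜).subtype

/-- The divergence, the adjoint of `-nabla`. -/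
def divergence (𝒜 : StarSubalgebra ℂ (Mat n)) (V : J → Mat n) : Field n J →ₗ[ℂ] HA 𝒜 :=
  -(LinearMap.adjoint (nabla 𝒜 V))

/-- The `j`-th component of a vector field takes values in `K j`. The family `K` is admissible if
each `K j` is stable under left and right multiplication by elements of `𝒜` and contains `[V j, A]`
for all `A` in `𝒜`. -/
structure IsAdmissible (𝒜 : StarSubalgebra ℂ (Mat n)) (V : J → Mat n)
    (K : J → Submodule ℂ (GNS n)) : Prop where
  grad_mem : ∀ j (A : HA 𝒜), nabla 𝒜 V A j ∈ K j
  left_mem : ∀ j, ∀ X ∈ 𝒜, ∀ v ∈ K j, Lop X v ∈ K j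
  right_mem : ∀ j, ∀ X ∈ 𝒜, ∀ v ∈ K j, Rop X v ∈ K j

/-! ### Operator connections -/

section Connection

variable {H : Type*} [NormedAddCommGroup H] [InnerProductSpace ℂ H] [CompleteSpace H]

/-- `a k` decreases to `b`: antitone for the Loewner order, with strong limit `b`. -/
def DecreasesTo (a : ℕ → H →L[ℂ] H) (b : H →L[ℂ] H) : Prop :=
  Antitone a ∧ ∀ x, Tendsto (fun k => a k x) atTop (𝓝 (b x))

/-- Operator connections on `B(H)₊` (only the values at positive operators matter). -/
structure IsOperatorConnection (Λ : (H →L[ℂ] H) → (H →L[ℂ] H) → (H →L[ℂ] H)) : Prop where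
  nonneg : ∀ A B, 0 ≤ A → 0 ≤ B → 0 ≤ Λ A B
  mono : ∀ A B C D, 0 ≤ A → 0 ≤ B → A ≤ C → B ≤ D → Λ A B ≤ Λ C D
  transformer : ∀ A B C, 0 ≤ A → 0 ≤ B → 0 ≤ C →
    C ∘L Λ A B ∘L C ≤ Λ (C ∘L A ∘L C) (C ∘L B ∘L C)
  decreasing : ∀ (a b : ℕ → H →L[ℂ] H) (A B : H →L[ℂ] H), (∀ k, 0 ≤ a k) → (∀ k, 0 ≤ b k) →
    DecreasesTo a A → DecreasesTo b B → DecreasesTo (fun k => Λ (a k) (b k)) (Λ A B)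

/-- An operator on the GNS space, extended by zero to an operator on `H` along an isometric
embedding. -/
def extendOp (ι : GNS n →ₗᵢ[ℂ] H) (T : GNS n →L[ℂ] GNS n) : H →L[ℂ] H :=
  ι.toContinuousLinearMap ∘L T ∘L ContinuousLinearMap.adjoint ι.toContinuousLinearMap

/-- The operator `[ρ]_Λ = Λ(L(ρ), R(ρ))`, where `L(ρ)` and `R(ρ)` are viewed as operators on `H`
along the isometric embedding `ι` of the GNS space and the result is viewed as an operator on the
GNS space. -/
def connBracket (ι : GNS n →ₗᵢ[ℂ] H) (Λ : (H →L[ℂ] H) → (H →L[ℂ] H) → (H →L[ℂ] H))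
    (ρ : Mat n) : GNS n →L[ℂ] GNS n :=
  ContinuousLinearMap.adjoint ι.toContinuousLinearMap ∘L
    Λ (extendOp ι (Lop ρ)) (extendOp ι (Rop ρ)) ∘L ι.toContinuousLinearMap

end Connection

/-- The operator `A ↦ ∫₀¹ e^{α (s - 1/2)} ρ^s A ρ^{1-s} ds`. -/
def expBracket (α : ℝ) (ρ : Mat n) : GNS n →L[ℂ] GNS n :=
  ∫ s in (0 : ℝ)..1, (Real.exp (α * (s - 1 / 2)) : ℂ) •
    (Lop (cfc (fun x : ℝ => x ^ s) ρ) ∘L Rop (cfc (fun x : ℝ => x ^ (1 - s)) ρ))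

/-! ### The transport distance

In this part `B j ρ` is an operator on the GNS space for each index `j` and matrix `ρ`; it is
to be either `connBracket ι (Λ j) ρ` or `expBracket (ω j) ρ`. -/

/-- The direct sum over `j` of the operators `B j ρ`. -/
def bracket (B : J → Mat n → (GNS n →L[ℂ] GNS n)) (ρ : Mat n) (W : Field n J) : Field n J :=
  WithLp.toLp 2 fun j => B j ρ (W j)

/-- `⟨W, K⁻¹ W⟩` for the positive operator `K = bracket B ρ`: it is `⟨K U, U⟩` if `W = K U`, and
`∞` if `W` is not in the range of `K`. -/
def invQuad (B : J → Mat n → (GNS n →L[ℂ] GNS n)) (ρ : Mat n) (W : Field n J) : ℝ≥0∞ :=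
  ⨅ (U : Field n J) (_ : bracket B ρ U = W), ENNReal.ofReal (⟪bracket B ρ U, U⟫_ℂ).re

/-- `f` is (the continuous representative of) a function in `H¹((0,1); E)` with weak derivative
`g`. -/
def HasH1Deriv {E : Type*} [NormedAddCommGroup E] [NormedSpace ℝ E] (f g : ℝ → E) : Prop :=
  MemLp g 2 (volume.restrict (Icc (0 : ℝ) 1)) ∧
    ∀ t ∈ Icc (0 : ℝ) 1, f t = f 0 + ∫ s in (0 : ℝ)..t, g s

/-- The pairs `(ρ, W)` of a curve of invertible density matrices in `H¹` and a square integrable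
vector field which satisfy `ρ' + div W = ε ℒ† ρ` and connect `ρ₀` to `ρ₁`. -/
structure IsAdmissiblePath (𝒜 : StarSubalgebra ℂ (Mat n)) (V : J → Mat n)
    (K : J → Submodule ℂ (GNS n)) (ℒ : HA 𝒜 →ₗ[ℂ] HA 𝒜) (ε : ℝ) (ρ₀ ρ₁ : Mat n)
    (ρ : ℝ → HA 𝒜) (W : ℝ → Field n J) : Prop where
  density : ∀ t ∈ Icc (0 : ℝ) 1, IsInvDensity 𝒜 (mat (ρ t))
  start : mat (ρ 0) = ρ₀
  finish : mat (ρ 1) = ρ₁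
  memLp : MemLp W 2 (volume.restrict (Icc (0 : ℝ) 1))
  values : ∀ᵐ t ∂(volume.restrict (Icc (0 : ℝ) 1)), ∀ j, W t j ∈ K j
  continuity : ∃ ρ' : ℝ → HA 𝒜, HasH1Deriv ρ ρ' ∧
    ∀ᵐ t ∂(volume.restrict (Icc (0 : ℝ) 1)),
      ρ' t + divergence 𝒜 V (W t) = (ε : ℂ) • LinearMap.adjoint ℒ (ρ t)

/-- The transport distance with parameter `ε`. -/
def transportDist (𝒜 : StarSubalgebra ℂ (Mat n)) (V : J → Mat n) (K : J → Submodule ℂ (GNS n))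
    (ℒ : HA 𝒜 →ₗ[ℂ] HA 𝒜) (ε : ℝ) (B : J → Mat n → (GNS n →L[ℂ] GNS n)) (ρ₀ ρ₁ : Mat n) :
    ℝ≥0∞ :=
  (⨅ (ρ : ℝ → HA 𝒜) (W : ℝ → Field n J) (_ : IsAdmissiblePath 𝒜 V K ℒ ε ρ₀ ρ₁ ρ W),
    ∫⁻ t in Icc (0 : ℝ) 1, invQuad B (mat (ρ t)) (W t)) ^ (1 / 2 : ℝ)

/-! ### Hamilton-Jacobi-Bellman subsolutions -/

/-- Hamilton-Jacobi-Bellman subsolutions in `H¹((0,1); 𝒜_h)`. -/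
def IsHJB (𝒜 : StarSubalgebra ℂ (Mat n)) (V : J → Mat n) (ℒ : HA 𝒜 →ₗ[ℂ] HA 𝒜) (ε : ℝ)
    (B : J → Mat n → (GNS n →L[ℂ] GNS n)) (A : ℝ → HA 𝒜) : Prop :=
  (∀ t ∈ Icc (0 : ℝ) 1, (mat (A t : GNS n)).IsHermitian) ∧
  ∃ A' : ℝ → HA 𝒜, HasH1Deriv A A' ∧
    ∀ᵐ t ∂(volume.restrict (Icc (0 : ℝ) 1)), ∀ ρ, IsDensity 𝒜 ρ →
      (tau (mat (A' t + (ε : ℂ) • ℒ (A t)) * ρ)).re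
        + 1 / 2 * (⟪nabla 𝒜 V (A t), bracket B ρ (nabla 𝒜 V (A t))⟫_ℂ).re ≤ 0

/-- The value `tau (A(1) ρ₁) - tau (A(0) ρ₀)` (a real number for self-adjoint arguments). -/
def dualValue {𝒜 : StarSubalgebra ℂ (Mat n)} (ρ₀ ρ₁ : Mat n) (A : ℝ → HA 𝒜) : ℝ :=
  (tau (mat (A 1) * ρ₁) - tau (mat (A 0) * ρ₀)).re

end QTransport

end

open QTransport

/-!
The duality formula is a minimax theorem for the Lagrangian
`Φ(A, ρ) = ⟪A(1), ρ₁⟫ - ⟪A(0), ρ₀⟫ - ∫ (⟪A' + ε ℒ A, ρ⟫ + ½ ⟪∇A, [ρ] ∇A⟫)`, concave in the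
potential `A` and convex in the curve `ρ`, because `⟪X, [ρ] X⟫` is a concave function of `ρ`.

*Weak duality* (`ofReal_two_mul_dualValue_le`). By the product rule for Sobolev curves
(`integral_inner_add_inner`) the dual value of a subsolution `A` is the integral of
`⟪A', ρ⟫ + ⟪∇A, W⟫ + ε ⟪ℒ A, ρ⟫` along an admissible pair `(ρ, W)`; the Hamilton-Jacobi-Bellman
inequality and Young's inequality bound it by half the action.

*Strong duality* (`TransportData.exists_isPath_action_le`) only involves a finite-dimensional real
Hilbert space, a gradient whose kernel is spanned by a vector `u`, and a positive, homogeneous and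
superadditive family of quadratic forms. Let `D` be an upper bound of the dual problem.

* Subtracting a multiple of `u` that depends smoothly on time turns any smooth curve `A` into a
  subsolution. Therefore `inf_ρ Φ(A, ρ) ≤ D` for each `A`, the infimum being over measurable curves
  of densities (`TransportData.exists_curve_le`). To stay away from singular densities, the
  quadratic forms are evaluated at `ρ + η u`.
* The set of square integrable curves of densities is bounded, closed and convex, so by weak
  compactness and separation in finite dimensions there is one curve with `Φ(A, ρ) ≤ D` for all
  smooth `A` (`exists_forall_le_of_finite_convex_combinations`,
  `TransportData.exists_curve_forall_le`).
* Mixing this curve with the straight line from `ρ₀` to `ρ₁` gives a curve `y` with values in a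
  compact set of strictly positive densities, at the cost of an arbitrarily small error in `D`. The
  part of `Φ(·, y)` that is linear in `A` is then bounded in `L²`, and the vector which represents
  it is the flux of `y`: the curve has a Sobolev representative with the prescribed end points, its
  velocity is the drift plus `∇† [y] ∇A` for a potential `A` found by solving an elliptic equation
  at each time, and inserting smooth approximations of this potential into `Φ` bounds the action by
  `2 D` (`TransportData.exists_isPath_of_le`).

*The operators.* Both families act on the joint eigenvectors of left and right multiplication by `ρ`
by a function `m` of the two eigenvalues (`IsSchur`), which is nonnegative, monotone, homogeneous
and positive for positive arguments (`IsWeight`). For operator connections this follows from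
monotonicity and the transformer inequality applied to rank one projections
(`QTransport.IsOperatorConnection.exists_isSymbol`), and superadditivity in `ρ` from the transformer
inequality for the diagonal in two orthogonal copies of the GNS space (`IsSymbol.superadditive`).
For the Carlen-Maas operators superadditivity is Lieb's concavity theorem, obtained from the
variational formula for parallel sums and an integral representation of powers (`isSuperadd_parallel`,
`isSuperadd_rpow`). By Lagrange interpolation such operators preserve the bimodules `K j`
(`IsSchur.apply_mem`), and the symmetry under adjoints makes the divergence of an optimal field
self-adjoint (`IsKernelFamily.bracket_fieldStar`), so that paths of the abstract problem are
admissible (`isAdmissiblePath_of_isPath`).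
-/

set_option linter.unusedSectionVars false

/-! ### Convexity in Hilbert spaces -/

/-- Weak compactness of bounded closed convex sets in a Hilbert space, phrased through the finite
intersection property: the vectors of minimal norm in the finite intersections form a Cauchy
net. -/
theorem nonempty_inter_of_finite_inter {X : Type*} [NormedAddCommGroup X] [InnerProductSpace ℝ X]
    [CompleteSpace X] {ι : Type*} {C₀ : Set X} (hb : Bornology.IsBounded C₀) (hc₀ : IsClosed C₀)
    (hv₀ : Convex ℝ C₀) {C : ι → Set X} (hc : ∀ i, IsClosed (C i)) (hv : ∀ i, Convex ℝ (C i))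
    (hne : ∀ s : Finset ι, (C₀ ∩ ⋂ i ∈ s, C i).Nonempty) : (C₀ ∩ ⋂ i, C i).Nonempty := by
  classical
  set K : Finset ι → Set X := fun s => C₀ ∩ ⋂ i ∈ s, C i with hK
  have hKc : ∀ s, IsClosed (K s) := fun s =>
    hc₀.inter (isClosed_iInter fun i => isClosed_iInter fun _ => hc i)
  have hKv : ∀ s, Convex ℝ (K s) := fun s =>
    hv₀.inter (convex_iInter fun i => convex_iInter fun _ => hv i)
  have hKm : ∀ s t, s ⊆ t → K t ⊆ K s := fun s t hst =>
    inter_subset_inter_right _ (biInter_subset_biInter_left fun i hi => hst hi)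
  have hmin : ∀ s, ∃ v ∈ K s, ∀ w ∈ K s, ‖v‖ ≤ ‖w‖ := by
    intro s
    obtain ⟨v, hv, hve⟩ := exists_norm_eq_iInf_of_complete_convex (hne s) (hKc s).isComplete
      (hKv s) 0
    refine ⟨v, hv, fun w hw => ?_⟩
    simp only [zero_sub, norm_neg] at hve
    rw [hve]
    exact ciInf_le ⟨0, by rintro _ ⟨w, rfl⟩; exact norm_nonneg _⟩ (⟨w, hw⟩ : K s)
  choose x hx hxm using hmin
  obtain ⟨R, hR⟩ := hb.exists_norm_le
  have hbd : BddAbove (range fun s => ‖x s‖ ^ 2) := by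
    refine ⟨R ^ 2, ?_⟩
    rintro _ ⟨s, rfl⟩
    exact pow_le_pow_left₀ (norm_nonneg _) (hR _ (hx s).1) 2
  have hcau : CauchySeq x := by
    rw [Metric.cauchySeq_iff']
    intro ε hε
    obtain ⟨s₀, hs₀⟩ := exists_lt_of_lt_ciSup
      (sub_lt_self (⨆ s, ‖x s‖ ^ 2) (show 0 < ε ^ 2 / 4 by positivity))
    refine ⟨s₀, fun s hs => ?_⟩
    have h1 : ‖x s‖ ^ 2 ≤ ⨆ s, ‖x s‖ ^ 2 := le_ciSup hbd s
    have h2 : ‖x s₀‖ ≤ ‖(1 / 2 : ℝ) • x s + (1 / 2 : ℝ) • x s₀‖ :=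
      hxm s₀ _ (hKv s₀ (hKm _ _ hs (hx s)) (hx s₀) (by norm_num) (by norm_num) (by norm_num))
    have h3 : ‖(1 / 2 : ℝ) • x s + (1 / 2 : ℝ) • x s₀‖ = 1 / 2 * ‖x s + x s₀‖ := by
      rw [← smul_add, norm_smul]; norm_num
    have h4 := parallelogram_law_with_norm ℝ (x s) (x s₀)
    rw [h3] at h2
    rw [dist_eq_norm]
    have h5 : (2 * ‖x s₀‖) ^ 2 ≤ ‖x s + x s₀‖ ^ 2 :=
      pow_le_pow_left₀ (by positivity) (by linarith) 2
    refine lt_of_pow_lt_pow_left₀ 2 hε.le ?_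
    nlinarith
  obtain ⟨y, hy⟩ := cauchySeq_tendsto_of_complete hcau
  have hmem : ∀ s, y ∈ K s := fun s =>
    (hKc s).mem_of_tendsto hy ((eventually_ge_atTop s).mono fun t ht => hKm s t ht (hx t))
  refine ⟨y, (hmem ∅).1, mem_iInter.2 fun i => ?_⟩
  have := (hmem {i}).2
  simpa using this

/-- A finite system of convex inequalities is solvable up to any positive error as soon as all its
convex combinations are. -/
theorem exists_forall_le_of_convex_combinations {X : Type*} [AddCommGroup X] [Module ℝ X]
    {ι : Type*} [Fintype ι] {C : Set X} (hC : C.Nonempty) {f : ι → X → ℝ}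
    (hf : ∀ i, ConvexOn ℝ C (f i)) {D : ℝ}
    (hD : ∀ w : ι → ℝ, (∀ i, 0 ≤ w i) → ∑ i, w i = 1 → ∀ γ > 0, ∃ x ∈ C,
      ∑ i, w i * f i x ≤ D + γ) {γ : ℝ} (hγ : 0 < γ) :
    ∃ x ∈ C, ∀ i, f i x ≤ D + γ := by
  classical
  by_contra! hcon
  set T : Set (ι → ℝ) := {y | ∃ x ∈ C, ∀ i, f i x < y i} with hT
  have hTv : Convex ℝ T := by
    rintro y ⟨x, hx, hxy⟩ z ⟨x', hx', hxz⟩ a b ha hb hab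
    refine ⟨a • x + b • x', (hf (Classical.choice ?_)).1 hx hx' ha hb hab, fun i => ?_⟩
    · obtain ⟨i, -⟩ := hcon x hx
      exact ⟨i⟩
    · refine ((hf i).2 hx hx' ha hb hab).trans_lt ?_
      simp only [Pi.add_apply, Pi.smul_apply, smul_eq_mul]
      rcases ha.eq_or_lt with rfl | ha
      · have : b = 1 := by linarith
        subst this
        simpa using hxz i
      · exact add_lt_add_of_lt_of_le (mul_lt_mul_of_pos_left (hxy i) ha)
          (mul_le_mul_of_nonneg_left (hxz i).le hb)
  have hTo : IsOpen T := by
    have : T = ⋃ x ∈ C, ⋂ i, {y : ι → ℝ | f i x < y i} := by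
      ext y; simp [hT]
    rw [this]
    exact isOpen_biUnion fun x _ => isOpen_iInter_of_finite fun i =>
      isOpen_lt continuous_const (continuous_apply i)
  have hp : (fun _ => D + γ : ι → ℝ) ∉ T := by
    rintro ⟨x, hx, h⟩
    obtain ⟨i, hi⟩ := hcon x hx
    exact absurd (h i) (not_lt.2 hi.le)
  obtain ⟨g, hg⟩ := geometric_hahn_banach_open_point hTv hTo hp
  set c : ι → ℝ := fun i => -g (Pi.single i 1) with hc
  have hgc : ∀ y, g y = -∑ i, c i * y i := by
    intro y
    conv_lhs => rw [pi_eq_sum_univ' y]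
    simp only [map_sum, map_smul, hc, smul_eq_mul, neg_mul, Finset.sum_neg_distrib, neg_neg]
    exact Finset.sum_congr rfl fun i _ => mul_comm _ _
  obtain ⟨x₀, hx₀⟩ := hC
  have hkey : ∀ x ∈ C, (∑ i, c i) * (D + γ) ≤ ∑ i, c i * f i x := by
    intro x hx
    refine le_of_forall_pos_le_add fun r hr => ?_
    set M := ∑ i, |c i| with hM
    have hM0 : 0 ≤ M := Finset.sum_nonneg fun i _ => abs_nonneg _
    have := hg (fun i => f i x + r / (M + 1)) ⟨x, hx, fun i => by
      have : 0 < r / (M + 1) := by positivity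
      linarith⟩
    rw [hgc, hgc] at this
    simp only [mul_add, Finset.sum_add_distrib, ← Finset.sum_mul] at this ⊢
    have h1 : (∑ i, c i) * (r / (M + 1)) ≤ r := by
      have h2 : ∑ i, c i ≤ M := Finset.sum_le_sum fun i _ => le_abs_self _
      have h3 : 0 ≤ r / (M + 1) := by positivity
      calc (∑ i, c i) * (r / (M + 1)) ≤ (M + 1) * (r / (M + 1)) :=
            mul_le_mul_of_nonneg_right (by linarith) h3
        _ = r := by field_simp
    linarith
  have hc0 : ∀ i, 0 ≤ c i := by
    intro i
    by_contra! hneg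
    -- otherwise moving far along the `i`-th axis violates the separation
    set s : ℝ := |(∑ j, c j * (f j x₀ + 1)) - ∑ j, c j * (D + γ)| / (-c i) with hs
    have hs0 : 0 ≤ s := div_nonneg (abs_nonneg _) (by linarith)
    have := hg (fun j => f j x₀ + 1 + if j = i then s else 0) ⟨x₀, hx₀, fun j => by
      dsimp only
      split_ifs <;> linarith⟩
    rw [hgc, hgc] at this
    have h1 : ∑ j, c j * (f j x₀ + 1 + if j = i then s else 0)
        = (∑ j, c j * (f j x₀ + 1)) + c i * s := by
      simp [mul_add, Finset.sum_add_distrib]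
    rw [h1] at this
    have h2 : c i * s = -|(∑ j, c j * (f j x₀ + 1)) - ∑ j, c j * (D + γ)| := by
      rw [hs, mul_div_assoc', div_neg, mul_div_cancel_left₀ _ hneg.ne]
    rw [h2] at this
    have h3 := le_abs_self ((∑ j, c j * (f j x₀ + 1)) - ∑ j, c j * (D + γ))
    linarith
  have hpos : 0 < ∑ i, c i := by
    refine (Finset.sum_nonneg fun i _ => hc0 i).lt_of_ne fun h0 => ?_
    have hz : ∀ i, c i = 0 := fun i =>
      (Finset.sum_eq_zero_iff_of_nonneg fun i _ => hc0 i).1 h0.symm i (Finset.mem_univ i)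
    have := hg (fun i => f i x₀ + 1) ⟨x₀, hx₀, fun i => by linarith⟩
    rw [hgc, hgc] at this
    simp [hz] at this
  obtain ⟨x, hx, hxD⟩ := hD (fun i => c i / ∑ j, c j) (fun i => div_nonneg (hc0 i) hpos.le)
    (by rw [← Finset.sum_div, div_self hpos.ne']) (γ / 2) (by linarith)
  have h1 : ∑ i, c i / (∑ j, c j) * f i x = (∑ i, c i * f i x) / ∑ j, c j := by
    rw [Finset.sum_div]
    exact Finset.sum_congr rfl fun i _ => by ring
  rw [h1, div_le_iff₀ hpos] at hxD
  have := hkey x hx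
  nlinarith

/-- A minimax principle. If every finite convex combination of the convex, sequentially closed
functions `f i` has infimum at most `D` over a bounded closed convex set, then some point of the
set satisfies `f i x ≤ D` for all `i`. -/
theorem exists_forall_le_of_finite_convex_combinations {X : Type*} [NormedAddCommGroup X]
    [InnerProductSpace ℝ X] [CompleteSpace X] {ι : Type*} {C : Set X} (hne : C.Nonempty)
    (hb : Bornology.IsBounded C) (hcl : IsClosed C) (hv : Convex ℝ C) {f : ι → X → ℝ}
    (hf : ∀ i, ConvexOn ℝ C (f i)) (hfc : ∀ i c, IsClosed {x ∈ C | f i x ≤ c}) {D : ℝ}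
    (hD : ∀ (s : Finset ι) (w : ι → ℝ), (∀ i ∈ s, 0 ≤ w i) → ∑ i ∈ s, w i = 1 → ∀ γ > 0,
      ∃ x ∈ C, ∑ i ∈ s, w i * f i x ≤ D + γ) :
    ∃ x ∈ C, ∀ i, f i x ≤ D := by
  classical
  obtain ⟨x, hx, hx'⟩ := nonempty_inter_of_finite_inter
    (ι := ι × {γ : ℝ // 0 < γ}) (C := fun p => {x ∈ C | f p.1 x ≤ D + p.2}) hb hcl hv
    (fun p => hfc _ _) (fun p => (hf _).convex_le _) (fun s => by
      rcases s.eq_empty_or_nonempty with rfl | hs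
      · simpa using hne
      obtain ⟨p₀, hp₀, hmin⟩ := s.exists_min_image (fun p => (p.2 : ℝ)) hs
      obtain ⟨x, hx, hle⟩ := exists_forall_le_of_convex_combinations
        (ι := s.image Prod.fst) hne (f := fun i => f i) (fun i => hf i) (D := D)
        (fun w hw hw1 γ hγ => by
          set w' : ι → ℝ := fun i => if h : i ∈ s.image Prod.fst then w ⟨i, h⟩ else 0 with hw'
          have hsum : ∀ F : ι → ℝ, ∑ i ∈ s.image Prod.fst, w' i * F i
              = ∑ i : s.image Prod.fst, w i * F i := by
            intro F
            rw [← Finset.sum_coe_sort]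
            refine Finset.sum_congr rfl fun i _ => ?_
            simp [hw', i.2, -Finset.mem_image]
          have h1 := hsum fun _ => 1
          simp only [mul_one] at h1
          obtain ⟨x, hx, hle⟩ := hD (s.image Prod.fst) w' (fun i hi => by
            simp only [hw', hi, dif_pos]; exact hw _) (h1.trans hw1) γ hγ
          exact ⟨x, hx, (hsum fun i => f i x) ▸ hle⟩) p₀.2.2
      refine ⟨x, hx, mem_iInter₂.2 fun p hp => ⟨hx, ?_⟩⟩
      have := hle ⟨p.1, Finset.mem_image_of_mem _ hp⟩
      have h2 := hmin p hp
      linarith)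
  refine ⟨x, hx, fun i => le_of_forall_pos_le_add fun γ hγ => ?_⟩
  exact (mem_iInter.1 hx' (i, ⟨γ, hγ⟩)).2

/-- A linear functional which is bounded by the norm of a linear map into a Hilbert space is
represented by a vector of that space. -/
theorem exists_inner_eq_of_abs_le {V X : Type*} [AddCommGroup V] [Module ℝ V]
    [NormedAddCommGroup X] [InnerProductSpace ℝ X] [CompleteSpace X] (T : V →ₗ[ℝ] X)
    (Φ : V →ₗ[ℝ] ℝ) {c : ℝ} (h : ∀ v, |Φ v| ≤ c * ‖T v‖) : ∃ x : X, ∀ v, Φ v = ⟪x, T v⟫_ℝ := by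
  obtain ⟨g, hg⟩ := T.rangeRestrict.exists_rightInverse_of_surjective T.range_rangeRestrict
  have hTg : ∀ y : LinearMap.range T, T (g y) = y := fun y => by
    have := congrArg Subtype.val (LinearMap.congr_fun hg y)
    simpa using this
  set F : LinearMap.range T →L[ℝ] ℝ := (Φ ∘ₗ g).mkContinuous c (fun y => by
    have := h (g y)
    rw [hTg] at this
    simpa using this) with hF
  obtain ⟨G, hG, -⟩ := _root_.exists_extension_norm_eq _ F
  refine ⟨(InnerProductSpace.toDual ℝ X).symm G, fun v => ?_⟩
  rw [InnerProductSpace.toDual_symm_apply]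
  have h1 := hG ⟨T v, LinearMap.mem_range_self T v⟩
  simp only at h1
  rw [h1]
  have h2 := h (v - g ⟨T v, LinearMap.mem_range_self T v⟩)
  rw [map_sub, map_sub, hTg] at h2
  simp only [sub_self, norm_zero, mul_zero, abs_nonpos_iff, sub_eq_zero] at h2
  simpa [hF] using h2

/-! ### Sobolev curves on the unit interval -/

/-- The product rule for the inner product of two Sobolev curves, integrated over `[0, 1]`. -/
theorem integral_inner_add_inner {E : Type*} [NormedAddCommGroup E] [InnerProductSpace ℝ E]
    [FiniteDimensional ℝ E] {f f' g g' : ℝ → E}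
    (hf' : IntervalIntegrable f' volume 0 1) (hg' : IntervalIntegrable g' volume 0 1)
    (hf : ∀ t ∈ Icc (0 : ℝ) 1, f t = f 0 + ∫ s in (0 : ℝ)..t, f' s)
    (hg : ∀ t ∈ Icc (0 : ℝ) 1, g t = g 0 + ∫ s in (0 : ℝ)..t, g' s) :
    IntervalIntegrable (fun t => ⟪f' t, g t⟫_ℝ + ⟪f t, g' t⟫_ℝ) volume 0 1 ∧
    ∫ t in (0 : ℝ)..1, (⟪f' t, g t⟫_ℝ + ⟪f t, g' t⟫_ℝ) = ⟪f 1, g 1⟫_ℝ - ⟪f 0, g 0⟫_ℝ := by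
  set b := stdOrthonormalBasis ℝ E
  have hscalar : ∀ {f f' : ℝ → E}, IntervalIntegrable f' volume 0 1 →
      (∀ t ∈ Icc (0 : ℝ) 1, f t = f 0 + ∫ s in (0 : ℝ)..t, f' s) → ∀ i,
      IntervalIntegrable (fun t => ⟪b i, f' t⟫_ℝ) volume 0 1 ∧
      ∀ t ∈ Icc (0 : ℝ) 1, ⟪b i, f t⟫_ℝ = ⟪b i, f 0⟫_ℝ + ∫ s in (0 : ℝ)..t, ⟪b i, f' s⟫_ℝ := by
    intro f f' hf' hf i
    have hI : IntervalIntegrable (fun t => ⟪b i, f' t⟫_ℝ) volume 0 1 :=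
      ⟨hf'.1.const_inner _, hf'.2.const_inner _⟩
    refine ⟨hI, fun t ht => ?_⟩
    have hsub : IntervalIntegrable f' volume 0 t :=
      hf'.mono_set (by
        rw [uIcc_of_le ht.1, uIcc_of_le zero_le_one]
        exact Icc_subset_Icc_right ht.2)
    conv_lhs => rw [hf t ht]
    rw [inner_add_right]
    congr 1
    exact ((innerSL ℝ (b i)).intervalIntegral_comp_comm hsub).symm
  have key : ∀ i, IntervalIntegrable
      (fun t => ⟪b i, f' t⟫_ℝ * ⟪b i, g t⟫_ℝ + ⟪b i, f t⟫_ℝ * ⟪b i, g' t⟫_ℝ) volume 0 1 ∧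
      ∫ t in (0 : ℝ)..1, (⟪b i, f' t⟫_ℝ * ⟪b i, g t⟫_ℝ + ⟪b i, f t⟫_ℝ * ⟪b i, g' t⟫_ℝ)
        = ⟪b i, f 1⟫_ℝ * ⟪b i, g 1⟫_ℝ - ⟪b i, f 0⟫_ℝ * ⟪b i, g 0⟫_ℝ := by
    intro i
    obtain ⟨hI, hF⟩ := hscalar hf' hf i
    obtain ⟨hJ, hG⟩ := hscalar hg' hg i
    set φ : ℝ → ℝ := fun t => ⟪b i, f 0⟫_ℝ + ∫ s in (0 : ℝ)..t, ⟪b i, f' s⟫_ℝ with hφ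
    set ψ : ℝ → ℝ := fun t => ⟪b i, g 0⟫_ℝ + ∫ s in (0 : ℝ)..t, ⟪b i, g' s⟫_ℝ with hψ
    have hac : ∀ (c : ℝ) {u : ℝ → ℝ}, IntervalIntegrable u volume 0 1 →
        AbsolutelyContinuousOnInterval (fun t => c + ∫ s in (0 : ℝ)..t, u s) 0 1 ∧
        ∀ᵐ x, x ∈ uIcc (0 : ℝ) 1 → deriv (fun t => c + ∫ s in (0 : ℝ)..t, u s) x = u x := by
      intro c u hu
      constructor
      · have h1 := hu.absolutelyContinuousOnInterval_intervalIntegral (c := 0) (by simp)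
        have h0 : AbsolutelyContinuousOnInterval (fun _ : ℝ => c) 0 1 :=
          (LipschitzWith.const c).lipschitzOnWith.absolutelyContinuousOnInterval
        exact h0.add h1
      · filter_upwards [hu.ae_hasDerivAt_integral] with x hx hx'
        simpa using ((hx hx' 0 (by simp)).const_add c).deriv
    obtain ⟨hφ1, hφ2⟩ := hac ⟪b i, f 0⟫_ℝ hI
    obtain ⟨hψ1, hψ2⟩ := hac ⟪b i, g 0⟫_ℝ hJ
    have hmain := hφ1.integral_deriv_mul_eq_sub hψ1
    have h01 : uIcc (0 : ℝ) 1 = Icc 0 1 := uIcc_of_le zero_le_one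
    have hΙ : uIoc (0 : ℝ) 1 ⊆ Icc 0 1 := by
      rw [uIoc_of_le zero_le_one]; exact Ioc_subset_Icc_self
    have hcongr : ∀ᵐ x, x ∈ uIoc (0 : ℝ) 1 → deriv φ x * ψ x + φ x * deriv ψ x
        = ⟪b i, f' x⟫_ℝ * ⟪b i, g x⟫_ℝ + ⟪b i, f x⟫_ℝ * ⟪b i, g' x⟫_ℝ := by
      filter_upwards [hφ2, hψ2] with x hx hx' hmem
      have hm := hΙ hmem
      rw [hF x hm, hG x hm, hx (h01 ▸ hm), hx' (h01 ▸ hm)]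
    constructor
    · have h1 : IntervalIntegrable (fun t => deriv φ t * ψ t + φ t * deriv ψ t) volume 0 1 :=
        (hφ1.intervalIntegrable_deriv.mul_continuousOn hψ1.continuousOn).add
          (hψ1.intervalIntegrable_deriv.continuousOn_mul hφ1.continuousOn)
      refine h1.congr_ae ?_
      rw [EventuallyEq, ae_restrict_iff' measurableSet_uIoc]
      exact hcongr
    · rw [← intervalIntegral.integral_congr_ae hcongr]
      refine hmain.trans ?_
      have h0 : (0 : ℝ) ∈ Icc (0 : ℝ) 1 := by simp
      have h1 : (1 : ℝ) ∈ Icc (0 : ℝ) 1 := by simp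
      rw [← hF 0 h0, ← hG 0 h0, ← hF 1 h1, ← hG 1 h1]
  have hexp : ∀ x y : E, ⟪x, y⟫_ℝ = ∑ i, ⟪b i, x⟫_ℝ * ⟪b i, y⟫_ℝ := by
    intro x y
    rw [← b.sum_inner_mul_inner x y]
    exact Finset.sum_congr rfl fun i _ => by rw [real_inner_comm x]
  have hfun : (fun t => ⟪f' t, g t⟫_ℝ + ⟪f t, g' t⟫_ℝ) = fun t => ∑ i,
      (⟪b i, f' t⟫_ℝ * ⟪b i, g t⟫_ℝ + ⟪b i, f t⟫_ℝ * ⟪b i, g' t⟫_ℝ) := by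
    ext t
    rw [hexp (f' t), hexp (f t), Finset.sum_add_distrib]
  rw [hfun]
  constructor
  · have := IntervalIntegrable.sum Finset.univ fun i _ => (key i).1
    refine this.congr ?_
    intro t _
    simp
  · rw [intervalIntegral.integral_finsetSum fun i _ => (key i).1, hexp (f 1), hexp (f 0),
      ← Finset.sum_sub_distrib]
    exact Finset.sum_congr rfl fun i _ => (key i).2

/-! ### Abstract transport problems -/

section Abstract

variable {E F : Type*} [NormedAddCommGroup E] [InnerProductSpace ℝ E] [FiniteDimensional ℝ E]
  [NormedAddCommGroup F] [InnerProductSpace ℝ F] [FiniteDimensional ℝ F]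

/-- The finite-dimensional data behind a dynamical transport distance: a unit vector `u` (the
identity matrix), a gradient `N`, a generator `L`, a compact convex set `S` of densities, an open
convex cone `P` of strictly positive elements, and a quadratic form `q(ρ)(X) = ⟪Q ρ X, X⟫` on
vector fields, which is positive definite, superadditive and homogeneous for `ρ ∈ P`. On the
possibly singular elements of `S` nothing but an upper bound is required. -/
structure TransportData (u : E) (N : E →L[ℝ] F) (L : E →L[ℝ] E) (S P : Set E)
    (Q : E → F →L[ℝ] F) : Prop where
  norm_u : ‖u‖ = 1
  N_u : N u = 0
  L_u : L u = 0
  ker_N : ∀ A, N A = 0 → ∃ c : ℝ, A = c • u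
  compact : IsCompact S
  convex : Convex ℝ S
  inner_u : ∀ ρ ∈ S, ⟪u, ρ⟫_ℝ = 1
  isOpen : IsOpen P
  add_mem : ∀ ρ ∈ P, ∀ ρ' ∈ P, ρ + ρ' ∈ P
  smul_mem : ∀ c : ℝ, 0 < c → ∀ ρ ∈ P, c • ρ ∈ P
  add_smul_mem : ∀ ρ ∈ S, ∀ η : ℝ, 0 < η → ρ + η • u ∈ P
  symm : ∀ ρ ∈ P, ∀ X Y, ⟪Q ρ X, Y⟫_ℝ = ⟪X, Q ρ Y⟫_ℝ
  pos : ∀ ρ ∈ P, ∀ X, X ≠ 0 → 0 < ⟪Q ρ X, X⟫_ℝ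
  superadd : ∀ ρ ∈ P, ∀ ρ' ∈ P, ∀ X, ⟪Q ρ X, X⟫_ℝ + ⟪Q ρ' X, X⟫_ℝ ≤ ⟪Q (ρ + ρ') X, X⟫_ℝ
  homog : ∀ c : ℝ, 0 < c → ∀ ρ ∈ P, ∀ X, ⟪Q (c • ρ) X, X⟫_ℝ = c * ⟪Q ρ X, X⟫_ℝ
  le_add : ∀ ρ ∈ S, ∀ η : ℝ, 0 < η → ∀ X, ⟪Q ρ X, X⟫_ℝ ≤ ⟪Q (ρ + η • u) X, X⟫_ℝ

namespace TransportData

variable {u : E} {N : E →L[ℝ] F} {L : E →L[ℝ] E} {S P : Set E} {Q : E → F →L[ℝ] F}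

theorem nonneg (h : TransportData u N L S P Q) {ρ : E} (hρ : ρ ∈ P) (X : F) :
    0 ≤ ⟪Q ρ X, X⟫_ℝ := by
  rcases eq_or_ne X 0 with rfl | hX
  · simp
  · exact (h.pos ρ hρ X hX).le

theorem convex_cone (h : TransportData u N L S P Q) : Convex ℝ P := by
  intro x hx y hy a b ha hb hab
  rcases ha.eq_or_lt with rfl | ha
  · obtain rfl : b = 1 := by linarith
    simpa using hy
  rcases hb.eq_or_lt with rfl | hb
  · obtain rfl : a = 1 := by linarith
    simpa using hx
  exact h.add_mem _ (h.smul_mem a ha x hx) _ (h.smul_mem b hb y hy)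

theorem concaveOn (h : TransportData u N L S P Q) (X : F) :
    ConcaveOn ℝ P fun ρ => ⟪Q ρ X, X⟫_ℝ := by
  refine ⟨h.convex_cone, fun x hx y hy a b ha hb hab => ?_⟩
  rcases ha.eq_or_lt with rfl | ha
  · obtain rfl : b = 1 := by linarith
    simp
  rcases hb.eq_or_lt with rfl | hb
  · obtain rfl : a = 1 := by linarith
    simp
  have := h.superadd _ (h.smul_mem a ha x hx) _ (h.smul_mem b hb y hy) X
  rwa [h.homog a ha x hx, h.homog b hb y hy] at this

/-- A concave function on an open subset of a finite-dimensional space is continuous; by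
polarization this extends from the quadratic forms to the operators. -/
theorem continuousOn (h : TransportData u N L S P Q) : ContinuousOn Q P := by
  have hq : ∀ X, ContinuousOn (fun ρ => ⟪Q ρ X, X⟫_ℝ) P := fun X =>
    (h.concaveOn X).continuousOn h.isOpen
  have hb : ∀ X Y, ContinuousOn (fun ρ => ⟪Y, Q ρ X⟫_ℝ) P := by
    intro X Y
    have h1 : ContinuousOn
        (fun ρ => (⟪Q ρ (X + Y), X + Y⟫_ℝ - ⟪Q ρ (X - Y), X - Y⟫_ℝ) / 4) P :=
      ((hq _).sub (hq _)).div_const 4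
    refine h1.congr fun ρ hρ => ?_
    have h2 := h.symm ρ hρ X Y
    have h3 := real_inner_comm X (Q ρ Y)
    have h4 := real_inner_comm Y (Q ρ X)
    simp only [map_add, map_sub, inner_add_left, inner_add_right, inner_sub_left, inner_sub_right]
    linarith
  rw [continuousOn_clm_apply]
  intro X
  set b := stdOrthonormalBasis ℝ F
  have h1 : ContinuousOn (fun ρ => ∑ i, ⟪b i, Q ρ X⟫_ℝ • b i) P :=
    continuousOn_finsetSum _ fun i _ => (hb X (b i)).smul continuousOn_const
  exact h1.congr fun ρ _ => (b.sum_repr' (Q ρ X)).symm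

/-- The elliptic operator `A ↦ N† Q(ρ) N A`, made invertible by adding the projection onto `u`. -/
noncomputable def elliptic (u : E) (N : E →L[ℝ] F) (Q : E → F →L[ℝ] F) (ρ : E) : E →L[ℝ] E :=
  ContinuousLinearMap.adjoint N ∘L Q ρ ∘L N + (innerSL ℝ u).smulRight u

theorem inner_elliptic (A B : E) (ρ : E) :
    ⟪elliptic u N Q ρ A, B⟫_ℝ = ⟪Q ρ (N A), N B⟫_ℝ + ⟪u, A⟫_ℝ * ⟪u, B⟫_ℝ := by
  simp [elliptic, inner_add_left, ContinuousLinearMap.adjoint_inner_left, inner_smul_left]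

theorem isUnit_elliptic (h : TransportData u N L S P Q) {ρ : E} (hρ : ρ ∈ P) :
    IsUnit (elliptic u N Q ρ) := by
  have hinj : Function.Injective (elliptic u N Q ρ : E →ₗ[ℝ] E) := by
    rw [injective_iff_map_eq_zero]
    intro A hA
    have h1 := inner_elliptic (u := u) (N := N) (Q := Q) A A ρ
    have hA' : elliptic u N Q ρ A = 0 := hA
    rw [hA', inner_zero_left] at h1
    have h2 := h.nonneg hρ (N A)
    have h3 := mul_self_nonneg ⟪u, A⟫_ℝ
    have h4 : N A = 0 := by
      by_contra hne
      have := h.pos ρ hρ _ hne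
      linarith
    obtain ⟨c, rfl⟩ := h.ker_N A h4
    have h5 : ⟪u, c • u⟫_ℝ = 0 := by
      have : ⟪u, c • u⟫_ℝ * ⟪u, c • u⟫_ℝ = 0 := by linarith
      simpa using this
    rw [inner_smul_right, real_inner_self_eq_norm_sq, h.norm_u] at h5
    have : c = 0 := by simpa using h5
    simp [this]
  let e := (LinearEquiv.ofInjectiveEndo _ hinj).toContinuousLinearEquiv
  refine ⟨ContinuousLinearEquiv.toUnit e, ?_⟩
  ext A
  rfl

theorem continuousOn_inverse_elliptic (h : TransportData u N L S P Q) :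
    ContinuousOn (fun ρ => Ring.inverse (elliptic u N Q ρ)) P := by
  have h1 : ContinuousOn (elliptic u N Q) P := by
    unfold elliptic
    refine ContinuousOn.add ?_ continuousOn_const
    exact continuousOn_const.clm_comp (h.continuousOn.clm_comp continuousOn_const)
  intro ρ hρ
  obtain ⟨x, hx⟩ := h.isUnit_elliptic hρ
  have h2 := NormedRing.inverse_continuousAt x
  rw [hx] at h2
  exact h2.comp_continuousWithinAt (h1 ρ hρ)

/-- Solution of the elliptic equation `N† Q(ρ) N A = g` for `g` orthogonal to `u`. -/
theorem elliptic_solve (h : TransportData u N L S P Q) {ρ : E} (hρ : ρ ∈ P) {g : E}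
    (hg : ⟪u, g⟫_ℝ = 0) :
    ContinuousLinearMap.adjoint N (Q ρ (N (Ring.inverse (elliptic u N Q ρ) g))) = g := by
  set a := Ring.inverse (elliptic u N Q ρ) g with ha
  have h1 : elliptic u N Q ρ a = g := by
    have := Ring.mul_inverse_cancel _ (h.isUnit_elliptic hρ)
    exact congrArg (fun T : E →L[ℝ] E => T g) this
  have h2 := inner_elliptic (u := u) (N := N) (Q := Q) a u ρ
  rw [h1, h.N_u, inner_zero_right, real_inner_self_eq_norm_sq, h.norm_u, real_inner_comm, hg] at h2
  have h3 : ⟪u, a⟫_ℝ = 0 := by linarith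
  have h4 : elliptic u N Q ρ a = ContinuousLinearMap.adjoint N (Q ρ (N a)) := by
    simp [elliptic, h3]
  rw [← h4, h1]

end TransportData

/-! ### Integrals along measurable curves -/

/-- Lebesgue measure on the unit interval. -/
noncomputable abbrev unitMeasure : Measure ℝ := volume.restrict (Icc (0 : ℝ) 1)

instance : IsProbabilityMeasure unitMeasure := ⟨by simp⟩

theorem ae_mem_Icc : ∀ᵐ t ∂unitMeasure, t ∈ Icc (0 : ℝ) 1 := ae_restrict_mem measurableSet_Icc

theorem exists_bound_of_continuousOn {S : Set E} (hS : IsCompact S) {G : Type*}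
    [NormedAddCommGroup G] {f : ℝ → E → G}
    (hf : ContinuousOn (Function.uncurry f) (Icc (0 : ℝ) 1 ×ˢ S)) :
    ∃ C, ∀ t ∈ Icc (0 : ℝ) 1, ∀ x ∈ S, ‖f t x‖ ≤ C := by
  obtain ⟨C, hC⟩ := (isCompact_Icc.prod hS).exists_bound_of_continuousOn hf
  exact ⟨C, fun t ht x hx => hC (t, x) ⟨ht, hx⟩⟩

theorem aestronglyMeasurable_comp_curve {S : Set E} (hS : IsCompact S) {G : Type*}
    [NormedAddCommGroup G] [NormedSpace ℝ G] [FiniteDimensional ℝ G] {f : ℝ → E → G}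
    (hf : ContinuousOn (Function.uncurry f) (Icc (0 : ℝ) 1 ×ˢ S)) {x : ℝ → E}
    (hx : AEStronglyMeasurable x unitMeasure) (hxS : ∀ᵐ t ∂unitMeasure, x t ∈ S) :
    AEStronglyMeasurable (fun t => f t (x t)) unitMeasure := by
  classical
  borelize E
  borelize G
  have hmeas : MeasurableSet (Icc (0 : ℝ) 1 ×ˢ S) := measurableSet_Icc.prod hS.measurableSet
  have h1 : Measurable ((Icc (0 : ℝ) 1 ×ˢ S).piecewise (Function.uncurry f) fun _ => 0) :=
    hf.measurable_piecewise continuousOn_const hmeas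
  have h2 : AEMeasurable (fun t => (t, x t)) unitMeasure := aemeasurable_id.prodMk hx.aemeasurable
  refine AEStronglyMeasurable.congr (h1.comp_aemeasurable h2).aestronglyMeasurable ?_
  filter_upwards [ae_mem_Icc, hxS] with t ht hxt
  simp only [Function.comp]
  rw [piecewise_eq_of_mem _ _ _ (show (t, x t) ∈ Icc (0 : ℝ) 1 ×ˢ S from ⟨ht, hxt⟩)]
  rfl

theorem integrable_comp_curve {S : Set E} (hS : IsCompact S) {f : ℝ → E → ℝ}
    (hf : ContinuousOn (Function.uncurry f) (Icc (0 : ℝ) 1 ×ˢ S)) {x : ℝ → E}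
    (hx : AEStronglyMeasurable x unitMeasure) (hxS : ∀ᵐ t ∂unitMeasure, x t ∈ S) :
    Integrable (fun t => f t (x t)) unitMeasure := by
  obtain ⟨C, hC⟩ := exists_bound_of_continuousOn hS hf
  refine Integrable.of_bound (aestronglyMeasurable_comp_curve hS hf hx hxS) C ?_
  filter_upwards [ae_mem_Icc, hxS] with t ht hxt using hC t ht _ hxt

/-- The square integrable curves with values in a given set. -/
def curveSet (S : Set E) : Set (Lp E 2 unitMeasure) := {x | ∀ᵐ t ∂unitMeasure, x t ∈ S}

theorem convex_curveSet {S : Set E} (hS : Convex ℝ S) : Convex ℝ (curveSet S) := by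
  intro x hx y hy a b ha hb hab
  have h1 := Lp.coeFn_add (a • x) (b • y)
  have h2 := Lp.coeFn_smul a x
  have h3 := Lp.coeFn_smul b y
  simp only [curveSet, mem_ofPred_eq] at hx hy ⊢
  filter_upwards [hx, hy, h1, h2, h3] with t hx hy h1 h2 h3
  rw [h1, Pi.add_apply, h2, h3]
  exact hS hx hy ha hb hab

theorem isBounded_curveSet {S : Set E} (hS : IsCompact S) :
    Bornology.IsBounded (curveSet S) := by
  obtain ⟨R, hR⟩ := hS.isBounded.exists_norm_le
  refine isBounded_iff_forall_norm_le.2 ⟨max R 0, fun x hx => ?_⟩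
  have := Lp.norm_le_of_ae_bound (f := x) (le_max_right R 0) (by
    filter_upwards [hx] with t ht using (hR _ ht).trans (le_max_left _ _))
  simpa [measureUnivNNReal] using this

/-- Superlevel sets of an integral functional with continuous integrand are closed, by almost
everywhere convergence of a subsequence and dominated convergence. -/
theorem isClosed_le_integral_curve {S : Set E} (hS : IsCompact S) {f : ℝ → E → ℝ}
    (hf : ContinuousOn (Function.uncurry f) (Icc (0 : ℝ) 1 ×ˢ S)) (c : ℝ) :
    IsClosed {x ∈ curveSet S | c ≤ ∫ t, f t (x t) ∂unitMeasure} := by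
  refine IsSeqClosed.isClosed fun x y hx hxy => ?_
  obtain ⟨C, hC⟩ := exists_bound_of_continuousOn hS hf
  obtain ⟨φ, -, hφ⟩ := (tendstoInMeasure_of_tendsto_Lp hxy).exists_seq_tendsto_ae
  have hall : ∀ᵐ t ∂unitMeasure, ∀ k, x k t ∈ S := ae_all_iff.2 fun k => (hx k).1
  have hy : y ∈ curveSet S := by
    simp only [curveSet, mem_ofPred_eq]
    filter_upwards [hall, hφ] with t ht ht'
    exact hS.isClosed.mem_of_tendsto ht' (Eventually.of_forall fun k => ht _)
  refine ⟨hy, ?_⟩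
  have hlim : Tendsto (fun k => ∫ t, f t (x (φ k) t) ∂unitMeasure) atTop
      (𝓝 (∫ t, f t (y t) ∂unitMeasure)) := by
    refine tendsto_integral_of_dominated_convergence (fun _ => C)
      (fun k => aestronglyMeasurable_comp_curve hS hf (Lp.aestronglyMeasurable _) (hx _).1)
      (integrable_const C) (fun k => ?_) ?_
    · filter_upwards [ae_mem_Icc, hall] with t ht ht' using hC t ht _ (ht' _)
    · filter_upwards [ae_mem_Icc, hall, hφ, hy] with t ht h1 h2 h3
      have h4 : Tendsto (fun k => (t, x (φ k) t)) atTop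
          (𝓝[Icc (0 : ℝ) 1 ×ˢ S] (t, y t)) :=
        tendsto_nhdsWithin_iff.2 ⟨tendsto_const_nhds.prodMk_nhds h2,
          Eventually.of_forall fun k => ⟨ht, h1 _⟩⟩
      exact (hf (t, y t) ⟨ht, h3⟩).tendsto.comp h4
  exact ge_of_tendsto' hlim fun k => (hx _).2

theorem isClosed_curveSet {S : Set E} (hS : IsCompact S) : IsClosed (curveSet S) := by
  have := isClosed_le_integral_curve hS (f := fun _ _ => (0 : ℝ)) continuousOn_const 0
  simpa using this

end Abstract

/-! ### Near-optimal curves of densities for a fixed potential -/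

section Abstract

variable {E F : Type*} [NormedAddCommGroup E] [InnerProductSpace ℝ E] [FiniteDimensional ℝ E]
  [NormedAddCommGroup F] [InnerProductSpace ℝ F] [FiniteDimensional ℝ F]

theorem integral_unitMeasure {G : Type*} [NormedAddCommGroup G] [NormedSpace ℝ G] (f : ℝ → G) :
    ∫ t, f t ∂unitMeasure = ∫ t in (0 : ℝ)..1, f t := by
  rw [intervalIntegral.integral_of_le zero_le_one, integral_Icc_eq_integral_Ioc]

theorem intervalIntegrable_iff_unitMeasure {G : Type*} [NormedAddCommGroup G] {f : ℝ → G} :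
    IntervalIntegrable f volume 0 1 ↔ Integrable f unitMeasure := by
  rw [intervalIntegrable_iff_integrableOn_Icc_of_le zero_le_one]; rfl

theorem integrable_of_continuous {G : Type*} [NormedAddCommGroup G] {f : ℝ → G}
    (hf : Continuous f) : Integrable f unitMeasure :=
  intervalIntegrable_iff_unitMeasure.1 (hf.intervalIntegrable 0 1)

theorem contDiff_primitive {G : Type*} [NormedAddCommGroup G] [NormedSpace ℝ G] [CompleteSpace G]
    {g : ℝ → G} (hg : ContDiff ℝ (⊤ : ℕ∞) g) :
    ContDiff ℝ (⊤ : ℕ∞) (fun t => ∫ s in (0 : ℝ)..t, g s) ∧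
      ∀ t, HasDerivAt (fun t => ∫ s in (0 : ℝ)..t, g s) (g t) t := by
  have h1 : ∀ t, HasDerivAt (fun t => ∫ s in (0 : ℝ)..t, g s) (g t) t := fun t =>
    intervalIntegral.integral_hasDerivAt_right (hg.continuous.intervalIntegrable 0 t)
      hg.continuous.stronglyMeasurable.stronglyMeasurableAtFilter hg.continuous.continuousAt
  refine ⟨?_, h1⟩
  rw [contDiff_infty_iff_deriv]
  refine ⟨fun t => (h1 t).differentiableAt, ?_⟩
  rwa [show deriv (fun t => ∫ s in (0 : ℝ)..t, g s) = g from funext fun t => (h1 t).deriv]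

theorem eq_add_integral_deriv {G : Type*} [NormedAddCommGroup G] [NormedSpace ℝ G]
    [CompleteSpace G] {A : ℝ → G} (hA : ContDiff ℝ (⊤ : ℕ∞) A) (t : ℝ) :
    A t = A 0 + ∫ s in (0 : ℝ)..t, deriv A s := by
  rw [intervalIntegral.integral_deriv_eq_sub
    (fun s _ => (hA.differentiable (by simp)).differentiableAt)
    ((hA.continuous_deriv (by simp)).intervalIntegrable _ _)]
  abel

namespace TransportData

variable {u : E} {N : E →L[ℝ] F} {L : E →L[ℝ] E} {S P : Set E} {Q : E → F →L[ℝ] F}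

/-- Smooth subsolutions of the Hamilton-Jacobi-Bellman equation. -/
structure IsSmoothSub (N : E →L[ℝ] F) (L : E →L[ℝ] E) (S : Set E) (Q : E → F →L[ℝ] F) (ε : ℝ)
    (A : ℝ → E) : Prop where
  smooth : ContDiff ℝ (⊤ : ℕ∞) A
  le : ∀ t ∈ Icc (0 : ℝ) 1, ∀ ρ ∈ S,
    ⟪deriv A t + ε • L (A t), ρ⟫_ℝ + 1 / 2 * ⟪Q ρ (N (A t)), N (A t)⟫_ℝ ≤ 0

/-- The Hamiltonian with the density shifted by `η • u`. -/
noncomputable def ham (u : E) (N : E →L[ℝ] F) (L : E →L[ℝ] E) (Q : E → F →L[ℝ] F) (ε η : ℝ)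
    (A : ℝ → E) (t : ℝ) (ρ : E) : ℝ :=
  ⟪deriv A t + ε • L (A t), ρ⟫_ℝ + 1 / 2 * ⟪Q (ρ + η • u) (N (A t)), N (A t)⟫_ℝ

theorem continuousOn_quad (h : TransportData u N L S P Q) {A : ℝ → E} (hA : Continuous A)
    {f : ℝ → E → E} (T : Set (ℝ × E)) (hf : ContinuousOn (Function.uncurry f) T)
    (hP : ∀ p ∈ T, f p.1 p.2 ∈ P) :
    ContinuousOn (fun p : ℝ × E => ⟪Q (f p.1 p.2) (N (A p.1)), N (A p.1)⟫_ℝ) T := by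
  have h1 : ContinuousOn (fun p : ℝ × E => Q (f p.1 p.2)) T := h.continuousOn.comp hf hP
  have h2 : ContinuousOn (fun p : ℝ × E => N (A p.1)) T :=
    (N.continuous.comp (hA.comp continuous_fst)).continuousOn
  exact (h1.clm_apply h2).inner h2

theorem continuousOn_ham (h : TransportData u N L S P Q) (ε : ℝ) {η : ℝ} (hη : 0 < η)
    {A : ℝ → E} (hA : ContDiff ℝ (⊤ : ℕ∞) A) (I : Set ℝ) :
    ContinuousOn (Function.uncurry (ham u N L Q ε η A)) (I ×ˢ S) := by
  have h1 : Continuous fun p : ℝ × E => deriv A p.1 + ε • L (A p.1) :=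
    ((hA.continuous_deriv (by simp)).comp continuous_fst).add
      ((L.continuous.comp (hA.continuous.comp continuous_fst)).const_smul ε)
  have h2 := h.continuousOn_quad hA.continuous (f := fun _ ρ => ρ + η • u) (I ×ˢ S)
    (show Continuous fun p : ℝ × E => p.2 + η • u by fun_prop).continuousOn
    (fun p hp => h.add_smul_mem _ hp.2 η hη)
  exact (h1.inner continuous_snd).continuousOn.add (h2.const_smul (1 / 2 : ℝ))

/-- Subtracting a primitive of an upper bound of the Hamiltonian turns an arbitrary smooth curve
into a subsolution. Hence the infimum of the Lagrangian over measurable curves of densities does not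
exceed any upper bound `D` of the dual problem: by uniform continuity, freezing the maximizer of the
Hamiltonian on short time intervals costs arbitrarily little. -/
theorem exists_curve_le (h : TransportData u N L S P Q) {ε η : ℝ} (hη : 0 < η) {ρ₀ ρ₁ : E}
    (hρ₀ : ρ₀ ∈ S) (hρ₁ : ρ₁ ∈ S) {D : ℝ}
    (hD : ∀ A, IsSmoothSub N L S Q ε A → ⟪A 1, ρ₁⟫_ℝ - ⟪A 0, ρ₀⟫_ℝ ≤ D)
    {A : ℝ → E} (hA : ContDiff ℝ (⊤ : ℕ∞) A) {γ : ℝ} (hγ : 0 < γ) :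
    ∃ ρ : ℝ → E, StronglyMeasurable ρ ∧ (∀ t, ρ t ∈ S) ∧
      ⟪A 1, ρ₁⟫_ℝ - ⟪A 0, ρ₀⟫_ℝ - ∫ t, ham u N L Q ε η A t (ρ t) ∂unitMeasure ≤ D + γ := by
  classical
  have : CompactSpace S := isCompact_iff_compactSpace.1 h.compact
  have : Nonempty S := ⟨⟨ρ₀, hρ₀⟩⟩
  set f : ℝ → S → ℝ := fun t x => ham u N L Q ε η A t x with hf
  have hfc : Continuous (Function.uncurry f) := by
    have h1 := h.continuousOn_ham ε hη hA univ
    have h2 : Continuous fun p : ℝ × S => ((p.1, (p.2 : E)) : ℝ × E) := by fun_prop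
    exact h1.comp_continuous h2 fun p => ⟨mem_univ _, p.2.2⟩
  have hmax : ∀ t, ∃ s : S, ∀ s', f t s' ≤ f t s := fun t => by
    obtain ⟨s, -, hs⟩ := isCompact_univ.exists_isMaxOn (univ_nonempty (α := S))
      (hfc.comp (continuous_const.prodMk continuous_id :
        Continuous fun s : S => (t, s))).continuousOn
    exact ⟨s, fun s' => hs (mem_univ s')⟩
  choose s hs using hmax
  set m : ℝ → ℝ := fun t => f t (s t) with hm
  have hmc : Continuous m := by
    have := IsCompact.continuous_sSup (f := f) (K := (univ : Set S)) isCompact_univ hfc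
    convert this using 2 with t
    have hg : IsGreatest (f t '' univ) (m t) :=
      ⟨⟨s t, mem_univ _, rfl⟩, by rintro _ ⟨s', -, rfl⟩; exact hs t s'⟩
    exact hg.csSup_eq.symm
  -- a polynomial between `m` and `m + γ / 4`, so that the corrected curve stays smooth
  obtain ⟨p, hp⟩ := exists_polynomial_near_of_continuousOn 0 1 (fun t => m t + γ / 8)
    (hmc.add continuous_const).continuousOn (γ / 8) (by positivity)
  -- the corrected subsolution
  have hpc : ContDiff ℝ (⊤ : ℕ∞) fun t => p.eval t := by
    simpa using p.contDiff_aeval (𝕜 := ℝ) (⊤ : ℕ∞)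
  obtain ⟨hi1, hi2⟩ := contDiff_primitive hpc
  set I : ℝ → ℝ := fun t => ∫ s in (0 : ℝ)..t, p.eval s with hI
  have hsub : IsSmoothSub N L S Q ε fun t => A t - I t • u := by
    refine ⟨hA.sub (hi1.smul contDiff_const), fun t ht ρ hρ => ?_⟩
    have hd : deriv (fun t => A t - I t • u) t = deriv A t - p.eval t • u :=
      (((hA.differentiable (by simp)).differentiableAt.hasDerivAt).sub
        ((hi2 t).smul_const u)).deriv
    rw [hd]
    have h1 : N (A t - I t • u) = N (A t) := by simp [h.N_u]
    have h2 : L (A t - I t • u) = L (A t) := by simp [h.L_u]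
    rw [h1, h2, sub_add_eq_add_sub, inner_sub_left, inner_smul_left, h.inner_u ρ hρ]
    have h3 := h.le_add ρ hρ η hη (N (A t))
    have h4 : f t ⟨ρ, hρ⟩ ≤ m t := hs t _
    have h5 := abs_lt.1 (hp t ht)
    simp only [hf, ham] at h4
    simp only [conj_trivial, mul_one]
    linarith [h5.1]
  have hval := hD _ hsub
  have hI0 : I 0 = 0 := by simp [hI]
  simp only [hI0, zero_smul, sub_zero, inner_sub_left, inner_smul_left, h.inner_u ρ₁ hρ₁,
    conj_trivial, mul_one] at hval
  have hI1 : I 1 ≤ (∫ t, m t ∂unitMeasure) + γ / 4 := by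
    have h1 : I 1 = ∫ t, p.eval t ∂unitMeasure := (integral_unitMeasure _).symm
    have h2 : ∫ t, p.eval t ∂unitMeasure ≤ ∫ t, (m t + γ / 4) ∂unitMeasure := by
      refine integral_mono_ae (integrable_of_continuous hpc.continuous)
        (integrable_of_continuous (hmc.add continuous_const)) ?_
      filter_upwards [ae_mem_Icc] with t ht
      have := abs_lt.1 (hp t ht)
      linarith [this.2]
    rw [integral_add (integrable_of_continuous hmc) (integrable_const _)] at h2
    simp only [integral_const, probReal_univ, one_smul] at h2
    linarith
  -- the piecewise constant curve
  obtain ⟨δ, hδ, hunif⟩ : ∃ δ > 0, ∀ t ∈ Icc (0 : ℝ) 1, ∀ t' ∈ Icc (0 : ℝ) 1, |t - t'| < δ →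
      ∀ x : S, |f t x - f t' x| < γ / 8 := by
    have hK : IsCompact (Icc (0 : ℝ) 1 ×ˢ (univ : Set S)) := isCompact_Icc.prod isCompact_univ
    have huc := hK.uniformContinuousOn_of_continuous hfc.continuousOn
    obtain ⟨δ, hδ, hh⟩ := Metric.uniformContinuousOn_iff.1 huc (γ / 8) (by positivity)
    refine ⟨δ, hδ, fun t ht t' ht' htt x => ?_⟩
    have := hh (t, x) ⟨ht, mem_univ _⟩ (t', x) ⟨ht', mem_univ _⟩ (by
      simpa [Prod.dist_eq, Real.dist_eq] using htt)
    simpa [Real.dist_eq] using this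
  obtain ⟨k, hk⟩ := exists_nat_one_div_lt hδ
  set K : ℝ := (k : ℝ) + 1 with hKdef
  have hK0 : 0 < K := by positivity
  set σ : ℤ → S := fun i => s (i / K) with hσ
  refine ⟨fun t => σ ⌊K * t⌋, ?_, fun t => (σ _).2, ?_⟩
  · have h1 : StronglyMeasurable fun i : ℤ => (σ i : E) := StronglyMeasurable.of_discrete
    exact h1.comp_measurable (Int.measurable_floor.comp (measurable_const_mul K))
  have hstep : ∀ t ∈ Icc (0 : ℝ) 1, m t - γ / 4 ≤ f t (σ ⌊K * t⌋) := by
    intro t ht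
    set t' : ℝ := ⌊K * t⌋ / K with ht'
    have h1 : (⌊K * t⌋ : ℝ) ≤ K * t := Int.floor_le _
    have h2 : K * t < ⌊K * t⌋ + 1 := Int.lt_floor_add_one _
    have h3 : 0 ≤ (⌊K * t⌋ : ℝ) := by
      exact_mod_cast Int.floor_nonneg.2 (mul_nonneg hK0.le ht.1)
    have h4 : t' ≤ t := by rw [ht', div_le_iff₀ hK0]; linarith
    have h5 : t - t' < δ := by
      have : t < t' + 1 / K := by
        rw [ht', ← add_div, lt_div_iff₀ hK0]; linarith
      linarith
    have h6 : t' ∈ Icc (0 : ℝ) 1 := ⟨div_nonneg h3 hK0.le, h4.trans ht.2⟩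
    have h7 : |t - t'| < δ := by rw [abs_of_nonneg (by linarith)]; exact h5
    have h8 := abs_lt.1 (hunif t ht t' h6 h7 (s t))
    have h9 := abs_lt.1 (hunif t ht t' h6 h7 (s t'))
    have h10 := hs t' (s t)
    have h11 : σ ⌊K * t⌋ = s t' := rfl
    rw [h11]
    simp only [hm]
    linarith [h8.2, h9.1]
  have hint : (∫ t, m t ∂unitMeasure) - γ / 4
      ≤ ∫ t, ham u N L Q ε η A t (σ ⌊K * t⌋) ∂unitMeasure := by
    have h1 : ∫ t, (m t - γ / 4) ∂unitMeasure
        ≤ ∫ t, ham u N L Q ε η A t (σ ⌊K * t⌋) ∂unitMeasure := by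
      refine integral_mono_ae (integrable_of_continuous (hmc.sub continuous_const))
        (integrable_comp_curve h.compact (h.continuousOn_ham ε hη hA _) (x := fun t => σ ⌊K * t⌋)
          ?_ (Eventually.of_forall fun t => (σ _).2)) ?_
      · have h1 : StronglyMeasurable fun i : ℤ => (σ i : E) := StronglyMeasurable.of_discrete
        exact (h1.comp_measurable
          (Int.measurable_floor.comp (measurable_const_mul K))).aestronglyMeasurable
      · filter_upwards [ae_mem_Icc] with t ht using hstep t ht
    rw [integral_sub (integrable_of_continuous hmc) (integrable_const _)] at h1
    simpa using h1
  linarith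

end TransportData

end Abstract

/-! ### Existence of an optimal curve and the continuity equation -/

section Abstract

variable {E F : Type*} [NormedAddCommGroup E] [InnerProductSpace ℝ E] [FiniteDimensional ℝ E]
  [NormedAddCommGroup F] [InnerProductSpace ℝ F] [FiniteDimensional ℝ F]

theorem integrable_inner_of_memLp {f g : ℝ → E} (hf : MemLp f 2 unitMeasure)
    (hg : MemLp g 2 unitMeasure) : Integrable (fun t => ⟪f t, g t⟫_ℝ) unitMeasure := by
  refine (L2.integrable_inner (𝕜 := ℝ) hf.toLp hg.toLp).congr ?_
  filter_upwards [hf.coeFn_toLp, hg.coeFn_toLp] with t h1 h2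
  rw [h1, h2]

theorem memLp_clm_apply {T : ℝ → E →L[ℝ] F} {f : ℝ → E} (hT : ContinuousOn T (Icc 0 1))
    (hf : MemLp f 2 unitMeasure) : MemLp (fun t => T t (f t)) 2 unitMeasure := by
  obtain ⟨C, hC⟩ := isCompact_Icc.exists_bound_of_continuousOn hT
  have hTm : AEStronglyMeasurable T unitMeasure := hT.aestronglyMeasurable measurableSet_Icc
  refine MemLp.of_le_mul hf (c := C)
    ((ContinuousLinearMap.apply ℝ F).flip.aestronglyMeasurable_comp₂ hTm hf.1) ?_
  filter_upwards [ae_mem_Icc] with t ht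
  exact (T t).le_of_opNorm_le (hC t ht) _

namespace TransportData

variable {u : E} {N : E →L[ℝ] F} {L : E →L[ℝ] E} {S P : Set E} {Q : E → F →L[ℝ] F}

theorem quad_convex (h : TransportData u N L S P Q) {ρ : E} (hρ : ρ ∈ P) (X Y : F) {a b : ℝ}
    (ha : 0 ≤ a) (hb : 0 ≤ b) (hab : a + b = 1) :
    ⟪Q ρ (a • X + b • Y), a • X + b • Y⟫_ℝ ≤ a * ⟪Q ρ X, X⟫_ℝ + b * ⟪Q ρ Y, Y⟫_ℝ := by
  have h1 := h.nonneg hρ (X - Y)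
  have h2 := h.symm ρ hρ X Y
  have h3 := real_inner_comm X (Q ρ Y)
  obtain rfl : b = 1 - a := by linarith
  simp only [map_add, map_sub, map_smul, inner_add_left, inner_add_right, inner_sub_left,
    inner_sub_right, inner_smul_left, inner_smul_right, conj_trivial] at h1 ⊢
  nlinarith [mul_nonneg ha hb]

theorem concave_ham (h : TransportData u N L S P Q) {ε η : ℝ} (hη : 0 < η) (A : ℝ → E) (t : ℝ) :
    ConcaveOn ℝ S (ham u N L Q ε η A t) := by
  refine ⟨h.convex, fun x hx y hy a b ha hb hab => ?_⟩
  have h1 := (h.concaveOn (N (A t))).2 (h.add_smul_mem x hx η hη) (h.add_smul_mem y hy η hη)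
    ha hb hab
  have h2 : a • (x + η • u) + b • (y + η • u) = a • x + b • y + η • u := by
    rw [smul_add, smul_add, add_add_add_comm, ← add_smul, hab, one_smul]
  simp only [h2, smul_eq_mul] at h1
  simp only [ham, smul_eq_mul, inner_add_right, inner_smul_right]
  linarith

theorem ham_convex_left (h : TransportData u N L S P Q) {ε η : ℝ} (hη : 0 < η) {A B : ℝ → E}
    (hA : ContDiff ℝ (⊤ : ℕ∞) A) (hB : ContDiff ℝ (⊤ : ℕ∞) B) {ρ : E} (hρ : ρ ∈ S) (t : ℝ)
    {a b : ℝ} (ha : 0 ≤ a) (hb : 0 ≤ b) (hab : a + b = 1) :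
    ham u N L Q ε η (a • A + b • B) t ρ
      ≤ a * ham u N L Q ε η A t ρ + b * ham u N L Q ε η B t ρ := by
  have hd : deriv (a • A + b • B) t = a • deriv A t + b • deriv B t :=
    (((hA.differentiable (by simp)).differentiableAt.hasDerivAt.const_smul a).add
      ((hB.differentiable (by simp)).differentiableAt.hasDerivAt.const_smul b)).deriv
  have h1 := h.quad_convex (h.add_smul_mem ρ hρ η hη) (N (A t)) (N (B t)) ha hb hab
  simp only [ham, hd, Pi.add_apply, Pi.smul_apply, map_add, map_smul, inner_add_left,
    inner_smul_left, smul_add, inner_add_right, inner_smul_right, conj_trivial] at h1 ⊢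
  linarith

theorem integrable_ham (h : TransportData u N L S P Q) {ε η : ℝ} (hη : 0 < η) {A : ℝ → E}
    (hA : ContDiff ℝ (⊤ : ℕ∞) A) {x : ℝ → E} (hx : AEStronglyMeasurable x unitMeasure)
    (hxS : ∀ᵐ t ∂unitMeasure, x t ∈ S) :
    Integrable (fun t => ham u N L Q ε η A t (x t)) unitMeasure :=
  integrable_comp_curve h.compact (h.continuousOn_ham ε hη hA _) hx hxS

/-- Existence of an optimal curve of densities for the Lagrangian with shifted densities. -/
theorem exists_curve_forall_le (h : TransportData u N L S P Q) {ε η : ℝ} (hη : 0 < η) {ρ₀ ρ₁ : E}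
    (hρ₀ : ρ₀ ∈ S) (hρ₁ : ρ₁ ∈ S) {D : ℝ}
    (hD : ∀ A, IsSmoothSub N L S Q ε A → ⟪A 1, ρ₁⟫_ℝ - ⟪A 0, ρ₀⟫_ℝ ≤ D) :
    ∃ x ∈ curveSet S, ∀ A : ℝ → E, ContDiff ℝ (⊤ : ℕ∞) A →
      ⟪A 1, ρ₁⟫_ℝ - ⟪A 0, ρ₀⟫_ℝ - ∫ t, ham u N L Q ε η A t (x t) ∂unitMeasure ≤ D := by
  obtain ⟨R, hR⟩ := h.compact.isBounded.exists_norm_le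
  -- measurable curves in `S`, as elements of `L²`
  have htoLp : ∀ ρ : ℝ → E, StronglyMeasurable ρ → (∀ t, ρ t ∈ S) →
      ∃ x ∈ curveSet S, x =ᵐ[unitMeasure] ρ := by
    intro ρ hρ hρS
    have hm : MemLp ρ 2 unitMeasure := MemLp.of_bound hρ.aestronglyMeasurable R
      (Eventually.of_forall fun t => hR _ (hρS t))
    refine ⟨hm.toLp, ?_, hm.coeFn_toLp⟩
    simp only [curveSet, mem_ofPred_eq]
    filter_upwards [hm.coeFn_toLp] with t ht
    rw [ht]
    exact hρS t
  have hne : (curveSet S).Nonempty := by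
    obtain ⟨x, hx, -⟩ := htoLp (fun _ => ρ₀) stronglyMeasurable_const fun _ => hρ₀
    exact ⟨x, hx⟩
  set f : {A : ℝ → E // ContDiff ℝ (⊤ : ℕ∞) A} → Lp E 2 unitMeasure → ℝ := fun A x =>
    ⟪A.1 1, ρ₁⟫_ℝ - ⟪A.1 0, ρ₀⟫_ℝ - ∫ t, ham u N L Q ε η A t (x t) ∂unitMeasure with hf
  have hint : ∀ (A : {A : ℝ → E // ContDiff ℝ (⊤ : ℕ∞) A}), ∀ x ∈ curveSet S,
      Integrable (fun t => ham u N L Q ε η A t (x t)) unitMeasure := fun A x hx =>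
    h.integrable_ham hη A.2 (Lp.aestronglyMeasurable _) hx
  suffices hmain : ∃ x ∈ curveSet S, ∀ A, f A x ≤ D by
    obtain ⟨x, hx, hxD⟩ := hmain
    exact ⟨x, hx, fun A hA => hxD ⟨A, hA⟩⟩
  refine exists_forall_le_of_finite_convex_combinations hne (isBounded_curveSet h.compact)
    (isClosed_curveSet h.compact) (convex_curveSet h.convex) ?_ ?_ ?_
  · intro A
    refine ⟨convex_curveSet h.convex, fun x hx y hy a b ha hb hab => ?_⟩
    have hz := convex_curveSet h.convex hx hy ha hb hab
    have h1 : ∫ t, (a * ham u N L Q ε η A t (x t) + b * ham u N L Q ε η A t (y t)) ∂unitMeasure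
        ≤ ∫ t, ham u N L Q ε η A t ((a • x + b • y : Lp E 2 unitMeasure) t) ∂unitMeasure := by
      refine integral_mono_ae (((hint A x hx).const_mul a).add ((hint A y hy).const_mul b))
        (hint A _ hz) ?_
      have hx' := hx
      have hy' := hy
      simp only [curveSet, mem_ofPred_eq] at hx' hy'
      filter_upwards [hx', hy', Lp.coeFn_add (a • x) (b • y), Lp.coeFn_smul a x,
        Lp.coeFn_smul b y] with t hx hy h1 h2 h3
      rw [h1, Pi.add_apply, h2, h3]
      exact (h.concave_ham hη A t).2 hx hy ha hb hab
    rw [integral_add ((hint A x hx).const_mul a) ((hint A y hy).const_mul b),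
      integral_const_mul, integral_const_mul] at h1
    simp only [hf, smul_eq_mul]
    obtain rfl : b = 1 - a := by linarith
    linarith
  · intro A c
    have := isClosed_le_integral_curve h.compact (h.continuousOn_ham ε hη A.2 _)
      (⟪A.1 1, ρ₁⟫_ℝ - ⟪A.1 0, ρ₀⟫_ℝ - c)
    convert this using 3 with x
    simp only [hf]
    exact and_congr_right fun _ => sub_le_comm
  · intro s w hw hw1 γ hγ
    set B : ℝ → E := ∑ A ∈ s, w A • A.1 with hB
    have hBs : ContDiff ℝ (⊤ : ℕ∞) B := by
      have : B = fun t => ∑ A ∈ s, w A • A.1 t := by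
        ext t; simp [hB]
      rw [this]
      exact ContDiff.sum fun A _ => A.2.const_smul (w A)
    obtain ⟨ρ, hρm, hρS, hle⟩ := h.exists_curve_le hη hρ₀ hρ₁ hD hBs hγ
    obtain ⟨x, hx, hxρ⟩ := htoLp ρ hρm hρS
    refine ⟨x, hx, ?_⟩
    set Φ : (ℝ → E) → ℝ := fun A =>
      ⟪A 1, ρ₁⟫_ℝ - ⟪A 0, ρ₀⟫_ℝ - ∫ t, ham u N L Q ε η A t (ρ t) ∂unitMeasure with hΦ
    have hρI : ∀ A : ℝ → E, ContDiff ℝ (⊤ : ℕ∞) A →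
        Integrable (fun t => ham u N L Q ε η A t (ρ t)) unitMeasure := fun A hA =>
      h.integrable_ham hη hA hρm.aestronglyMeasurable (Eventually.of_forall hρS)
    have hconc : ConcaveOn ℝ {A : ℝ → E | ContDiff ℝ (⊤ : ℕ∞) A} Φ := by
      have hcv : Convex ℝ {A : ℝ → E | ContDiff ℝ (⊤ : ℕ∞) A} := fun A hA B hB a b _ _ _ =>
        (show ContDiff ℝ (⊤ : ℕ∞) A from hA).const_smul a |>.add
          ((show ContDiff ℝ (⊤ : ℕ∞) B from hB).const_smul b)
      refine ⟨hcv, fun A hA B hB a b ha hb hab => ?_⟩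
      have h1 : ∫ t, ham u N L Q ε η (a • A + b • B) t (ρ t) ∂unitMeasure
          ≤ ∫ t, (a * ham u N L Q ε η A t (ρ t) + b * ham u N L Q ε η B t (ρ t)) ∂unitMeasure :=
        integral_mono (hρI _ (hcv hA hB ha hb hab))
          (((hρI A hA).const_mul a).add ((hρI B hB).const_mul b))
          fun t => h.ham_convex_left hη hA hB (hρS t) t ha hb hab
      rw [integral_add ((hρI A hA).const_mul a) ((hρI B hB).const_mul b),
        integral_const_mul, integral_const_mul] at h1
      simp only [hΦ, smul_eq_mul, Pi.add_apply, Pi.smul_apply, inner_add_left, inner_smul_left,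
        conj_trivial]
      linarith
    have h1 := hconc.le_map_sum (t := s) (w := w) (p := fun A => A.1) hw hw1 fun A _ => A.2
    have h2 : ∀ A ∈ s, w A * f A x = w A • Φ A.1 := by
      intro A _
      have : ∫ t, ham u N L Q ε η A t (x t) ∂unitMeasure
          = ∫ t, ham u N L Q ε η A t (ρ t) ∂unitMeasure := by
        refine integral_congr_ae ?_
        filter_upwards [hxρ] with t ht
        rw [ht]
      simp only [hf, hΦ, smul_eq_mul, this]
    rw [Finset.sum_congr rfl h2]
    exact h1.trans hle

/-- A curve of strictly positive densities from `ρ₀` to `ρ₁` which is driven by the gradient field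
`N (A t)`, that is, a Sobolev solution of `ρ' = N† Q(ρ) N A + ε L† ρ` with square integrable
potential. -/
structure IsPath (N : E →L[ℝ] F) (L : E →L[ℝ] E) (S P : Set E) (Q : E → F →L[ℝ] F) (ε : ℝ)
    (ρ₀ ρ₁ : E) (ρ A : ℝ → E) : Prop where
  density : ∀ t ∈ Icc (0 : ℝ) 1, ρ t ∈ S ∩ P
  start : ρ 0 = ρ₀
  finish : ρ 1 = ρ₁
  memLp_potential : MemLp A 2 unitMeasure
  memLp_flux : MemLp (fun t => Q (ρ t) (N (A t))) 2 unitMeasure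
  memLp_deriv : MemLp (fun t => ContinuousLinearMap.adjoint N (Q (ρ t) (N (A t)))
    + ε • ContinuousLinearMap.adjoint L (ρ t)) 2 unitMeasure
  eq_integral : ∀ t ∈ Icc (0 : ℝ) 1, ρ t = ρ 0 + ∫ s in (0 : ℝ)..t,
    (ContinuousLinearMap.adjoint N (Q (ρ s) (N (A s))) + ε • ContinuousLinearMap.adjoint L (ρ s))

theorem IsPath.integrable_energy {ε : ℝ} {ρ₀ ρ₁ : E} {ρ A : ℝ → E}
    (h : IsPath N L S P Q ε ρ₀ ρ₁ ρ A) :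
    Integrable (fun t => ⟪Q (ρ t) (N (A t)), N (A t)⟫_ℝ) unitMeasure :=
  integrable_inner_of_memLp h.memLp_flux (N.comp_memLp' h.memLp_potential)

/-- A continuous curve of strictly positive densities whose derivative minus the drift is square
integrable and orthogonal to `u` is driven by a gradient field. -/
theorem isPath_of_flux (h : TransportData u N L S P Q) {ε : ℝ} {ρ₀ ρ₁ : E} {ρ g : ℝ → E}
    (hρ : ∀ t ∈ Icc (0 : ℝ) 1, ρ t ∈ S ∩ P) (hρc : ContinuousOn ρ (Icc 0 1)) (h0 : ρ 0 = ρ₀)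
    (h1 : ρ 1 = ρ₁) (hg : MemLp g 2 unitMeasure) (hgu : ∀ᵐ t ∂unitMeasure, ⟪u, g t⟫_ℝ = 0)
    (heq : ∀ t ∈ Icc (0 : ℝ) 1, ρ t = ρ 0 + ∫ s in (0 : ℝ)..t,
      (g s + ε • ContinuousLinearMap.adjoint L (ρ s))) :
    ∃ A : ℝ → E, IsPath N L S P Q ε ρ₀ ρ₁ ρ A ∧
      ∀ᵐ t ∂unitMeasure, ContinuousLinearMap.adjoint N (Q (ρ t) (N (A t))) = g t := by
  -- the potential solves an elliptic equation at each time
  set A : ℝ → E := fun t => Ring.inverse (elliptic u N Q (ρ t)) (g t) with hA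
  have hAm : MemLp A 2 unitMeasure :=
    memLp_clm_apply (h.continuousOn_inverse_elliptic.comp hρc fun t ht => (hρ t ht).2) hg
  have hflux : MemLp (fun t => Q (ρ t) (N (A t))) 2 unitMeasure :=
    memLp_clm_apply (h.continuousOn.comp hρc fun t ht => (hρ t ht).2) (N.comp_memLp' hAm)
  have hsolve : ∀ᵐ t ∂unitMeasure, ContinuousLinearMap.adjoint N (Q (ρ t) (N (A t))) = g t := by
    filter_upwards [hgu, ae_mem_Icc] with t ht ht'
    exact h.elliptic_solve (hρ t ht').2 ht
  have hdrift : MemLp (fun t => ε • ContinuousLinearMap.adjoint L (ρ t)) 2 unitMeasure := by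
    have h1 : ContinuousOn (fun t => ε • ContinuousLinearMap.adjoint L (ρ t)) (Icc 0 1) :=
      ((ContinuousLinearMap.adjoint L).continuous.comp_continuousOn hρc).const_smul ε
    obtain ⟨C, hC⟩ := isCompact_Icc.exists_bound_of_continuousOn h1
    refine MemLp.of_bound (h1.aestronglyMeasurable measurableSet_Icc) C ?_
    filter_upwards [ae_mem_Icc] with t ht using hC t ht
  refine ⟨A, ⟨hρ, h0, h1, hAm, hflux, ?_, fun t ht => ?_⟩, hsolve⟩
  · exact ((ContinuousLinearMap.adjoint N).comp_memLp' hflux).add hdrift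
  · rw [heq t ht]
    congr 1
    refine intervalIntegral.integral_congr_ae ?_
    have h2 := (ae_restrict_iff' measurableSet_Icc).1 hsolve
    filter_upwards [h2] with s hs hs'
    rw [uIoc_of_le ht.1] at hs'
    rw [hs ⟨hs'.1.le, hs'.2.trans ht.2⟩]

/-- The weak form of the continuity equation along a path. -/
theorem IsPath.weak_form {ε : ℝ} {ρ₀ ρ₁ : E} {ρ A : ℝ → E}
    (h : IsPath N L S P Q ε ρ₀ ρ₁ ρ A) {B : ℝ → E} (hB : ContDiff ℝ (⊤ : ℕ∞) B) :
    Integrable (fun t => ⟪deriv B t + ε • L (B t), ρ t⟫_ℝ) unitMeasure ∧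
    Integrable (fun t => ⟪Q (ρ t) (N (A t)), N (B t)⟫_ℝ) unitMeasure ∧
    ⟪B 1, ρ₁⟫_ℝ - ⟪B 0, ρ₀⟫_ℝ - ∫ t, ⟪deriv B t + ε • L (B t), ρ t⟫_ℝ ∂unitMeasure
      = ∫ t, ⟪Q (ρ t) (N (A t)), N (B t)⟫_ℝ ∂unitMeasure := by
  obtain ⟨h1, h2⟩ := integral_inner_add_inner
    ((hB.continuous_deriv (by simp)).intervalIntegrable 0 1)
    (intervalIntegrable_iff_unitMeasure.2 (h.memLp_deriv.integrable (by simp)))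
    (fun t _ => eq_add_integral_deriv hB t) h.eq_integral
  rw [h.start, h.finish, ← integral_unitMeasure] at h2
  rw [intervalIntegrable_iff_unitMeasure] at h1
  have h3 : Integrable (fun t => ⟪Q (ρ t) (N (A t)), N (B t)⟫_ℝ) unitMeasure := by
    have hNB : Continuous fun t => N (B t) := N.continuous.comp hB.continuous
    obtain ⟨C, hC⟩ := isCompact_Icc.exists_bound_of_continuousOn hNB.continuousOn
    have : MemLp (fun t => N (B t)) 2 unitMeasure := MemLp.of_bound hNB.aestronglyMeasurable C (by
      filter_upwards [ae_mem_Icc] with t ht using hC t ht)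
    exact integrable_inner_of_memLp h.memLp_flux this
  have h4 : ∀ t, ⟪deriv B t + ε • L (B t), ρ t⟫_ℝ = (⟪deriv B t, ρ t⟫_ℝ
      + ⟪B t, ContinuousLinearMap.adjoint N (Q (ρ t) (N (A t)))
        + ε • ContinuousLinearMap.adjoint L (ρ t)⟫_ℝ) - ⟪Q (ρ t) (N (A t)), N (B t)⟫_ℝ := by
    intro t
    rw [inner_add_left, inner_add_right, inner_smul_left, inner_smul_right,
      ContinuousLinearMap.adjoint_inner_right, ContinuousLinearMap.adjoint_inner_right,
      real_inner_comm (Q (ρ t) (N (A t)))]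
    simp only [conj_trivial]
    ring
  refine ⟨?_, h3, ?_⟩
  · simp_rw [h4]; exact h1.sub h3
  · simp_rw [h4]
    rw [integral_sub h1 h3, h2]
    ring

end TransportData

end Abstract

/-! ### Paths from bounds on the dual functional -/

section Abstract

variable {E F : Type*} [NormedAddCommGroup E] [InnerProductSpace ℝ E] [FiniteDimensional ℝ E]
  [NormedAddCommGroup F] [InnerProductSpace ℝ F] [FiniteDimensional ℝ F]

/-- A linear functional with a bound of second order is bounded by scaling: apply the bound to a
multiple of `v` whose image has norm one. -/
theorem abs_le_of_le_add_sq {V X : Type*} [AddCommGroup V] [Module ℝ V] [NormedAddCommGroup X]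
    [NormedSpace ℝ X] (T : V →ₗ[ℝ] X) (Φ : V →ₗ[ℝ] ℝ) {a b : ℝ}
    (h : ∀ v, Φ v ≤ a + b * ‖T v‖ ^ 2) (v : V) : |Φ v| ≤ (a + b) * ‖T v‖ := by
  have hone : ∀ v, Φ v ≤ (a + b) * ‖T v‖ := by
    intro v
    rcases eq_or_ne (T v) 0 with h0 | h0
    · rw [h0, norm_zero, mul_zero]
      by_contra! hpos
      have := h (((a + 1) / Φ v) • v)
      rw [map_smul, map_smul, h0, smul_zero, norm_zero, smul_eq_mul,
        div_mul_cancel₀ _ hpos.ne'] at this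
      norm_num at this
    · have hn : 0 < ‖T v‖ := norm_pos_iff.2 h0
      have := h ((‖T v‖⁻¹) • v)
      rw [map_smul, map_smul, norm_smul, norm_inv, norm_norm, inv_mul_cancel₀ hn.ne', one_pow,
        mul_one, smul_eq_mul, inv_mul_le_iff₀ hn] at this
      linarith
  rw [abs_le']
  refine ⟨hone v, ?_⟩
  have := hone (-v)
  rwa [map_neg, map_neg, norm_neg] at this

/-- A continuous curve which lies in a closed set at almost every time does so at all times. -/
theorem mem_of_ae_mem {R : ℝ → E} (hR : ContinuousOn R (Icc 0 1)) {K : Set E} (hK : IsClosed K)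
    (h : ∀ᵐ t ∂unitMeasure, R t ∈ K) : ∀ t ∈ Icc (0 : ℝ) 1, R t ∈ K := by
  have hU : IsOpen (Ioo (0 : ℝ) 1 ∩ R ⁻¹' Kᶜ) :=
    (hR.mono Ioo_subset_Icc_self).isOpen_inter_preimage isOpen_Ioo hK.isOpen_compl
  have hzero : volume (Ioo (0 : ℝ) 1 ∩ R ⁻¹' Kᶜ) = 0 := by
    rw [ae_restrict_iff' measurableSet_Icc] at h
    refine measure_mono_null ?_ (ae_iff.1 h)
    intro t ht
    simp only [mem_ofPred_eq, Classical.not_imp]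
    exact ⟨Ioo_subset_Icc_self ht.1, ht.2⟩
  have hempty := hU.measure_eq_zero_iff volume |>.1 hzero
  have hIoo : MapsTo R (Ioo 0 1) K := fun t ht => by
    by_contra hne
    exact (Set.ext_iff.1 hempty t).1 ⟨ht, hne⟩
  have hcl : closure (Ioo (0 : ℝ) 1) = Icc 0 1 := closure_Ioo (by norm_num)
  have := hIoo.closure_of_continuousOn (by rwa [hcl])
  rw [hcl, hK.closure_eq] at this
  exact this

/-- The space of smooth curves. -/
def smoothCurves (E : Type*) [NormedAddCommGroup E] [InnerProductSpace ℝ E] :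
    Submodule ℝ (ℝ → E) where
  carrier := {A | ContDiff ℝ (⊤ : ℕ∞) A}
  add_mem' {A B} hA hB := by
    rw [mem_ofPred_eq] at *
    exact hA.add hB
  zero_mem' := by
    rw [mem_ofPred_eq]
    exact contDiff_const
  smul_mem' c A hA := by
    rw [mem_ofPred_eq] at *
    exact hA.const_smul c

theorem smoothCurves.contDiff (A : smoothCurves E) : ContDiff ℝ (⊤ : ℕ∞) A.1 := by
  exact A.2

theorem memLp_of_continuous {A : ℝ → E} (hA : Continuous A) : MemLp A 2 unitMeasure := by
  obtain ⟨C, hC⟩ := isCompact_Icc.exists_bound_of_continuousOn (hA.continuousOn (s := Icc 0 1))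
  exact MemLp.of_bound hA.aestronglyMeasurable C (by
    filter_upwards [ae_mem_Icc] with t ht using hC t ht)

/-- Smooth curves as square integrable curves. -/
noncomputable def smoothToLp : smoothCurves E →ₗ[ℝ] Lp E 2 unitMeasure where
  toFun A := (memLp_of_continuous (smoothCurves.contDiff A).continuous).toLp
  map_add' _ _ := rfl
  map_smul' _ _ := rfl

theorem smoothToLp_ae (A : smoothCurves E) : smoothToLp A =ᵐ[unitMeasure] A.1 :=
  MemLp.coeFn_toLp (memLp_of_continuous (smoothCurves.contDiff A).continuous)

theorem norm_sq_toLp {f : ℝ → E} (hf : MemLp f 2 unitMeasure) :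
    ‖hf.toLp‖ ^ 2 = ∫ t, ‖f t‖ ^ 2 ∂unitMeasure := by
  rw [← real_inner_self_eq_norm_sq, L2.inner_def]
  refine integral_congr_ae ?_
  filter_upwards [hf.coeFn_toLp] with t ht
  rw [ht, real_inner_self_eq_norm_sq]

namespace TransportData

variable {u : E} {N : E →L[ℝ] F} {L : E →L[ℝ] E} {S P : Set E} {Q : E → F →L[ℝ] F}

/-- The functional obtained by testing the defect of the drift equation for a curve `y` with fixed
end points. -/
noncomputable def defect (L : E →L[ℝ] E) (ε : ℝ) (ρ₀ ρ₁ : E) {K : Set E} (hK : IsCompact K)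
    {y : ℝ → E} (hy : AEStronglyMeasurable y unitMeasure) (hyK : ∀ᵐ t ∂unitMeasure, y t ∈ K) :
    smoothCurves E →ₗ[ℝ] ℝ :=
  have hint : ∀ A : smoothCurves E,
      Integrable (fun t => ⟪deriv A.1 t + ε • L (A.1 t), y t⟫_ℝ) unitMeasure := fun A =>
    integrable_comp_curve hK (f := fun t ρ => ⟪deriv A.1 t + ε • L (A.1 t), ρ⟫_ℝ)
      (Continuous.continuousOn (by
        have h1 : Continuous (deriv A.1) := (smoothCurves.contDiff A).continuous_deriv (by simp)
        have h2 : Continuous A.1 := (smoothCurves.contDiff A).continuous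
        simp only [Function.uncurry_def]
        fun_prop)) hy hyK
  { toFun := fun A => ⟪A.1 1, ρ₁⟫_ℝ - ⟪A.1 0, ρ₀⟫_ℝ
      - ∫ t, ⟪deriv A.1 t + ε • L (A.1 t), y t⟫_ℝ ∂unitMeasure
    map_add' := fun A B => by
      have hd : ∀ t, deriv (A.1 + B.1) t = deriv A.1 t + deriv B.1 t := fun t =>
        deriv_add ((smoothCurves.contDiff A).differentiable (by simp)).differentiableAt
          ((smoothCurves.contDiff B).differentiable (by simp)).differentiableAt
      have : ∀ t, ⟪deriv (A + B).1 t + ε • L ((A + B).1 t), y t⟫_ℝ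
          = ⟪deriv A.1 t + ε • L (A.1 t), y t⟫_ℝ + ⟪deriv B.1 t + ε • L (B.1 t), y t⟫_ℝ := by
        intro t
        rw [← inner_add_left]
        congr 1
        rw [Submodule.coe_add, hd, Pi.add_apply, map_add, smul_add]
        abel
      simp_rw [this]
      rw [integral_add (hint A) (hint B)]
      simp only [Submodule.coe_add, Pi.add_apply, inner_add_left]
      ring
    map_smul' := fun c A => by
      have hd : ∀ t, deriv (c • A.1) t = c • deriv A.1 t := fun t =>
        deriv_const_smul c ((smoothCurves.contDiff A).differentiable (by simp)).differentiableAt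
      have : ∀ t, ⟪deriv (c • A).1 t + ε • L ((c • A).1 t), y t⟫_ℝ
          = c * ⟪deriv A.1 t + ε • L (A.1 t), y t⟫_ℝ := by
        intro t
        rw [Submodule.coe_smul, hd, Pi.smul_apply, map_smul, smul_comm ε c, ← smul_add,
          inner_smul_left, conj_trivial]
      simp_rw [this]
      rw [integral_const_mul]
      simp only [Submodule.coe_smul, Pi.smul_apply, inner_smul_left, conj_trivial, RingHom.id_apply,
        smul_eq_mul]
      ring }

/-- A curve of densities for which the dual functional is bounded by `D` is a solution of the drift
equation driven by a gradient field with energy at most `2 * D`. The flux of the curve is found by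
the Riesz representation theorem, and its potential by solving an elliptic equation at each
time. -/
theorem exists_isPath_of_le (h : TransportData u N L S P Q) {ε : ℝ} {ρ₀ ρ₁ : E} (hρ₀ : ρ₀ ∈ S)
    (hρ₁ : ρ₁ ∈ S) {K : Set E} (hK : IsCompact K) (hKS : K ⊆ S ∩ P) {y : ℝ → E}
    (hy : AEStronglyMeasurable y unitMeasure) (hyK : ∀ᵐ t ∂unitMeasure, y t ∈ K) {D : ℝ}
    (hD : ∀ A : ℝ → E, ContDiff ℝ (⊤ : ℕ∞) A →
      ⟪A 1, ρ₁⟫_ℝ - ⟪A 0, ρ₀⟫_ℝ - ∫ t, ⟪deriv A t + ε • L (A t), y t⟫_ℝ ∂unitMeasure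
        ≤ D + 1 / 2 * ∫ t, ⟪Q (y t) (N (A t)), N (A t)⟫_ℝ ∂unitMeasure) :
    ∃ ρ A : ℝ → E, IsPath N L S P Q ε ρ₀ ρ₁ ρ A ∧
      1 / 2 * ∫ t, ⟪Q (ρ t) (N (A t)), N (A t)⟫_ℝ ∂unitMeasure ≤ D := by
  have hyL : MemLp y 2 unitMeasure := by
    obtain ⟨C, hC⟩ := hK.isBounded.exists_norm_le
    exact MemLp.of_bound hy C (by filter_upwards [hyK] with t ht using hC _ ht)
  -- a uniform bound for the quadratic forms
  obtain ⟨C, hC0, hC⟩ : ∃ C, 0 ≤ C ∧ ∀ ρ ∈ K, ∀ B, ⟪Q ρ (N B), N B⟫_ℝ ≤ C * ‖B‖ ^ 2 := by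
    obtain ⟨C, hC⟩ := hK.exists_bound_of_continuousOn (h.continuousOn.mono fun x hx => (hKS hx).2)
    refine ⟨max C 0 * ‖N‖ ^ 2, by positivity, fun ρ hρ B => ?_⟩
    have h1 : ‖Q ρ (N B)‖ ≤ max C 0 * ‖N B‖ :=
      (Q ρ).le_of_opNorm_le ((hC ρ hρ).trans (le_max_left _ _)) _
    have h2 : ‖N B‖ ≤ ‖N‖ * ‖B‖ := N.le_opNorm B
    calc ⟪Q ρ (N B), N B⟫_ℝ ≤ ‖Q ρ (N B)‖ * ‖N B‖ := real_inner_le_norm _ _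
      _ ≤ (max C 0 * ‖N B‖) * ‖N B‖ := by gcongr
      _ = max C 0 * ‖N B‖ ^ 2 := by ring
      _ ≤ max C 0 * (‖N‖ * ‖B‖) ^ 2 := by gcongr
      _ = _ := by ring
  set T := smoothToLp (E := E)
  set Φ := defect L ε ρ₀ ρ₁ hK hy hyK with hΦ
  have hΦA : ∀ A : smoothCurves E, Φ A = ⟪A.1 1, ρ₁⟫_ℝ - ⟪A.1 0, ρ₀⟫_ℝ
      - ∫ t, ⟪deriv A.1 t + ε • L (A.1 t), y t⟫_ℝ ∂unitMeasure := fun A => rfl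
  have hquad : ∀ A : ℝ → E, Continuous A →
      Integrable (fun t => ⟪Q (y t) (N (A t)), N (A t)⟫_ℝ) unitMeasure := fun A hA =>
    integrable_comp_curve hK (f := fun t ρ => ⟪Q ρ (N (A t)), N (A t)⟫_ℝ)
      (h.continuousOn_quad hA (f := fun _ ρ => ρ) _ continuous_snd.continuousOn
        fun p hp => (hKS hp.2).2) hy hyK
  have hbound : ∀ A, |Φ A| ≤ (D + C / 2) * ‖T A‖ := by
    refine abs_le_of_le_add_sq T Φ fun A => ?_
    have hAc : Continuous A.1 := (smoothCurves.contDiff A).continuous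
    have h1 := hD A.1 A.2
    have h2 : ∫ t, ⟪Q (y t) (N (A.1 t)), N (A.1 t)⟫_ℝ ∂unitMeasure ≤ C * ‖T A‖ ^ 2 := by
      have h3 : ‖T A‖ ^ 2 = ∫ t, ‖A.1 t‖ ^ 2 ∂unitMeasure :=
        norm_sq_toLp (memLp_of_continuous hAc)
      rw [h3, ← integral_const_mul]
      refine integral_mono_ae (hquad _ hAc) (integrable_of_continuous (by fun_prop)) ?_
      filter_upwards [hyK] with t ht using hC _ ht _
    rw [hΦA]
    linarith
  -- the flux
  obtain ⟨x, hx⟩ := exists_inner_eq_of_abs_le T Φ hbound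
  have hxA : ∀ A : ℝ → E, ContDiff ℝ (⊤ : ℕ∞) A → ⟪A 1, ρ₁⟫_ℝ - ⟪A 0, ρ₀⟫_ℝ
      - ∫ t, ⟪deriv A t + ε • L (A t), y t⟫_ℝ ∂unitMeasure = ∫ t, ⟪x t, A t⟫_ℝ ∂unitMeasure := by
    intro A hA
    have h1 := hx ⟨A, hA⟩
    rw [hΦA, L2.inner_def] at h1
    rw [h1]
    refine integral_congr_ae ?_
    filter_upwards [smoothToLp_ae (⟨A, hA⟩ : smoothCurves E)] with t ht
    rw [ht]
  have hxL : MemLp x 2 unitMeasure := Lp.memLp x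
  have hxu : ∀ᵐ t ∂unitMeasure, ⟪u, x t⟫_ℝ = 0 := by
    have hI : Integrable (fun t => ⟪u, x t⟫_ℝ) unitMeasure :=
      (hxL.const_inner u).integrable (by simp)
    refine ae_eq_zero_of_integral_contDiff_smul_eq_zero hI.locallyIntegrable fun g hg _ => ?_
    have h1 := hxA (fun t => g t • u) (hg.smul contDiff_const)
    have h2 : ∫ t, ⟪deriv (fun t => g t • u) t + ε • L (g t • u), y t⟫_ℝ ∂unitMeasure
        = ∫ t, deriv g t ∂unitMeasure := by
      refine integral_congr_ae ?_
      filter_upwards [hyK] with t ht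
      rw [deriv_smul_const (hg.differentiable (by simp)).differentiableAt, map_smul, h.L_u,
        smul_zero, smul_zero, add_zero, inner_smul_left, h.inner_u _ (hKS ht).1]
      simp
    rw [h2, integral_unitMeasure] at h1
    have h3 := eq_add_integral_deriv hg 1
    simp only [inner_smul_left, conj_trivial, h.inner_u _ hρ₀, h.inner_u _ hρ₁, inner_smul_right,
      mul_one] at h1
    simp only [smul_eq_mul]
    simp_rw [real_inner_comm (x _) u]
    linarith
  -- the continuous representative
  set g : ℝ → E := fun t => x t + ε • ContinuousLinearMap.adjoint L (y t) with hg
  have hgL : MemLp g 2 unitMeasure :=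
    hxL.add (((ContinuousLinearMap.adjoint L).comp_memLp' hyL).const_smul ε)
  have hgI : IntervalIntegrable g volume 0 1 :=
    intervalIntegrable_iff_unitMeasure.2 (hgL.integrable (by simp))
  set R : ℝ → E := fun t => ρ₀ + ∫ s in (0 : ℝ)..t, g s with hR
  have hR0 : R 0 = ρ₀ := by simp [hR]
  have hReq : ∀ t ∈ Icc (0 : ℝ) 1, R t = R 0 + ∫ s in (0 : ℝ)..t, g s := fun t _ => by rw [hR0]
  have hRc : ContinuousOn R (Icc 0 1) := by
    have := intervalIntegral.continuousOn_primitive_interval' hgI (a := 0) (by simp)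
    rw [uIcc_of_le zero_le_one] at this
    exact continuousOn_const.add this
  have hRL : MemLp R 2 unitMeasure := by
    obtain ⟨C, hC⟩ := isCompact_Icc.exists_bound_of_continuousOn hRc
    exact MemLp.of_bound (hRc.aestronglyMeasurable measurableSet_Icc) C (by
      filter_upwards [ae_mem_Icc] with t ht using hC t ht)
  have hparts : ∀ A : ℝ → E, ContDiff ℝ (⊤ : ℕ∞) A →
      ⟪A 1, ρ₁ - R 1⟫_ℝ = ∫ t, ⟪deriv A t, y t - R t⟫_ℝ ∂unitMeasure := by
    intro A hA
    have hdc : Continuous (deriv A) := hA.continuous_deriv (by simp)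
    have hdL := memLp_of_continuous hdc
    have hAL := memLp_of_continuous hA.continuous
    obtain ⟨-, h2⟩ := integral_inner_add_inner (hdc.intervalIntegrable 0 1) hgI
      (fun t _ => eq_add_integral_deriv hA t) hReq
    rw [hR0, ← integral_unitMeasure] at h2
    have i1 := integrable_inner_of_memLp hdL hRL
    have i2 := integrable_inner_of_memLp hAL hgL
    have i3 := integrable_inner_of_memLp hdL hyL
    have i4 := integrable_inner_of_memLp hxL hAL
    have i5 : Integrable (fun t => ⟪ε • L (A t), y t⟫_ℝ) unitMeasure :=
      integrable_inner_of_memLp ((L.comp_memLp' hAL).const_smul ε) hyL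
    have h3 := hxA A hA
    simp_rw [inner_add_left] at h3
    rw [integral_add i3 i5] at h3
    have h4 : ∫ t, ⟪A t, g t⟫_ℝ ∂unitMeasure = (∫ t, ⟪x t, A t⟫_ℝ ∂unitMeasure)
        + ∫ t, ⟪ε • L (A t), y t⟫_ℝ ∂unitMeasure := by
      rw [← integral_add i4 i5]
      refine integral_congr_ae (Eventually.of_forall fun t => ?_)
      simp only [hg, inner_add_right, inner_smul_right, inner_smul_left,
        ContinuousLinearMap.adjoint_inner_right, conj_trivial, real_inner_comm (x t)]
    rw [integral_add i1 i2, h4] at h2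
    simp_rw [inner_sub_right]
    rw [integral_sub i3 i1]
    linarith
  have hR1 : R 1 = ρ₁ := by
    refine (sub_eq_zero.1 (ext_inner_left ℝ fun e => ?_)).symm
    have := hparts (fun _ => e) contDiff_const
    simpa using this
  have hRy : ∀ᵐ t ∂unitMeasure, y t - R t = 0 := by
    have hI : Integrable (fun t => y t - R t) unitMeasure := (hyL.sub hRL).integrable (by simp)
    refine ae_eq_zero_of_integral_contDiff_smul_eq_zero hI.locallyIntegrable fun φ hφ _ => ?_
    refine ext_inner_left ℝ fun e => ?_
    obtain ⟨hp1, hp2⟩ := contDiff_primitive hφ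
    have h1 := hparts (fun t => (∫ s in (0 : ℝ)..t, φ s) • e) (hp1.smul contDiff_const)
    rw [hR1, sub_self, inner_zero_right] at h1
    have hφL := memLp_of_continuous hφ.continuous
    have hI' : Integrable (fun t => φ t • (y t - R t)) unitMeasure :=
      memLp_one_iff_integrable.1 (MemLp.smul (p := 2) (q := 2) (r := 1) (hyL.sub hRL) hφL)
    rw [inner_zero_right, ← integral_inner hI', h1]
    refine integral_congr_ae (Eventually.of_forall fun t => ?_)
    simp only [((hp2 t).smul_const e).deriv, inner_smul_left, inner_smul_right, conj_trivial]
  have hRK : ∀ t ∈ Icc (0 : ℝ) 1, R t ∈ K := mem_of_ae_mem hRc hK.isClosed (by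
    filter_upwards [hRy, hyK] with t h1 h2
    rwa [← sub_eq_zero.1 h1])
  -- the potential
  obtain ⟨A, hA, hAx⟩ := h.isPath_of_flux (ε := ε) (fun t ht => hKS (hRK t ht)) hRc hR0 hR1 hxL hxu
    (fun t ht => by
      rw [hReq t ht]
      congr 1
      refine intervalIntegral.integral_congr_ae ?_
      have h2 := (ae_restrict_iff' measurableSet_Icc).1 hRy
      filter_upwards [h2] with s hs hs'
      rw [uIoc_of_le ht.1] at hs'
      simp only [hg]
      rw [sub_eq_zero.1 (hs ⟨hs'.1.le, hs'.2.trans ht.2⟩)])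
  refine ⟨R, A, hA, ?_⟩
  have hAL := hA.memLp_potential
  -- completing the square, up to a smooth approximation `B` of the potential
  have hxAI := integrable_inner_of_memLp hxL hAL
  have henergy : ∫ t, ⟪Q (R t) (N (A t)), N (A t)⟫_ℝ ∂unitMeasure
      = ∫ t, ⟪x t, A t⟫_ℝ ∂unitMeasure := by
    refine integral_congr_ae ?_
    filter_upwards [hAx] with t ht
    rw [← ht, ContinuousLinearMap.adjoint_inner_left]
  rw [henergy]
  have happrox : ∀ B : ℝ → E, ContDiff ℝ (⊤ : ℕ∞) B →
      ∀ hBL : MemLp (fun t => B t - A t) 2 unitMeasure,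
      1 / 2 * ∫ t, ⟪x t, A t⟫_ℝ ∂unitMeasure ≤ D + C / 2 * ‖hBL.toLp‖ ^ 2 := by
    intro B hB hBL
    have hBL' := memLp_of_continuous hB.continuous
    have h1 := hD B hB
    rw [hxA B hB] at h1
    rw [norm_sq_toLp]
    have i1 := integrable_inner_of_memLp hxL hBL'
    have i2 : Integrable (fun t => ‖B t - A t‖ ^ 2) unitMeasure :=
      (memLp_two_iff_integrable_sq_norm hBL.1).1 hBL
    have h2 : ∫ t, (1 / 2 * ⟪x t, A t⟫_ℝ) ∂unitMeasure
        ≤ ∫ t, ((⟪x t, B t⟫_ℝ - 1 / 2 * ⟪Q (y t) (N (B t)), N (B t)⟫_ℝ)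
          + C / 2 * ‖B t - A t‖ ^ 2) ∂unitMeasure := by
      refine integral_mono_ae (hxAI.const_mul _)
        ((i1.sub ((hquad B hB.continuous).const_mul _)).add (i2.const_mul _)) ?_
      filter_upwards [hRy, hyK, hAx] with t h1 h2 h3
      have h4 := hC _ h2 (B t - A t)
      rw [sub_eq_zero.1 h1] at h2 h4 ⊢
      have h5 := h.symm _ (hKS h2).2 (N (A t)) (N (B t))
      have h6 : ∀ Z, ⟪x t, Z⟫_ℝ = ⟪Q (R t) (N (A t)), N Z⟫_ℝ := fun Z => by
        rw [← h3, ContinuousLinearMap.adjoint_inner_left]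
      have h7 := real_inner_comm (N (A t)) (Q (R t) (N (B t)))
      rw [h6, h6]
      simp only [map_sub, inner_sub_left, inner_sub_right] at h4
      linarith
    have i3 : Integrable (fun t => ⟪x t, B t⟫_ℝ - 1 / 2 * ⟪Q (y t) (N (B t)), N (B t)⟫_ℝ)
        unitMeasure := i1.sub ((hquad B hB.continuous).const_mul _)
    rw [integral_const_mul, integral_add i3 (i2.const_mul _),
      integral_sub i1 ((hquad B hB.continuous).const_mul _), integral_const_mul,
      integral_const_mul] at h2
    linarith
  refine le_of_forall_pos_le_add fun r hr => ?_
  have hcpos : 0 < C / 2 + 1 := by linarith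
  obtain ⟨B, -, hB, hBA⟩ := hAL.exist_eLpNorm_sub_le (by simp) (by simp)
    (show 0 < Real.sqrt (r / (C / 2 + 1)) from Real.sqrt_pos.2 (by positivity))
  have hBL : MemLp (fun t => B t - A t) 2 unitMeasure :=
    (memLp_of_continuous hB.continuous).sub hAL
  refine (happrox B hB hBL).trans ?_
  have hn : ‖hBL.toLp‖ ≤ Real.sqrt (r / (C / 2 + 1)) := by
    rw [Lp.norm_toLp]
    refine ENNReal.toReal_le_of_le_ofReal (Real.sqrt_nonneg _) ?_
    rw [eLpNorm_sub_comm] at hBA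
    exact hBA
  have hn2 : ‖hBL.toLp‖ ^ 2 ≤ r / (C / 2 + 1) := by
    rw [← Real.sq_sqrt (show 0 ≤ r / (C / 2 + 1) by positivity)]
    exact pow_le_pow_left₀ (norm_nonneg _) hn 2
  have : C / 2 * ‖hBL.toLp‖ ^ 2 ≤ r := by
    calc C / 2 * ‖hBL.toLp‖ ^ 2 ≤ (C / 2 + 1) * (r / (C / 2 + 1)) := by gcongr; linarith
      _ = r := by field_simp
  linarith

end TransportData

end Abstract

/-! ### Strong duality for abstract transport problems -/

section Abstract

variable {E F : Type*} [NormedAddCommGroup E] [InnerProductSpace ℝ E] [FiniteDimensional ℝ E]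
  [NormedAddCommGroup F] [InnerProductSpace ℝ F] [FiniteDimensional ℝ F]

namespace TransportData

variable {u : E} {N : E →L[ℝ] F} {L : E →L[ℝ] E} {S P : Set E} {Q : E → F →L[ℝ] F}

/-- The straight line between strictly positive densities is driven by a gradient field. -/
theorem exists_isPath_segment (h : TransportData u N L S P Q) (ε : ℝ) {ρ₀ ρ₁ : E}
    (hρ₀ : ρ₀ ∈ S ∩ P) (hρ₁ : ρ₁ ∈ S ∩ P) :
    ∃ A : ℝ → E, IsPath N L S P Q ε ρ₀ ρ₁ (fun t => (1 - t) • ρ₀ + t • ρ₁) A := by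
  set ρ : ℝ → E := fun t => (1 - t) • ρ₀ + t • ρ₁ with hρ
  have hρc : Continuous ρ := by fun_prop
  set g : ℝ → E := fun t => ρ₁ - ρ₀ - ε • ContinuousLinearMap.adjoint L (ρ t) with hg
  have hgc : Continuous g := by fun_prop
  obtain ⟨A, hA, -⟩ := h.isPath_of_flux (ε := ε) (ρ := ρ) (g := g) (ρ₀ := ρ₀) (ρ₁ := ρ₁)
    (fun t ht => (h.convex.inter h.convex_cone) hρ₀ hρ₁ (by linarith [ht.2]) ht.1 (by ring))
    hρc.continuousOn (by simp [hρ]) (by simp [hρ]) (memLp_of_continuous hgc)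
    (Eventually.of_forall fun t => by
      simp [hg, inner_sub_right, h.inner_u _ hρ₀.1, h.inner_u _ hρ₁.1, inner_smul_right,
        ContinuousLinearMap.adjoint_inner_right, h.L_u])
    (fun t _ => by
      simp only [hg, sub_add_cancel, intervalIntegral.integral_const, hρ]
      module)
  exact ⟨A, hA⟩

/-- Strong duality: an upper bound of the dual problem over smooth subsolutions is, up to any
positive error, an upper bound of the action of some path. An optimal curve of densities for the
Lagrangian may reach the boundary of the cone, and is therefore mixed with the straight line. -/
theorem exists_isPath_action_le (h : TransportData u N L S P Q) {ε : ℝ} {ρ₀ ρ₁ : E}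
    (hρ₀ : ρ₀ ∈ S ∩ P) (hρ₁ : ρ₁ ∈ S ∩ P) {D : ℝ}
    (hD : ∀ A, IsSmoothSub N L S Q ε A → ⟪A 1, ρ₁⟫_ℝ - ⟪A 0, ρ₀⟫_ℝ ≤ D) {γ : ℝ} (hγ : 0 < γ) :
    ∃ ρ A : ℝ → E, IsPath N L S P Q ε ρ₀ ρ₁ ρ A ∧
      1 / 2 * ∫ t, ⟪Q (ρ t) (N (A t)), N (A t)⟫_ℝ ∂unitMeasure ≤ D + γ := by
  have hD0 : 0 ≤ D := by
    have := hD (fun _ => 0) ⟨contDiff_const, fun t _ ρ _ => by simp⟩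
    simpa using this
  obtain ⟨a, ha⟩ := h.exists_isPath_segment ε hρ₀ hρ₁
  set r : ℝ → E := fun t => (1 - t) • ρ₀ + t • ρ₁ with hr
  have hrc : Continuous r := by fun_prop
  set C₀ : ℝ := ∫ t, 2 * ⟪Q (r t) (N (a t)), N (a t)⟫_ℝ ∂unitMeasure with hC₀
  have hC₀0 : 0 ≤ C₀ := integral_nonneg_of_ae (by
    filter_upwards [ae_mem_Icc] with t ht
    exact mul_nonneg zero_le_two (h.nonneg (ha.density t ht).2 _))
  -- a lower bound for the end points
  obtain ⟨c, hc, hc₀, hc₁⟩ : ∃ c : ℝ, 0 < c ∧ ρ₀ - c • u ∈ P ∧ ρ₁ - c • u ∈ P := by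
    have hlim : ∀ ρ ∈ P, ∀ᶠ c : ℝ in 𝓝[>] 0, ρ - c • u ∈ P := fun ρ hρ => by
      have hcont : Continuous fun c : ℝ => ρ - c • u := by fun_prop
      have : Tendsto (fun c : ℝ => ρ - c • u) (𝓝[>] 0) (𝓝 ρ) := by
        have := (hcont.tendsto 0).mono_left (nhdsWithin_le_nhds (s := Ioi (0 : ℝ)))
        simpa using this
      exact this.eventually (h.isOpen.mem_nhds hρ)
    obtain ⟨c, ⟨h0, h1⟩, hc⟩ :=
      (((hlim _ hρ₀.2).and (hlim _ hρ₁.2)).and self_mem_nhdsWithin).exists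
    exact ⟨c, hc, h0, h1⟩
  have hrP : ∀ t ∈ Icc (0 : ℝ) 1, r t ∈ S ∩ P := ha.density
  have hrcP : ∀ t ∈ Icc (0 : ℝ) 1, r t - c • u ∈ P := fun t ht => by
    have := h.convex_cone hc₀ hc₁ (sub_nonneg.2 ht.2) ht.1 (by ring)
    convert this using 1
    simp only [hr]
    module
  -- the mixing parameters
  set δ : ℝ := min (1 / 4) (γ / (C₀ + 1)) with hδ
  have hδ0 : 0 < δ := lt_min (by norm_num) (by positivity)
  have hδ4 : δ ≤ 1 / 4 := min_le_left _ _
  have hδC : δ * C₀ ≤ γ := by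
    calc δ * C₀ ≤ γ / (C₀ + 1) * (C₀ + 1) := by
          gcongr
          · exact min_le_right _ _
          · linarith
      _ = γ := by field_simp
  set κ : ℝ := 1 - 2 * δ with hκ
  have hκ0 : 0 < κ := by linarith
  -- with this shift, `κ • (s + η • u)` and two multiples of the straight line add up to the mixture
  set η : ℝ := δ * c / κ with hη
  have hη0 : 0 < η := by positivity
  obtain ⟨x, hxS, hx⟩ := h.exists_curve_forall_le hη0 hρ₀.1 hρ₁.1 hD
  set mix : ℝ → E → E := fun t s => κ • s + (2 * δ) • r t with hmix
  have hmixc : Continuous (Function.uncurry mix) := by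
    simp only [hmix, Function.uncurry_def]; fun_prop
  have hdecomp : ∀ t s, mix t s = κ • (s + η • u) + (δ • r t + δ • (r t - c • u)) := by
    intro t s
    have : κ • (s + η • u) = κ • s + (δ * c) • u := by
      rw [smul_add, smul_smul, hη, mul_div_cancel₀ _ hκ0.ne']
    rw [this]
    simp only [hmix]
    module
  have hparts : ∀ t ∈ Icc (0 : ℝ) 1, ∀ s ∈ S, κ • (s + η • u) ∈ P ∧ δ • r t ∈ P ∧
      δ • (r t - c • u) ∈ P := fun t ht s hs =>
    ⟨h.smul_mem _ hκ0 _ (h.add_smul_mem s hs η hη0), h.smul_mem _ hδ0 _ (hrP t ht).2,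
      h.smul_mem _ hδ0 _ (hrcP t ht)⟩
  have hmixP : ∀ t ∈ Icc (0 : ℝ) 1, ∀ s ∈ S, mix t s ∈ S ∩ P := by
    intro t ht s hs
    refine ⟨h.convex hs (hrP t ht).1 hκ0.le (by positivity) (by rw [hκ]; ring), ?_⟩
    obtain ⟨h1, h2, h3⟩ := hparts t ht s hs
    rw [hdecomp]
    exact h.add_mem _ h1 _ (h.add_mem _ h2 _ h3)
  have hmixq : ∀ t ∈ Icc (0 : ℝ) 1, ∀ s ∈ S, ∀ X,
      κ * ⟪Q (s + η • u) X, X⟫_ℝ + δ * ⟪Q (r t) X, X⟫_ℝ ≤ ⟪Q (mix t s) X, X⟫_ℝ := by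
    intro t ht s hs X
    obtain ⟨h1, h2, h3⟩ := hparts t ht s hs
    have e1 := h.superadd _ h1 _ (h.add_mem _ h2 _ h3) X
    have e2 := h.superadd _ h2 _ h3 X
    have e3 := h.nonneg h3 X
    rw [h.homog κ hκ0 _ (h.add_smul_mem s hs η hη0)] at e1
    rw [h.homog δ hδ0 _ (hrP t ht).2] at e2
    rw [hdecomp]
    linarith
  set K : Set E := Function.uncurry mix '' (Icc (0 : ℝ) 1 ×ˢ S) with hK
  have hKc : IsCompact K := (isCompact_Icc.prod h.compact).image hmixc
  have hKS : K ⊆ S ∩ P := by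
    rintro _ ⟨⟨t, s⟩, ⟨ht, hs⟩, rfl⟩
    exact hmixP t ht s hs
  have hxS' : ∀ᵐ t ∂unitMeasure, x t ∈ S := hxS
  have hxm : AEStronglyMeasurable x unitMeasure := Lp.aestronglyMeasurable x
  have hxL : MemLp x 2 unitMeasure := Lp.memLp x
  refine h.exists_isPath_of_le (ε := ε) hρ₀.1 hρ₁.1 hKc hKS
    (y := fun t => mix t (x t)) (D := D + γ)
    ((hxm.const_smul κ).add (hrc.aestronglyMeasurable.const_smul (2 * δ)))
    (by filter_upwards [ae_mem_Icc, hxS'] with t ht ht' using ⟨(t, x t), ⟨ht, ht'⟩, rfl⟩)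
    (fun B hB => ?_)
  obtain ⟨i1, i2, hweak⟩ := ha.weak_form hB
  have hxB := hx B hB
  have hBc := hB.continuous
  have hdL : MemLp (fun t => deriv B t + ε • L (B t)) 2 unitMeasure :=
    memLp_of_continuous ((hB.continuous_deriv (by simp)).add (by fun_prop))
  have i3 := integrable_inner_of_memLp hdL hxL
  have i4 : Integrable (fun t => ⟪Q (x t + η • u) (N (B t)), N (B t)⟫_ℝ) unitMeasure :=
    integrable_comp_curve h.compact (f := fun t ρ => ⟪Q (ρ + η • u) (N (B t)), N (B t)⟫_ℝ)
      (h.continuousOn_quad hBc (f := fun _ ρ => ρ + η • u) _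
        (show Continuous fun p : ℝ × E => p.2 + η • u by fun_prop).continuousOn
        fun p hp => h.add_smul_mem _ hp.2 η hη0) hxm hxS'
  have i5 : Integrable (fun t => ⟪Q (mix t (x t)) (N (B t)), N (B t)⟫_ℝ) unitMeasure :=
    integrable_comp_curve h.compact (f := fun t ρ => ⟪Q (mix t ρ) (N (B t)), N (B t)⟫_ℝ)
      (h.continuousOn_quad hBc (f := mix) _ hmixc.continuousOn
        fun p hp => (hmixP _ hp.1 _ hp.2).2) hxm hxS'
  have i6 : Integrable (fun t => 2 * ⟪Q (r t) (N (a t)), N (a t)⟫_ℝ) unitMeasure :=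
    ha.integrable_energy.const_mul 2
  have e1 : ∫ t, ham u N L Q ε η B t (x t) ∂unitMeasure
      = (∫ t, ⟪deriv B t + ε • L (B t), x t⟫_ℝ ∂unitMeasure)
        + 1 / 2 * ∫ t, ⟪Q (x t + η • u) (N (B t)), N (B t)⟫_ℝ ∂unitMeasure := by
    rw [← integral_const_mul, ← integral_add i3 (i4.const_mul _)]
    rfl
  have e2 : ∫ t, ⟪deriv B t + ε • L (B t), mix t (x t)⟫_ℝ ∂unitMeasure
      = κ * (∫ t, ⟪deriv B t + ε • L (B t), x t⟫_ℝ ∂unitMeasure)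
        + 2 * δ * ∫ t, ⟪deriv B t + ε • L (B t), r t⟫_ℝ ∂unitMeasure := by
    rw [← integral_const_mul, ← integral_const_mul,
      ← integral_add (i3.const_mul _) (i1.const_mul _)]
    simp only [hmix, inner_add_right, inner_smul_right]
  -- Young's inequality for the contribution of the straight line
  have e3 : κ * (1 / 2 * ∫ t, ⟪Q (x t + η • u) (N (B t)), N (B t)⟫_ℝ ∂unitMeasure)
      + 2 * δ * (∫ t, ⟪Q (r t) (N (a t)), N (B t)⟫_ℝ ∂unitMeasure)
      ≤ δ * C₀ + 1 / 2 * ∫ t, ⟪Q (mix t (x t)) (N (B t)), N (B t)⟫_ℝ ∂unitMeasure := by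
    rw [hC₀, ← integral_const_mul, ← integral_const_mul, ← integral_const_mul,
      ← integral_const_mul, ← integral_const_mul,
      ← integral_add ((i4.const_mul _).const_mul _) (i2.const_mul _),
      ← integral_add (i6.const_mul _) (i5.const_mul _)]
    refine integral_mono_ae (((i4.const_mul _).const_mul _).add (i2.const_mul _))
      ((i6.const_mul _).add (i5.const_mul _)) ?_
    filter_upwards [ae_mem_Icc, hxS'] with t ht ht'
    have q1 := hmixq t ht _ ht' (N (B t))
    have hP := (hrP t ht).2
    have q2 := h.nonneg hP (N (B t) - (2 : ℝ) • N (a t))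
    have q3 := h.symm _ hP (N (a t)) (N (B t))
    have q4 := real_inner_comm (N (a t)) (Q (r t) (N (B t)))
    simp only [map_sub, map_smul, inner_sub_left, inner_sub_right, inner_smul_left,
      inner_smul_right, conj_trivial] at q2
    have q5 := mul_nonneg hδ0.le q2
    nlinarith
  rw [e1] at hxB
  rw [e2]
  have e4 : κ * D ≤ D := by nlinarith
  have e5 := mul_le_mul_of_nonneg_left hxB hκ0.le
  have e6 : ⟪B 1, ρ₁⟫_ℝ - ⟪B 0, ρ₀⟫_ℝ = κ * (⟪B 1, ρ₁⟫_ℝ - ⟪B 0, ρ₀⟫_ℝ)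
      + 2 * δ * (⟪B 1, ρ₁⟫_ℝ - ⟪B 0, ρ₀⟫_ℝ) := by rw [hκ]; ring
  have e7 := congrArg (fun z => 2 * δ * z) hweak
  linarith

end TransportData

end Abstract

open QTransport

/-! ### Joint eigenvectors of left and right multiplication -/

section Schur

variable {n : ℕ}

@[simp] theorem mat_toGNS (X : Mat n) : mat (toGNS X) = X := rfl
@[simp] theorem toGNS_mat (X : GNS n) : toGNS (mat X) = X := rfl
@[simp] theorem mat_add (X Y : GNS n) : mat (X + Y) = mat X + mat Y := rfl
@[simp] theorem mat_sub (X Y : GNS n) : mat (X - Y) = mat X - mat Y := rfl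
@[simp] theorem mat_neg (X : GNS n) : mat (-X) = -mat X := rfl
@[simp] theorem mat_zero : mat (0 : GNS n) = 0 := rfl
@[simp] theorem mat_smul (c : ℂ) (X : GNS n) : mat (c • X) = c • mat X := rfl
@[simp] theorem mat_Lop (X : Mat n) (Y : GNS n) : mat (Lop X Y) = X * mat Y := rfl
@[simp] theorem mat_Rop (X : Mat n) (Y : GNS n) : mat (Rop X Y) = mat Y * X := rfl

theorem mat_injective : Function.Injective (mat : GNS n → Mat n) := fun _ _ h => h

theorem mat_sum {ι : Type*} (s : Finset ι) (f : ι → GNS n) :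
    mat (∑ i ∈ s, f i) = ∑ i ∈ s, mat (f i) :=
  map_sum (toGNS (n := n)).symm f s

/-- The matrix units with respect to the eigenvector basis of a Hermitian matrix. -/
noncomputable def eig {ρ : Mat n} (hρ : ρ.IsHermitian) (p : Fin n × Fin n) : GNS n :=
  toGNS ((hρ.eigenvectorUnitary : Mat n) * Matrix.single p.1 p.2 1 *
    (hρ.eigenvectorUnitary : Mat n)ᴴ)

/-- The coefficients of a matrix with respect to the matrix units `eig`. -/
noncomputable def coef {ρ : Mat n} (hρ : ρ.IsHermitian) (p : Fin n × Fin n) : GNS n →ₗ[ℂ] ℂ where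
  toFun X := ((hρ.eigenvectorUnitary : Mat n)ᴴ * mat X * (hρ.eigenvectorUnitary : Mat n)) p.1 p.2
  map_add' X Y := by simp [mul_add, add_mul]
  map_smul' c X := by simp

variable {ρ : Mat n} (hρ : ρ.IsHermitian)

theorem unitary_mul_conjTranspose :
    (hρ.eigenvectorUnitary : Mat n) * (hρ.eigenvectorUnitary : Mat n)ᴴ = 1 :=
  Unitary.mul_star_self_of_mem hρ.eigenvectorUnitary.2

theorem unitary_conjTranspose_mul :
    (hρ.eigenvectorUnitary : Mat n)ᴴ * (hρ.eigenvectorUnitary : Mat n) = 1 :=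
  Unitary.star_mul_self_of_mem hρ.eigenvectorUnitary.2

theorem cfc_mul_unitary (f : ℝ → ℝ) : cfc f ρ * (hρ.eigenvectorUnitary : Mat n)
    = (hρ.eigenvectorUnitary : Mat n) * Matrix.diagonal fun i => (f (hρ.eigenvalues i) : ℂ) := by
  rw [hρ.cfc_eq, Matrix.IsHermitian.cfc, Unitary.conjStarAlgAut_apply, mul_assoc, mul_assoc,
    Unitary.star_mul_self_of_mem hρ.eigenvectorUnitary.2, mul_one]
  rfl

theorem unitary_mul_cfc (f : ℝ → ℝ) : (hρ.eigenvectorUnitary : Mat n)ᴴ * cfc f ρ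
    = (Matrix.diagonal fun i => (f (hρ.eigenvalues i) : ℂ)) * (hρ.eigenvectorUnitary : Mat n)ᴴ := by
  have h := congrArg Matrix.conjTranspose (cfc_mul_unitary hρ f)
  have hf : (cfc f ρ)ᴴ = cfc f ρ := cfc_predicate f ρ
  rw [Matrix.conjTranspose_mul, Matrix.conjTranspose_mul, hf, Matrix.diagonal_conjTranspose] at h
  rw [h]
  congr 2
  ext i
  simp

theorem diagonal_mul_single (d : Fin n → ℂ) (i k : Fin n) :
    Matrix.diagonal d * Matrix.single i k 1 = d i • Matrix.single i k (1 : ℂ) := by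
  ext a b
  rw [Matrix.diagonal_mul, Matrix.smul_apply, Matrix.single_apply, smul_eq_mul]
  split_ifs with h
  · rw [h.1]
  · simp

theorem single_mul_diagonal (d : Fin n → ℂ) (i k : Fin n) :
    Matrix.single i k 1 * Matrix.diagonal d = d k • Matrix.single i k (1 : ℂ) := by
  ext a b
  rw [Matrix.mul_diagonal, Matrix.smul_apply, Matrix.single_apply, smul_eq_mul]
  split_ifs with h
  · rw [h.2, mul_comm]
  · simp

theorem Lop_cfc_eig (f : ℝ → ℝ) (p : Fin n × Fin n) :
    Lop (cfc f ρ) (eig hρ p) = (f (hρ.eigenvalues p.1) : ℂ) • eig hρ p := by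
  apply mat_injective
  simp only [mat_Lop, mat_smul, eig, mat_toGNS]
  rw [← mul_assoc, ← mul_assoc, cfc_mul_unitary, mul_assoc _ (Matrix.diagonal _),
    diagonal_mul_single, Matrix.mul_smul, Matrix.smul_mul]

theorem Rop_cfc_eig (f : ℝ → ℝ) (p : Fin n × Fin n) :
    Rop (cfc f ρ) (eig hρ p) = (f (hρ.eigenvalues p.2) : ℂ) • eig hρ p := by
  apply mat_injective
  simp only [mat_Rop, mat_smul, eig, mat_toGNS]
  rw [mul_assoc, unitary_mul_cfc, ← mul_assoc, mul_assoc _ (Matrix.single _ _ _),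
    single_mul_diagonal, Matrix.mul_smul, Matrix.smul_mul]

theorem Lop_eig (p : Fin n × Fin n) :
    Lop ρ (eig hρ p) = (hρ.eigenvalues p.1 : ℂ) • eig hρ p := by
  have := Lop_cfc_eig hρ id p
  have hid : cfc (id : ℝ → ℝ) ρ = ρ := cfc_id ℝ ρ hρ
  simpa only [hid, id] using this

theorem Rop_eig (p : Fin n × Fin n) :
    Rop ρ (eig hρ p) = (hρ.eigenvalues p.2 : ℂ) • eig hρ p := by
  have := Rop_cfc_eig hρ id p
  have hid : cfc (id : ℝ → ℝ) ρ = ρ := cfc_id ℝ ρ hρ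
  simpa only [hid, id] using this

theorem sum_coef_eig (X : GNS n) : ∑ p, coef hρ p X • eig hρ p = X := by
  apply mat_injective
  set U := (hρ.eigenvectorUnitary : Mat n) with hU
  have h1 : mat X = U * (Uᴴ * mat X * U) * Uᴴ := by
    have := unitary_mul_conjTranspose hρ
    rw [← hU] at this
    calc mat X = (U * Uᴴ) * mat X * (U * Uᴴ) := by rw [this, one_mul, mul_one]
      _ = _ := by simp only [mul_assoc]
  rw [mat_sum]
  conv_rhs => rw [h1, Matrix.matrix_eq_sum_single (Uᴴ * mat X * U), ← Finset.sum_product',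
    Finset.mul_sum, Finset.sum_mul]
  refine Finset.sum_congr rfl fun p _ => ?_
  have h2 : Matrix.single p.1 p.2 ((Uᴴ * mat X * U) p.1 p.2)
      = (Uᴴ * mat X * U) p.1 p.2 • Matrix.single p.1 p.2 (1 : ℂ) := by
    rw [Matrix.smul_single, smul_eq_mul, mul_one]
  rw [h2, Matrix.mul_smul, Matrix.smul_mul]
  rfl

theorem inner_eq_coef (X Y : GNS n) :
    ⟪X, Y⟫_ℂ = (∑ p, (starRingEnd ℂ) (coef hρ p X) * coef hρ p Y) / n := by
  rw [gns_inner, tau]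
  congr 1
  set U := (hρ.eigenvectorUnitary : Mat n) with hU
  have h1 : ((mat X)ᴴ * mat Y).trace = ((Uᴴ * mat X * U)ᴴ * (Uᴴ * mat Y * U)).trace := by
    have h2 := unitary_mul_conjTranspose hρ
    rw [← hU] at h2
    have : (Uᴴ * mat X * U)ᴴ * (Uᴴ * mat Y * U) = Uᴴ * ((mat X)ᴴ * ((U * Uᴴ) * mat Y)) * U := by
      simp only [Matrix.conjTranspose_mul, Matrix.conjTranspose_conjTranspose, mul_assoc]
    rw [this, h2, one_mul]
    generalize (mat X)ᴴ * mat Y = M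
    rw [Matrix.trace_mul_comm, ← mul_assoc, h2, one_mul]
  rw [h1, Fintype.sum_prod_type, Finset.sum_comm]
  rfl

theorem coef_eig (p q : Fin n × Fin n) : coef hρ p (eig hρ q) = if q = p then 1 else 0 := by
  set U := (hρ.eigenvectorUnitary : Mat n) with hU
  have h2 := unitary_conjTranspose_mul hρ
  rw [← hU] at h2
  have : Uᴴ * mat (eig hρ q) * U = Matrix.single q.1 q.2 1 := by
    simp only [eig, mat_toGNS, ← hU]
    calc _ = (Uᴴ * U) * Matrix.single q.1 q.2 1 * (Uᴴ * U) := by simp only [mul_assoc]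
      _ = _ := by rw [h2, one_mul, mul_one]
  simp only [coef, LinearMap.coe_mk, AddHom.coe_mk, ← hU, this, Matrix.single_apply, Prod.ext_iff]

theorem eig_ne_zero (p : Fin n × Fin n) : eig hρ p ≠ 0 := fun h => by
  have := coef_eig hρ p p
  simp [h] at this

theorem eig_conjTranspose (p : Fin n × Fin n) :
    (mat (eig hρ p))ᴴ = mat (eig hρ p.swap) := by
  simp [eig, Matrix.conjTranspose_mul, mul_assoc]

theorem clm_ext_eig {V : Type*} [NormedAddCommGroup V] [NormedSpace ℂ V] {S T : GNS n →L[ℂ] V}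
    (h : ∀ p, S (eig hρ p) = T (eig hρ p)) : S = T := by
  ext X
  rw [← sum_coef_eig hρ X]
  simp only [map_sum, map_smul, h]

/-- The operators `T ρ` act on the joint eigenvectors of left and right multiplication by `ρ` by a
function `m` of the eigenvalues. Nothing is required of `T ρ` if `ρ` is not positive
semidefinite. -/
def IsSchur (m : ℝ → ℝ → ℝ) (T : Mat n → GNS n →L[ℂ] GNS n) : Prop :=
  ∀ ρ : Mat n, ρ.PosSemidef → ∀ (X : GNS n) (x y : ℝ), X ≠ 0 → Lop ρ X = (x : ℂ) • X →
    Rop ρ X = (y : ℂ) • X → T ρ X = (m x y : ℂ) • X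

theorem coef_Lop (p : Fin n × Fin n) (X : GNS n) :
    coef hρ p (Lop ρ X) = (hρ.eigenvalues p.1 : ℂ) * coef hρ p X := by
  conv_lhs => rw [← sum_coef_eig hρ X]
  simp only [map_sum, map_smul, Lop_eig, coef_eig, smul_eq_mul, mul_ite, mul_one, mul_zero,
    Finset.sum_ite_eq', Finset.mem_univ, if_true]
  ring

theorem coef_Rop (p : Fin n × Fin n) (X : GNS n) :
    coef hρ p (Rop ρ X) = (hρ.eigenvalues p.2 : ℂ) * coef hρ p X := by
  conv_lhs => rw [← sum_coef_eig hρ X]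
  simp only [map_sum, map_smul, Rop_eig, coef_eig, smul_eq_mul, mul_ite, mul_one, mul_zero,
    Finset.sum_ite_eq', Finset.mem_univ, if_true]
  ring

/-- It suffices to know the action on one eigenbasis. -/
theorem isSchur_of_eig {m : ℝ → ℝ → ℝ} {T : Mat n → GNS n →L[ℂ] GNS n}
    (h : ∀ (ρ : Mat n) (hρ : ρ.PosSemidef) (p : Fin n × Fin n), T ρ (eig hρ.1 p)
      = (m (hρ.1.eigenvalues p.1) (hρ.1.eigenvalues p.2) : ℂ) • eig hρ.1 p) : IsSchur m T := by
  intro ρ hρ X x y _ hx hy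
  conv_lhs => rw [← sum_coef_eig hρ.1 X]
  conv_rhs => rw [← sum_coef_eig hρ.1 X]
  simp only [map_sum, map_smul, Finset.smul_sum]
  refine Finset.sum_congr rfl fun p _ => ?_
  rw [smul_comm, h ρ hρ p]
  rcases eq_or_ne (coef hρ.1 p X) 0 with h0 | h0
  · simp [h0]
  have h1 := coef_Lop hρ.1 p X
  have h2 := coef_Rop hρ.1 p X
  rw [hx, map_smul, smul_eq_mul] at h1
  rw [hy, map_smul, smul_eq_mul] at h2
  have h3 : x = hρ.1.eigenvalues p.1 := by exact_mod_cast mul_right_cancel₀ h0 h1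
  have h4 : y = hρ.1.eigenvalues p.2 := by exact_mod_cast mul_right_cancel₀ h0 h2
  rw [h3, h4]

variable {m : ℝ → ℝ → ℝ} {T : Mat n → GNS n →L[ℂ] GNS n}

theorem IsSchur.apply_eig (h : IsSchur m T) (hρ : ρ.PosSemidef) (p : Fin n × Fin n) :
    T ρ (eig hρ.1 p) = (m (hρ.1.eigenvalues p.1) (hρ.1.eigenvalues p.2) : ℂ) • eig hρ.1 p :=
  h ρ hρ _ _ _ (eig_ne_zero _ _) (Lop_eig _ _) (Rop_eig _ _)

theorem IsSchur.coef_apply (h : IsSchur m T) (hρ : ρ.PosSemidef) (p : Fin n × Fin n) (X : GNS n) :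
    coef hρ.1 p (T ρ X)
      = (m (hρ.1.eigenvalues p.1) (hρ.1.eigenvalues p.2) : ℂ) * coef hρ.1 p X := by
  conv_lhs => rw [← sum_coef_eig hρ.1 X]
  simp only [map_sum, map_smul, h.apply_eig hρ, coef_eig, smul_eq_mul, mul_ite, mul_one, mul_zero,
    Finset.sum_ite_eq', Finset.mem_univ, if_true]
  ring

theorem IsSchur.inner_symm (h : IsSchur m T) (hρ : ρ.PosSemidef) (X Y : GNS n) :
    ⟪T ρ X, Y⟫_ℂ = ⟪X, T ρ Y⟫_ℂ := by
  rw [inner_eq_coef hρ.1, inner_eq_coef hρ.1]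
  congr 1
  refine Finset.sum_congr rfl fun p _ => ?_
  rw [h.coef_apply hρ, h.coef_apply hρ, map_mul, Complex.conj_ofReal]
  ring

theorem IsSchur.re_inner (h : IsSchur m T) (hρ : ρ.PosSemidef) (X : GNS n) :
    (⟪T ρ X, X⟫_ℂ).re = (∑ p : Fin n × Fin n, m (hρ.1.eigenvalues p.1) (hρ.1.eigenvalues p.2)
      * ‖coef hρ.1 p X‖ ^ 2) / n := by
  rw [inner_eq_coef hρ.1, Complex.div_natCast_re, Complex.re_sum]
  congr 1
  refine Finset.sum_congr rfl fun p _ => ?_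
  rw [h.coef_apply hρ, map_mul, Complex.conj_ofReal, mul_assoc, mul_comm ((starRingEnd ℂ) _),
    Complex.mul_conj, Complex.normSq_eq_norm_sq, ← Complex.ofReal_mul, Complex.ofReal_re]

/-- Nonnegative, monotone and homogeneous functions on the quadrant which are positive in its
interior. -/
structure IsWeight (m : ℝ → ℝ → ℝ) : Prop where
  nonneg : ∀ x y, 0 ≤ x → 0 ≤ y → 0 ≤ m x y
  mono : ∀ x y x' y', 0 ≤ x → 0 ≤ y → x ≤ x' → y ≤ y' → m x y ≤ m x' y'
  homog : ∀ c x y, 0 < c → 0 ≤ x → 0 ≤ y → m (c * x) (c * y) = c * m x y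
  pos : ∀ x y, 0 < x → 0 < y → 0 < m x y

theorem IsSchur.re_inner_nonneg (h : IsSchur m T) (hm : IsWeight m) (hρ : ρ.PosSemidef)
    (X : GNS n) : 0 ≤ (⟪T ρ X, X⟫_ℂ).re := by
  rw [h.re_inner hρ]
  exact div_nonneg (Finset.sum_nonneg fun p _ => mul_nonneg
    (hm.nonneg _ _ (hρ.eigenvalues_nonneg _) (hρ.eigenvalues_nonneg _)) (sq_nonneg _))
    (Nat.cast_nonneg n)

theorem IsSchur.re_inner_pos (h : IsSchur m T) (hm : IsWeight m) (hρ : ρ.PosDef) {X : GNS n}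
    (hX : X ≠ 0) : 0 < (⟪T ρ X, X⟫_ℂ).re := by
  have hn : 0 < (n : ℝ) := by
    rcases Nat.eq_zero_or_pos n with rfl | hn
    · exact absurd (Subsingleton.elim (α := Mat 0) X 0) hX
    · exact_mod_cast hn
  have hne : ∃ p, coef hρ.1 p X ≠ 0 := by
    by_contra! hall
    apply hX
    rw [← sum_coef_eig hρ.1 X]
    simp [hall]
  obtain ⟨p, hp⟩ := hne
  rw [h.re_inner hρ.posSemidef]
  refine div_pos (Finset.sum_pos' (fun p _ => mul_nonneg
    (hm.nonneg _ _ (hρ.posSemidef.eigenvalues_nonneg _) (hρ.posSemidef.eigenvalues_nonneg _))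
    (sq_nonneg _)) ⟨p, Finset.mem_univ _, ?_⟩) hn
  exact mul_pos (hm.pos _ _ (hρ.eigenvalues_pos _) (hρ.eigenvalues_pos _))
    (pow_pos (norm_pos_iff.2 hp) 2)

/-- Homogeneity in `ρ`, since `ρ` and its multiples have the same joint eigenvectors. -/
theorem IsSchur.smul (h : IsSchur m T) (hm : IsWeight m) (hρ : ρ.PosSemidef) {c : ℝ}
    (hc : 0 < c) : T ((c : ℂ) • ρ) = (c : ℂ) • T ρ := by
  have hcρ : ((c : ℂ) • ρ).PosSemidef := hρ.smul (by exact_mod_cast hc.le)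
  refine clm_ext_eig hρ.1 fun p => ?_
  have h1 : Lop ((c : ℂ) • ρ) (eig hρ.1 p) = ((c * hρ.1.eigenvalues p.1 : ℝ) : ℂ) • eig hρ.1 p := by
    have := congrArg (fun Y => (c : ℂ) • Y) (Lop_eig hρ.1 p)
    simp only [smul_smul] at this
    rw [Complex.ofReal_mul, ← this]
    apply mat_injective
    simp [-Complex.coe_smul]
  have h2 : Rop ((c : ℂ) • ρ) (eig hρ.1 p) = ((c * hρ.1.eigenvalues p.2 : ℝ) : ℂ) • eig hρ.1 p := by
    have := congrArg (fun Y => (c : ℂ) • Y) (Rop_eig hρ.1 p)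
    simp only [smul_smul] at this
    rw [Complex.ofReal_mul, ← this]
    apply mat_injective
    simp [-Complex.coe_smul]
  rw [h _ hcρ _ _ _ (eig_ne_zero _ _) h1 h2, smul_apply, h.apply_eig hρ,
    hm.homog c _ _ hc (hρ.eigenvalues_nonneg _) (hρ.eigenvalues_nonneg _), Complex.ofReal_mul,
    smul_smul]

/-- The matrices `ρ` and `ρ + c` have the same joint eigenvectors, and the symbol is monotone. -/
theorem IsSchur.le_add (h : IsSchur m T) (hm : IsWeight m) (hρ : ρ.PosSemidef) {c : ℝ}
    (hc : 0 ≤ c) (X : GNS n) :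
    (⟪T ρ X, X⟫_ℂ).re ≤ (⟪T (ρ + (c : ℂ) • 1) X, X⟫_ℂ).re := by
  have hcρ : (ρ + (c : ℂ) • 1).PosSemidef :=
    hρ.add (Matrix.PosSemidef.one.smul (by exact_mod_cast hc))
  set w : Fin n × Fin n → ℝ := fun p => m (hρ.1.eigenvalues p.1 + c) (hρ.1.eigenvalues p.2 + c)
    with hw
  have hT : ∀ p, coef hρ.1 p (T (ρ + (c : ℂ) • 1) X) = (w p : ℂ) * coef hρ.1 p X := by
    intro p
    have h1 : ∀ q, T (ρ + (c : ℂ) • 1) (eig hρ.1 q) = (w q : ℂ) • eig hρ.1 q := by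
      intro q
      refine h _ hcρ _ _ _ (eig_ne_zero _ _) ?_ ?_
      · rw [Complex.ofReal_add, add_smul, ← Lop_eig]
        apply mat_injective
        simp [add_mul, -Complex.coe_smul]
      · rw [Complex.ofReal_add, add_smul, ← Rop_eig]
        apply mat_injective
        simp [mul_add, -Complex.coe_smul]
    conv_lhs => rw [← sum_coef_eig hρ.1 X]
    simp only [map_sum, map_smul, h1, coef_eig, smul_eq_mul, mul_ite, mul_one, mul_zero,
      Finset.sum_ite_eq', Finset.mem_univ, if_true]
    ring
  have hq : (⟪T (ρ + (c : ℂ) • 1) X, X⟫_ℂ).re = (∑ p, w p * ‖coef hρ.1 p X‖ ^ 2) / n := by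
    rw [inner_eq_coef hρ.1, Complex.div_natCast_re, Complex.re_sum]
    congr 1
    refine Finset.sum_congr rfl fun p _ => ?_
    rw [hT, map_mul, Complex.conj_ofReal, mul_assoc, mul_comm ((starRingEnd ℂ) _),
      Complex.mul_conj, Complex.normSq_eq_norm_sq, ← Complex.ofReal_mul, Complex.ofReal_re]
  rw [hq, h.re_inner hρ]
  refine div_le_div_of_nonneg_right (Finset.sum_le_sum fun p _ => ?_) (Nat.cast_nonneg n)
  exact mul_le_mul_of_nonneg_right (hm.mono _ _ _ _ (hρ.eigenvalues_nonneg _)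
    (hρ.eigenvalues_nonneg _) (by linarith) (by linarith)) (sq_nonneg _)

/-- Taking adjoints exchanges the two eigenvalues. -/
theorem IsSchur.conjTranspose {m' : ℝ → ℝ → ℝ} {T' : Mat n → GNS n →L[ℂ] GNS n}
    (h : IsSchur m T) (h' : IsSchur m' T') (hmm : ∀ x y, 0 ≤ x → 0 ≤ y → m' x y = m y x)
    (hρ : ρ.PosSemidef) (X : GNS n) :
    mat (T' ρ (toGNS (mat X)ᴴ)) = (mat (T ρ X))ᴴ := by
  have hX : (mat X)ᴴ = ∑ p, (starRingEnd ℂ) (coef hρ.1 p X) • mat (eig hρ.1 p.swap) := by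
    conv_lhs => rw [← sum_coef_eig hρ.1 X]
    rw [mat_sum, Matrix.conjTranspose_sum]
    simp [Matrix.conjTranspose_smul, eig_conjTranspose]
  have hTX : mat (T ρ X) = ∑ p, coef hρ.1 p X •
      ((m (hρ.1.eigenvalues p.1) (hρ.1.eigenvalues p.2) : ℂ) • mat (eig hρ.1 p)) := by
    conv_lhs => rw [← sum_coef_eig hρ.1 X]
    simp only [map_sum, map_smul, h.apply_eig hρ, mat_sum, mat_smul]
  rw [hX, hTX, Matrix.conjTranspose_sum, map_sum, map_sum, mat_sum]
  refine Finset.sum_congr rfl fun p _ => ?_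
  rw [map_smul, map_smul, toGNS_mat, h'.apply_eig hρ, Prod.fst_swap, Prod.snd_swap,
    hmm _ _ (hρ.eigenvalues_nonneg _) (hρ.eigenvalues_nonneg _)]
  simp [Matrix.conjTranspose_smul, eig_conjTranspose, -Complex.coe_smul]

theorem Lop_aeval_eig (q : Polynomial ℂ) (p : Fin n × Fin n) :
    Lop (Polynomial.aeval ρ q) (eig hρ p) = q.eval (hρ.eigenvalues p.1 : ℂ) • eig hρ p := by
  induction q using Polynomial.induction_on' with
  | add a b ha hb =>
    rw [Polynomial.eval_add, add_smul, ← ha, ← hb, map_add]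
    apply mat_injective
    simp [add_mul]
  | monomial k a =>
    induction k with
    | zero =>
      apply mat_injective
      simp [Algebra.algebraMap_eq_smul_one]
    | succ k ih =>
      have h1 : Polynomial.aeval ρ (Polynomial.monomial (k + 1) a)
          = ρ * Polynomial.aeval ρ (Polynomial.monomial k a) := by
        rw [Polynomial.aeval_monomial, Polynomial.aeval_monomial, pow_succ', ← mul_assoc,
          Algebra.commutes, mul_assoc]
      have h2 : Lop (ρ * Polynomial.aeval ρ (Polynomial.monomial k a)) (eig hρ p)
          = Lop ρ (Lop (Polynomial.aeval ρ (Polynomial.monomial k a)) (eig hρ p)) := by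
        apply mat_injective
        simp [mul_assoc]
      rw [h1, h2, ih, map_smul, Lop_eig, smul_smul]
      congr 1
      simp only [Polynomial.eval_monomial]
      ring

theorem Rop_aeval_eig (q : Polynomial ℂ) (p : Fin n × Fin n) :
    Rop (Polynomial.aeval ρ q) (eig hρ p) = q.eval (hρ.eigenvalues p.2 : ℂ) • eig hρ p := by
  induction q using Polynomial.induction_on' with
  | add a b ha hb =>
    rw [Polynomial.eval_add, add_smul, ← ha, ← hb, map_add]
    apply mat_injective
    simp [mul_add]
  | monomial k a =>
    induction k with
    | zero =>
      apply mat_injective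
      simp [Algebra.algebraMap_eq_smul_one]
    | succ k ih =>
      have h1 : Polynomial.aeval ρ (Polynomial.monomial (k + 1) a)
          = Polynomial.aeval ρ (Polynomial.monomial k a) * ρ := by
        rw [Polynomial.aeval_monomial, Polynomial.aeval_monomial, pow_succ, mul_assoc]
      have h2 : Rop (Polynomial.aeval ρ (Polynomial.monomial k a) * ρ) (eig hρ p)
          = Rop ρ (Rop (Polynomial.aeval ρ (Polynomial.monomial k a)) (eig hρ p)) := by
        apply mat_injective
        simp [mul_assoc]
      rw [h1, h2, ih, map_smul, Rop_eig, smul_smul]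
      congr 1
      simp only [Polynomial.eval_monomial]
      ring

/-- A subspace which is stable under left and right multiplication by polynomials in `ρ` is stable
under `T ρ`, which is a linear combination of products of such multiplications by Lagrange
interpolation. -/
theorem IsSchur.apply_mem (h : IsSchur m T) {𝒜 : StarSubalgebra ℂ (Mat n)} (hρ : ρ.PosSemidef)
    (hρ𝒜 : ρ ∈ 𝒜) {K : Submodule ℂ (GNS n)} (hL : ∀ X ∈ 𝒜, ∀ v ∈ K, Lop X v ∈ K)
    (hR : ∀ X ∈ 𝒜, ∀ v ∈ K, Rop X v ∈ K) {X : GNS n} (hX : X ∈ K) : T ρ X ∈ K := by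
  classical
  set l : Fin n → ℝ := hρ.1.eigenvalues
  set s : Finset ℝ := Finset.univ.image l
  set b : ℝ → Polynomial ℂ := fun a => Lagrange.basis s (fun x : ℝ => (x : ℂ)) a
  have hinj : Set.InjOn (fun x : ℝ => (x : ℂ)) s := Complex.ofReal_injective.injOn
  have hb : ∀ a ∈ s, ∀ i, (b a).eval (l i : ℂ) = if l i = a then 1 else 0 := by
    intro a ha i
    split_ifs with hi
    · rw [hi]; exact Lagrange.eval_basis_self hinj ha
    · exact Lagrange.eval_basis_of_ne (Ne.symm hi) (Finset.mem_image_of_mem _ (Finset.mem_univ _))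
  have hmem : ∀ q : Polynomial ℂ, Polynomial.aeval ρ q ∈ 𝒜 := fun q => by
    have h1 := Polynomial.aeval_mem_adjoin_singleton ℂ ρ (p := q)
    exact (Algebra.adjoin_le (S := 𝒜.toSubalgebra) (by simpa using hρ𝒜)) h1
  have hT : T ρ = ∑ a ∈ s, ∑ c ∈ s, (m a c : ℂ) •
      (Lop (Polynomial.aeval ρ (b a)) ∘L Rop (Polynomial.aeval ρ (b c))) := by
    refine clm_ext_eig hρ.1 fun p => ?_
    rw [h.apply_eig hρ]
    simp only [sum_apply, smul_apply,
      ContinuousLinearMap.comp_apply, Rop_aeval_eig, Lop_aeval_eig, map_smul]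
    have h1 : ∀ i, l i ∈ s := fun i => Finset.mem_image_of_mem _ (Finset.mem_univ _)
    rw [Finset.sum_eq_single_of_mem (l p.1) (h1 _), Finset.sum_eq_single_of_mem (l p.2) (h1 _)]
    · rw [hb _ (h1 _), hb _ (h1 _)]
      simp [l]
    · intro c hc hne
      rw [hb c hc, if_neg (Ne.symm hne)]
      simp
    · intro a ha hne
      refine Finset.sum_eq_zero fun c _ => ?_
      rw [hb a ha, if_neg (Ne.symm hne)]
      simp
  rw [hT]
  simp only [sum_apply, smul_apply,
    ContinuousLinearMap.comp_apply]
  exact Submodule.sum_mem _ fun a _ => Submodule.sum_mem _ fun c _ => K.smul_mem _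
    (hL _ (hmem _) _ (hR _ (hmem _) _ hX))

end Schur

open QTransport

/-! ### The symbol of an operator connection -/

section Connection

open ContinuousLinearMap (adjoint)

variable {H : Type*} [NormedAddCommGroup H] [InnerProductSpace ℂ H] [CompleteSpace H]

theorem eq_zero_of_nonneg_of_inner_eq_zero {D : H →L[ℂ] H} (hD : 0 ≤ D) {v : H}
    (h : ⟪D v, v⟫_ℂ = 0) : D v = 0 := by
  have hr : IsSelfAdjoint (CFC.sqrt D) := IsSelfAdjoint.of_nonneg (CFC.sqrt_nonneg D)
  have hD' : ∀ x, D x = CFC.sqrt D (CFC.sqrt D x) := fun x => by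
    conv_lhs => rw [← CFC.sqrt_mul_sqrt_self D hD]
    rfl
  have h1 : CFC.sqrt D v = 0 := by
    rw [hD', ← ContinuousLinearMap.adjoint_inner_right, hr.adjoint_eq] at h
    exact inner_self_eq_zero.1 h
  rw [hD', h1, map_zero]

/-- A positive operator dominates its part along an eigenvector: the difference is the compression
of the operator to the orthogonal complement. -/
theorem smul_rankOne_le {A : H →L[ℂ] H} (hA : 0 ≤ A) {v : H} (hv : ‖v‖ = 1) {a : ℝ}
    (h : A v = (a : ℂ) • v) : (a : ℂ) • InnerProductSpace.rankOne ℂ v v ≤ A := by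
  set P := InnerProductSpace.rankOne ℂ v v with hP
  have hPsa : IsSelfAdjoint P := (InnerProductSpace.isPositive_rankOne_self v).isSelfAdjoint
  have hPP : P * P = P := InnerProductSpace.isIdempotentElem_rankOne_self hv
  have hAP : A * P = (a : ℂ) • P := by
    ext x
    simp only [hP, mul_apply_eq_comp, InnerProductSpace.rankOne_apply, map_smul, h,
      smul_apply]
    exact smul_comm _ _ _
  have hPA : P * A = (a : ℂ) • P := by
    have := congrArg star hAP
    rwa [star_mul, hPsa.star_eq, (IsSelfAdjoint.of_nonneg hA).star_eq, star_smul, hPsa.star_eq,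
      Complex.star_def, Complex.conj_ofReal] at this
  have h1 := ((IsSelfAdjoint.one (H →L[ℂ] H)).sub hPsa).conjugate_nonneg hA
  have h2 : (1 - P) * A * (1 - P) = A - (a : ℂ) • P := by
    rw [sub_mul, one_mul, hPA, mul_sub, mul_one, sub_mul, hAP, smul_mul_assoc, hPP, sub_self,
      sub_zero]
  rw [h2] at h1
  exact sub_nonneg.1 h1

theorem rankOne_conj {A : H →L[ℂ] H} {v : H} (hv : ‖v‖ = 1) {a : ℝ} (h : A v = (a : ℂ) • v) :
    InnerProductSpace.rankOne ℂ v v ∘L A ∘L InnerProductSpace.rankOne ℂ v v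
      = (a : ℂ) • InnerProductSpace.rankOne ℂ v v := by
  ext x
  simp only [ContinuousLinearMap.comp_apply, InnerProductSpace.rankOne_apply, map_smul, h,
    smul_apply, inner_self_eq_norm_sq_to_K, hv]
  simp only [one_pow, mul_one, smul_smul, RCLike.ofReal_one]
  congr 1
  simp [mul_comm]

/-- `m` is the symbol of the binary operation `Λ` on positive operators: on a joint eigenvector of
`A` and `B`, the operator `Λ A B` acts by the value of `m` at the eigenvalues. -/
def IsSymbol (m : ℝ → ℝ → ℝ) (Λ : (H →L[ℂ] H) → (H →L[ℂ] H) → (H →L[ℂ] H)) : Prop :=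
  ∀ A B, 0 ≤ A → 0 ≤ B → ∀ (v : H) (a b : ℝ), v ≠ 0 → A v = (a : ℂ) • v → B v = (b : ℂ) • v →
    Λ A B v = (m a b : ℂ) • v

theorem re_inner_le_of_le {S T : H →L[ℂ] H} (h : S ≤ T) (v : H) :
    (⟪S v, v⟫_ℂ).re ≤ (⟪T v, v⟫_ℂ).re := by
  have := ((ContinuousLinearMap.le_def S T).1 h).re_inner_nonneg_left v
  rw [sub_apply, inner_sub_left, map_sub] at this
  simpa using this

theorem nonneg_eigenvalue {A : H →L[ℂ] H} (hA : 0 ≤ A) {v : H} (hv : v ≠ 0) {a : ℝ}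
    (h : A v = (a : ℂ) • v) : 0 ≤ a := by
  have h1 := re_inner_le_of_le hA v
  rw [h, inner_smul_left, inner_self_eq_norm_sq_to_K] at h1
  have h2 : 0 < ‖v‖ ^ 2 := pow_pos (norm_pos_iff.2 hv) 2
  have h3 : 0 ≤ a * ‖v‖ ^ 2 := by
    have h4 : (⟪(0 : H →L[ℂ] H) v, v⟫_ℂ).re = 0 := by simp
    have h5 : ((starRingEnd ℂ) (a : ℂ) * ((‖v‖ : ℝ) : ℂ) ^ 2).re = a * ‖v‖ ^ 2 := by
      rw [Complex.conj_ofReal, ← Complex.ofReal_pow, ← Complex.ofReal_mul, Complex.ofReal_re]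
    exact h5 ▸ h4 ▸ h1
  exact nonneg_of_mul_nonneg_left h3 h2

variable {Λ : (H →L[ℂ] H) → (H →L[ℂ] H) → (H →L[ℂ] H)}

/-- Joint eigenvectors of `A` and `B` are eigenvectors of `Λ A B`, and the eigenvalue depends only
on the vector and on its eigenvalues: compare `Λ A B` with the value of `Λ` at the multiples of the
rank one projection along the eigenvector. -/
theorem QTransport.IsOperatorConnection.apply_eigenvector (hΛ : IsOperatorConnection Λ)
    {A B : H →L[ℂ] H} (hA : 0 ≤ A) (hB : 0 ≤ B) {v : H} (hv : ‖v‖ = 1) {a b : ℝ}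
    (ha : A v = (a : ℂ) • v) (hb : B v = (b : ℂ) • v) :
    Λ A B v = ((⟪Λ ((a : ℂ) • InnerProductSpace.rankOne ℂ v v)
      ((b : ℂ) • InnerProductSpace.rankOne ℂ v v) v, v⟫_ℂ).re : ℂ) • v := by
  have hv0 : v ≠ 0 := fun h => by simp [h] at hv
  have ha0 := nonneg_eigenvalue hA hv0 ha
  have hb0 := nonneg_eigenvalue hB hv0 hb
  set P := InnerProductSpace.rankOne ℂ v v with hP
  have hP0 : 0 ≤ P :=
    (ContinuousLinearMap.nonneg_iff_isPositive _).2 (InnerProductSpace.isPositive_rankOne_self v)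
  have haP : 0 ≤ (a : ℂ) • P := smul_nonneg (by exact_mod_cast ha0) hP0
  have hbP : 0 ≤ (b : ℂ) • P := smul_nonneg (by exact_mod_cast hb0) hP0
  have hPv : P v = v := by
    rw [hP, InnerProductSpace.rankOne_apply, inner_self_eq_norm_sq_to_K, hv]; simp
  have haPv : ((a : ℂ) • P) v = (a : ℂ) • v := by rw [smul_apply, hPv]
  have hbPv : ((b : ℂ) • P) v = (b : ℂ) • v := by rw [smul_apply, hPv]
  set T := Λ ((a : ℂ) • P) ((b : ℂ) • P) with hT
  set s := (⟪T v, v⟫_ℂ).re with hs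
  have hT0 : 0 ≤ T := hΛ.nonneg _ _ haP hbP
  have hle : T ≤ Λ A B :=
    hΛ.mono _ _ _ _ haP hbP (smul_rankOne_le hA hv ha) (smul_rankOne_le hB hv hb)
  have hge : P ∘L Λ A B ∘L P ≤ T := by
    have := hΛ.transformer A B P hA hB hP0
    rwa [rankOne_conj hv ha, rankOne_conj hv hb] at this
  have hPTP : P ∘L T ∘L P = (s : ℂ) • P := by
    have h1 : (⟪v, T v⟫_ℂ) = s := by
      have h2 := ((ContinuousLinearMap.nonneg_iff_isPositive _).1 hT0).inner_nonneg_right v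
      have h3 : (⟪v, T v⟫_ℂ).re = s := by rw [hs, ← inner_conj_symm, Complex.conj_re]
      rw [← h3]
      exact Complex.ext rfl (by simpa using (Complex.le_def.1 h2).2.symm)
    ext x
    simp only [hP, ContinuousLinearMap.comp_apply, InnerProductSpace.rankOne_apply, map_smul,
      smul_apply, h1]
    rw [smul_smul, smul_smul, mul_comm]
  have hPT : (s : ℂ) • P ≤ T := by
    have := hΛ.transformer _ _ P haP hbP hP0
    rwa [rankOne_conj hv haPv, rankOne_conj hv hbPv, ← hT, hPTP] at this
  have hD : 0 ≤ Λ A B - (s : ℂ) • P := sub_nonneg.2 (hPT.trans hle)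
  have hPv' : ∀ x, ⟪P x, v⟫_ℂ = ⟪x, v⟫_ℂ := fun x => by
    rw [hP, InnerProductSpace.rankOne_apply, inner_smul_left, inner_self_eq_norm_sq_to_K, hv,
      inner_conj_symm]
    simp
  -- the positive operator `Λ A B - s • P` has expectation zero in the state `v`
  have hval : ⟪(Λ A B - (s : ℂ) • P) v, v⟫_ℂ = 0 := by
    have h2 := ((ContinuousLinearMap.nonneg_iff_isPositive _).1 hD).inner_nonneg_left v
    have h4 := re_inner_le_of_le hge v
    rw [ContinuousLinearMap.comp_apply, ContinuousLinearMap.comp_apply, hPv, hPv'] at h4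
    have h5 : (⟪(Λ A B - (s : ℂ) • P) v, v⟫_ℂ).re = (⟪Λ A B v, v⟫_ℂ).re - s := by
      rw [sub_apply, smul_apply, hPv, inner_sub_left, inner_smul_left,
        inner_self_eq_norm_sq_to_K, hv]
      simp
    refine Complex.ext (le_antisymm ?_ (Complex.le_def.1 h2).1) (Complex.le_def.1 h2).2.symm
    rw [h5, Complex.zero_re]
    linarith
  have := eq_zero_of_nonneg_of_inner_eq_zero hD hval
  rwa [sub_apply, smul_apply, hPv, sub_eq_zero] at this

/-- An operator connection has a symbol. The operator `Λ (a • 1) (b • 1)` is scalar, since each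
vector is an eigenvector of it, and the symbol is its value. -/
theorem QTransport.IsOperatorConnection.exists_isSymbol (hΛ : IsOperatorConnection Λ) :
    ∃ m, IsSymbol m Λ := by
  have hnorm : ∀ A B, 0 ≤ A → 0 ≤ B → ∀ (v : H) (a b : ℝ), v ≠ 0 → A v = (a : ℂ) • v →
      B v = (b : ℂ) • v → Λ A B v = Λ ((a : ℂ) • 1) ((b : ℂ) • 1) v ∧
        ∃ c : ℝ, Λ A B v = (c : ℂ) • v := by
    intro A B hA hB v a b hv ha hb
    have ha0 := nonneg_eigenvalue hA hv ha
    have hb0 := nonneg_eigenvalue hB hv hb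
    have h1 : (0 : H →L[ℂ] H) ≤ 1 := zero_le_one
    have hn : (‖v‖ : ℂ) ≠ 0 := by exact_mod_cast norm_ne_zero_iff.2 hv
    set w : H := ((‖v‖⁻¹ : ℝ) : ℂ) • v with hw
    have hw1 : ‖w‖ = 1 := by
      rw [hw, norm_smul, Complex.norm_real, norm_inv, norm_norm,
        inv_mul_cancel₀ (norm_ne_zero_iff.2 hv)]
    have hvw : v = (‖v‖ : ℂ) • w := by
      rw [hw, smul_smul, Complex.ofReal_inv, mul_inv_cancel₀ hn, one_smul]
    have haw : A w = (a : ℂ) • w := by rw [hw, map_smul, ha, smul_comm]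
    have hbw : B w = (b : ℂ) • w := by rw [hw, map_smul, hb, smul_comm]
    have e1 := hΛ.apply_eigenvector hA hB hw1 haw hbw
    have e2 := hΛ.apply_eigenvector (A := (a : ℂ) • 1) (B := (b : ℂ) • 1) (v := w) (a := a) (b := b)
      (smul_nonneg (by exact_mod_cast ha0) h1) (smul_nonneg (by exact_mod_cast hb0) h1) hw1
      (by simp) (by simp)
    clear_value w
    obtain ⟨c, hc⟩ : ∃ c : ℝ, Λ A B w = (c : ℂ) • w := ⟨_, e1⟩
    refine ⟨?_, c, ?_⟩
    · rw [hvw, map_smul, map_smul, e1, e2]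
    · conv_lhs => rw [hvw, map_smul, hc, smul_comm, ← hvw]
  have hscalar : ∀ a b : ℝ, 0 ≤ a → 0 ≤ b →
      ∃ c : ℝ, ∀ v, Λ ((a : ℂ) • 1) ((b : ℂ) • 1) v = (c : ℂ) • v := by
    intro a b ha hb
    have h1 : (0 : H →L[ℂ] H) ≤ 1 := zero_le_one
    have hev : ∀ v : H, v ≠ 0 → ∃ c : ℝ, Λ ((a : ℂ) • 1) ((b : ℂ) • 1) v = (c : ℂ) • v :=
      fun v hv => (hnorm _ _ (smul_nonneg (by exact_mod_cast ha) h1)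
        (smul_nonneg (by exact_mod_cast hb) h1) v a b hv (by simp) (by simp)).2
    obtain ⟨c, hc⟩ := LinearMap.exists_eq_smul_id_of_forall_notLinearIndependent
      (f := (Λ ((a : ℂ) • 1) ((b : ℂ) • 1)).toLinearMap) fun v => by
        rcases eq_or_ne v 0 with rfl | hv
        · intro h; exact h.ne_zero 0 rfl
        obtain ⟨c, hc⟩ := hev v hv
        intro h
        have := LinearIndependent.pair_iff.1 h (c : ℂ) (-1) (by
          rw [ContinuousLinearMap.coe_coe, hc]; simp)
        simpa using this.2
    have hc' : ∀ v, Λ ((a : ℂ) • 1) ((b : ℂ) • 1) v = c • v := fun v =>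
      congrArg (fun f : H →ₗ[ℂ] H => f v) hc
    rcases subsingleton_or_nontrivial H with hH | hH
    · exact ⟨0, fun v => Subsingleton.elim _ _⟩
    obtain ⟨v, hv⟩ := exists_ne (0 : H)
    obtain ⟨r, hr⟩ := hev v hv
    have : c = (r : ℂ) := smul_left_injective ℂ hv ((hc' v).symm.trans hr)
    exact ⟨r, fun v => by rw [hc', this]⟩
  choose m hm using hscalar
  refine ⟨fun a b => if h : 0 ≤ a ∧ 0 ≤ b then m a b h.1 h.2 else 0, ?_⟩
  intro A B hA hB v a b hv ha hb
  simp only [dif_pos (And.intro (nonneg_eigenvalue hA hv ha) (nonneg_eigenvalue hB hv hb))]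
  rw [(hnorm A B hA hB v a b hv ha hb).1, hm]

variable {m : ℝ → ℝ → ℝ}

theorem IsSymbol.apply_smul_one (hm : IsSymbol m Λ) {a b : ℝ} (ha : 0 ≤ a) (hb : 0 ≤ b) :
    Λ ((a : ℂ) • 1) ((b : ℂ) • 1) = (m a b : ℂ) • 1 := by
  have h1 : (0 : H →L[ℂ] H) ≤ 1 := zero_le_one
  ext v
  rcases eq_or_ne v 0 with rfl | hv
  · simp
  rw [hm _ _ (smul_nonneg (by exact_mod_cast ha) h1) (smul_nonneg (by exact_mod_cast hb) h1) v a b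
    hv (by simp) (by simp)]
  simp

theorem smul_one_le_iff [Nontrivial H] {a b : ℝ} :
    (a : ℂ) • (1 : H →L[ℂ] H) ≤ (b : ℂ) • 1 ↔ a ≤ b := by
  constructor
  · intro h
    obtain ⟨v, hv⟩ := exists_ne (0 : H)
    have h0 : (0 : H →L[ℂ] H) ≤ ((b - a : ℝ) : ℂ) • 1 := by
      rw [Complex.ofReal_sub, sub_smul]
      exact sub_nonneg.2 h
    linarith [nonneg_eigenvalue h0 hv (a := b - a) (by simp)]
  · intro h
    have h1 : (0 : H →L[ℂ] H) ≤ 1 := zero_le_one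
    exact smul_le_smul_of_nonneg_right (by exact_mod_cast h) h1

/-- The symbol is the restriction of the connection to multiples of the identity, from which it
inherits its properties; it is positive in the interior of the quadrant because a zero there would
force the connection to vanish. -/
theorem IsSymbol.isWeight [Nontrivial H] (hm : IsSymbol m Λ) (hΛ : IsOperatorConnection Λ)
    (h0 : ∃ A B, 0 ≤ A ∧ 0 ≤ B ∧ Λ A B ≠ 0) : IsWeight m := by
  have h1 : (0 : H →L[ℂ] H) ≤ 1 := zero_le_one
  have hs : ∀ a : ℝ, 0 ≤ a → (0 : H →L[ℂ] H) ≤ (a : ℂ) • 1 := fun a ha =>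
    smul_nonneg (by exact_mod_cast ha) h1
  have hnonneg : ∀ x y, 0 ≤ x → 0 ≤ y → 0 ≤ m x y := by
    intro x y hx hy
    have := hΛ.nonneg _ _ (hs x hx) (hs y hy)
    rw [hm.apply_smul_one hx hy] at this
    exact (smul_one_le_iff (H := H)).1 (by simpa only [Complex.ofReal_zero, zero_smul] using this)
  have hmono : ∀ x y x' y', 0 ≤ x → 0 ≤ y → x ≤ x' → y ≤ y' → m x y ≤ m x' y' := by
    intro x y x' y' hx hy hx' hy'
    have := hΛ.mono _ _ _ _ (hs x hx) (hs y hy) (smul_one_le_iff.2 hx') (smul_one_le_iff.2 hy')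
    rw [hm.apply_smul_one hx hy, hm.apply_smul_one (hx.trans hx') (hy.trans hy')] at this
    exact smul_one_le_iff.1 this
  have hhom : ∀ c x y, 0 < c → 0 ≤ x → 0 ≤ y → c * m x y ≤ m (c * x) (c * y) := by
    intro c x y hc hx hy
    have := hΛ.transformer _ _ ((Real.sqrt c : ℂ) • 1) (hs x hx) (hs y hy)
      (hs _ (Real.sqrt_nonneg c))
    have hconj : ∀ a : ℝ, (((Real.sqrt c : ℂ) • 1 : H →L[ℂ] H) ∘L
        ((a : ℂ) • 1 : H →L[ℂ] H) ∘L ((Real.sqrt c : ℂ) • 1 : H →L[ℂ] H))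
          = ((c * a : ℝ) : ℂ) • 1 := by
      intro a
      have hc2 : (Real.sqrt c : ℂ) * (Real.sqrt c : ℂ) = c := by
        exact_mod_cast Real.mul_self_sqrt hc.le
      ext v
      simp only [ContinuousLinearMap.comp_apply, smul_apply, one_apply_eq_self,
        smul_smul]
      rw [Complex.ofReal_mul, ← hc2]
      ring_nf
    rw [hm.apply_smul_one hx hy, hconj, hconj, hconj, hm.apply_smul_one (mul_nonneg hc.le hx)
      (mul_nonneg hc.le hy)] at this
    exact smul_one_le_iff.1 this
  have hhom' : ∀ c x y, 0 < c → 0 ≤ x → 0 ≤ y → m (c * x) (c * y) = c * m x y := by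
    intro c x y hc hx hy
    refine le_antisymm ?_ (hhom c x y hc hx hy)
    have := hhom c⁻¹ (c * x) (c * y) (inv_pos.2 hc) (mul_nonneg hc.le hx) (mul_nonneg hc.le hy)
    rwa [inv_mul_cancel_left₀ hc.ne', inv_mul_cancel_left₀ hc.ne', inv_mul_le_iff₀ hc] at this
  refine ⟨hnonneg, hmono, hhom', fun x y hx hy => ?_⟩
  refine lt_of_le_of_ne (hnonneg x y hx.le hy.le) fun hxy => ?_
  obtain ⟨A, B, hA, hB, hAB⟩ := h0
  apply hAB
  -- `A` and `B` are dominated by multiples of the identity, where the connection vanishes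
  obtain ⟨k, hk0, hkA, hkB⟩ : ∃ k : ℝ, 0 < k ∧ ‖A‖ ≤ k * x ∧ ‖B‖ ≤ k * y := by
    refine ⟨‖A‖ / x + ‖B‖ / y + 1, by positivity, ?_, ?_⟩
    · have : ‖A‖ = ‖A‖ / x * x := by field_simp
      have h2 : 0 ≤ (‖B‖ / y + 1) * x := by positivity
      linarith
    · have : ‖B‖ = ‖B‖ / y * y := by field_simp
      have h2 : 0 ≤ (‖A‖ / x + 1) * y := by positivity
      linarith
  have hle : ∀ (S : H →L[ℂ] H) (c : ℝ), 0 ≤ S → ‖S‖ ≤ c → S ≤ (c : ℂ) • 1 := by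
    intro S c hS hc
    have h2 := IsSelfAdjoint.le_algebraMap_norm_self (IsSelfAdjoint.of_nonneg hS)
    refine h2.trans ?_
    have : algebraMap ℝ (H →L[ℂ] H) ‖S‖ = ((‖S‖ : ℝ) : ℂ) • 1 := by
      rw [Algebra.algebraMap_eq_smul_one, Complex.coe_smul]
    rw [this]
    exact smul_one_le_iff.2 hc
  have h3 := hΛ.mono _ _ _ _ hA hB (hle A _ hA hkA) (hle B _ hB hkB)
  rw [hm.apply_smul_one (mul_nonneg hk0.le hx.le) (mul_nonneg hk0.le hy.le),
    hhom' k x y hk0 hx.le hy.le, ← hxy, mul_zero, Complex.ofReal_zero, zero_smul] at h3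
  exact le_antisymm h3 (hΛ.nonneg _ _ hA hB)

end Connection

open QTransport

/-! ### The operators defined by an operator connection -/

section ConnBracket

open ContinuousLinearMap (adjoint)

variable {n : ℕ} {H : Type*} [NormedAddCommGroup H] [InnerProductSpace ℂ H] [CompleteSpace H]

theorem IsSchur.nonneg {m : ℝ → ℝ → ℝ} {T : Mat n → GNS n →L[ℂ] GNS n} (h : IsSchur m T)
    (hm : IsWeight m) {ρ : Mat n} (hρ : ρ.PosSemidef) : 0 ≤ T ρ := by
  rw [ContinuousLinearMap.nonneg_iff_isPositive]
  refine ⟨fun X Y => h.inner_symm hρ X Y, fun X => ?_⟩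
  exact h.re_inner_nonneg hm hρ X

theorem Lop_nonneg {ρ : Mat n} (hρ : ρ.PosSemidef) : 0 ≤ Lop ρ :=
  IsSchur.nonneg (m := fun x _ => x) (T := Lop) (fun _ _ _ _ _ _ hx _ => hx)
    ⟨fun _ _ hx _ => hx, fun _ _ _ _ _ _ h _ => h, fun _ _ _ _ _ _ => rfl, fun _ _ hx _ => hx⟩ hρ

theorem Rop_nonneg {ρ : Mat n} (hρ : ρ.PosSemidef) : 0 ≤ Rop ρ :=
  IsSchur.nonneg (m := fun _ y => y) (T := Rop) (fun _ _ _ _ _ _ _ hy => hy)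
    ⟨fun _ _ _ hy => hy, fun _ _ _ _ _ _ _ h => h, fun _ _ _ _ _ _ => rfl, fun _ _ _ hy => hy⟩ hρ

theorem conj_adjoint_nonneg (d : GNS n →L[ℂ] H) {T : GNS n →L[ℂ] GNS n} (hT : 0 ≤ T) :
    0 ≤ d ∘L T ∘L adjoint d := by
  rw [ContinuousLinearMap.nonneg_iff_isPositive] at hT ⊢
  exact hT.conj_adjoint d

theorem adjoint_apply_isometry (ι : GNS n →ₗᵢ[ℂ] H) (X : GNS n) :
    adjoint ι.toContinuousLinearMap (ι X) = X := by
  refine ext_inner_right ℂ fun Y => ?_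
  rw [ContinuousLinearMap.adjoint_inner_left]
  exact ι.inner_map_map X Y

theorem adjoint_apply_orthogonal {ι κ : GNS n →ₗᵢ[ℂ] H} (h : ∀ X Y, ⟪ι X, κ Y⟫_ℂ = 0)
    (X : GNS n) : adjoint κ.toContinuousLinearMap (ι X) = 0 := by
  refine ext_inner_right ℂ fun Y => ?_
  rw [ContinuousLinearMap.adjoint_inner_left, inner_zero_left]
  exact h X Y

theorem extendOp_apply (ι : GNS n →ₗᵢ[ℂ] H) (T : GNS n →L[ℂ] GNS n) (X : GNS n) :
    extendOp ι T (ι X) = ι (T X) := by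
  have := adjoint_apply_isometry ι X
  simp only [extendOp, ContinuousLinearMap.comp_apply, this]
  rfl

variable {Λ : (H →L[ℂ] H) → (H →L[ℂ] H) → (H →L[ℂ] H)} {m : ℝ → ℝ → ℝ}

theorem IsSymbol.isSchur_connBracket (hm : IsSymbol m Λ) (ι : GNS n →ₗᵢ[ℂ] H) :
    IsSchur m (connBracket ι Λ) := by
  intro ρ hρ X x y hX hx hy
  have h1 : Λ (extendOp ι (Lop ρ)) (extendOp ι (Rop ρ)) (ι X) = (m x y : ℂ) • ι X := by
    refine hm _ _ (conj_adjoint_nonneg _ (Lop_nonneg hρ)) (conj_adjoint_nonneg _ (Rop_nonneg hρ))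
      _ x y ((map_ne_zero_iff ι ι.injective).2 hX) ?_ ?_
    · exact (extendOp_apply ι _ X).trans (by rw [hx, map_smul])
    · exact (extendOp_apply ι _ X).trans (by rw [hy, map_smul])
  simp only [connBracket, ContinuousLinearMap.comp_apply, LinearIsometry.coe_toContinuousLinearMap,
    h1, map_smul, adjoint_apply_isometry]

/-- An infinite-dimensional Hilbert space contains isometric copies of all finite-dimensional
ones. -/
theorem exists_linearIsometry (hH : ¬ FiniteDimensional ℂ H) (W : Type*) [NormedAddCommGroup W]
    [InnerProductSpace ℂ W] [FiniteDimensional ℂ W] : Nonempty (W →ₗᵢ[ℂ] H) := by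
  have hrank : ((Module.finrank ℂ W : ℕ) : Cardinal) ≤ Module.rank ℂ H := by
    refine (Cardinal.natCast_le_aleph0).trans ?_
    by_contra hlt
    exact hH (Module.rank_lt_aleph0_iff.1 (not_le.1 hlt))
  obtain ⟨f, hf⟩ := exists_linearIndependent_of_le_rank hrank
  set S := Submodule.span ℂ (range f)
  have hfin : FiniteDimensional ℂ S := FiniteDimensional.span_of_finite ℂ (finite_range f)
  have hS : Module.finrank ℂ W = Module.finrank ℂ S := by
    rw [finrank_span_eq_card hf, Fintype.card_fin]
  exact ⟨S.subtypeₗᵢ.comp ((stdOrthonormalBasis ℂ W).equiv (stdOrthonormalBasis ℂ S)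
    (finCongr hS)).toLinearIsometry⟩

theorem exists_orthogonal_linearIsometry (hH : ¬ FiniteDimensional ℂ H) (n : ℕ) :
    ∃ ι κ : GNS n →ₗᵢ[ℂ] H, ∀ X Y, ⟪ι X, κ Y⟫_ℂ = 0 := by
  obtain ⟨φ⟩ := exists_linearIsometry hH (PiLp 2 fun _ : Fin 2 => GNS n)
  let incl : Fin 2 → GNS n →ₗᵢ[ℂ] PiLp 2 fun _ : Fin 2 => GNS n := fun i =>
    { toLinearMap := (WithLp.linearEquiv 2 ℂ (Fin 2 → GNS n)).symm.toLinearMap ∘ₗ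
        LinearMap.single ℂ (fun _ => GNS n) i
      norm_map' := fun X => PiLp.norm_single 2 (fun _ : Fin 2 => GNS n) i X }
  refine ⟨φ.comp (incl 0), φ.comp (incl 1), fun X Y => ?_⟩
  have h : ∀ i X, incl i X = WithLp.toLp 2 (Pi.single i X) := fun i X => rfl
  refine (φ.inner_map_map _ _).trans ?_
  change ⟪incl 0 X, incl 1 Y⟫_ℂ = 0
  rw [h, h, PiLp.inner_apply]
  simp

/-- Joint concavity of an operator connection, in superadditive form. The operators
`L ρ ⊕ L ρ'` and `R ρ ⊕ R ρ'` act on two orthogonal copies of the GNS space, and conjugation by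
twice the projection onto the diagonal copy turns them into multiples of `L (ρ + ρ')` and
`R (ρ + ρ')`; the claim is the transformer inequality for this conjugation. -/
theorem IsSymbol.superadditive (hΛ : IsOperatorConnection Λ) (hm : IsSymbol m Λ)
    (hw : IsWeight m) (hH : ¬ FiniteDimensional ℂ H)
    {T : Mat n → GNS n →L[ℂ] GNS n} (hT : IsSchur m T) {ρ ρ' : Mat n} (hρ : ρ.PosSemidef)
    (hρ' : ρ'.PosSemidef) (X : GNS n) :
    (⟪T ρ X, X⟫_ℂ).re + (⟪T ρ' X, X⟫_ℂ).re ≤ (⟪T (ρ + ρ') X, X⟫_ℂ).re := by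
  obtain ⟨ι, κ, hικ⟩ := exists_orthogonal_linearIsometry hH n
  have hκι : ∀ X Y, ⟪κ X, ι Y⟫_ℂ = 0 := fun X Y => by
    rw [← inner_conj_symm, hικ, map_zero]
  have hs := hρ.add hρ'
  set d : GNS n →L[ℂ] H := ι.toContinuousLinearMap + κ.toContinuousLinearMap with hd
  have hdX : ∀ X, d X = ι X + κ X := fun X => rfl
  have hdι : ∀ X, adjoint d (ι X) = X := fun X => by
    rw [hd, map_add, add_apply, adjoint_apply_isometry, adjoint_apply_orthogonal hικ, add_zero]
  have hdκ : ∀ X, adjoint d (κ X) = X := fun X => by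
    rw [hd, map_add, add_apply, adjoint_apply_isometry, adjoint_apply_orthogonal hκι, zero_add]
  have hdd : ∀ X, adjoint d (d X) = (2 : ℂ) • X := fun X => by
    rw [hdX, map_add, hdι, hdκ, two_smul]
  clear_value d
  -- `C` is twice the projection onto the diagonal
  set C : H →L[ℂ] H := d ∘L adjoint d with hC
  have hC0 : 0 ≤ C :=
    (ContinuousLinearMap.nonneg_iff_isPositive _).2
      (ContinuousLinearMap.isPositive_self_comp_adjoint d)
  set A := extendOp ι (Lop ρ) + extendOp κ (Lop ρ') with hA
  set B := extendOp ι (Rop ρ) + extendOp κ (Rop ρ') with hB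
  have hA0 : 0 ≤ A := add_nonneg (conj_adjoint_nonneg _ (Lop_nonneg hρ))
    (conj_adjoint_nonneg _ (Lop_nonneg hρ'))
  have hB0 : 0 ≤ B := add_nonneg (conj_adjoint_nonneg _ (Rop_nonneg hρ))
    (conj_adjoint_nonneg _ (Rop_nonneg hρ'))
  have hext : ∀ (S S' : GNS n →L[ℂ] GNS n) (X : GNS n),
      (extendOp ι S + extendOp κ S') (ι X) = ι (S X) ∧
      (extendOp ι S + extendOp κ S') (κ X) = κ (S' X) := by
    intro S S' X
    constructor
    · rw [add_apply, extendOp_apply]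
      simp [extendOp, adjoint_apply_orthogonal hικ]
    · rw [add_apply, extendOp_apply]
      simp [extendOp, adjoint_apply_orthogonal hκι]
  -- `Λ A B` acts as `T ρ ⊕ T ρ'`
  have hΛι : ∀ X, Λ A B (ι X) = ι (T ρ X) := by
    have : Λ A B ∘L ι.toContinuousLinearMap = ι.toContinuousLinearMap ∘L T ρ := by
      refine clm_ext_eig hρ.1 fun p => ?_
      rw [ContinuousLinearMap.comp_apply, ContinuousLinearMap.comp_apply, hT.apply_eig hρ, map_smul]
      refine hm A B hA0 hB0 _ _ _ ((map_ne_zero_iff ι ι.injective).2 (eig_ne_zero hρ.1 p)) ?_ ?_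
      · exact ((hext _ _ _).1).trans (by rw [Lop_eig, map_smul]; rfl)
      · exact ((hext _ _ _).1).trans (by rw [Rop_eig, map_smul]; rfl)
    exact fun X => congrArg (fun f : GNS n →L[ℂ] H => f X) this
  have hΛκ : ∀ X, Λ A B (κ X) = κ (T ρ' X) := by
    have : Λ A B ∘L κ.toContinuousLinearMap = κ.toContinuousLinearMap ∘L T ρ' := by
      refine clm_ext_eig hρ'.1 fun p => ?_
      rw [ContinuousLinearMap.comp_apply, ContinuousLinearMap.comp_apply, hT.apply_eig hρ',
        map_smul]
      refine hm A B hA0 hB0 _ _ _ ((map_ne_zero_iff κ κ.injective).2 (eig_ne_zero hρ'.1 p)) ?_ ?_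
      · exact ((hext _ _ _).2).trans (by rw [Lop_eig, map_smul]; rfl)
      · exact ((hext _ _ _).2).trans (by rw [Rop_eig, map_smul]; rfl)
    exact fun X => congrArg (fun f : GNS n →L[ℂ] H => f X) this
  have hcomp : ∀ S S' : GNS n →L[ℂ] GNS n, C ∘L (extendOp ι S + extendOp κ S') ∘L C
      = d ∘L (S + S') ∘L adjoint d := by
    intro S S'
    ext x
    simp only [hC, ContinuousLinearMap.comp_apply]
    rw [hdX (adjoint d x), map_add, (hext _ _ _).1, (hext _ _ _).2, map_add, hdι, hdκ]
    rfl
  have hLadd : Lop ρ + Lop ρ' = Lop (ρ + ρ') := by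
    ext X; apply mat_injective; simp [add_mul]
  have hRadd : Rop ρ + Rop ρ' = Rop (ρ + ρ') := by
    ext X; apply mat_injective; simp [mul_add]
  have htr := hΛ.transformer A B C hA0 hB0 hC0
  rw [hA, hB, hcomp, hcomp, hLadd, hRadd, ← hA, ← hB] at htr
  set A' := d ∘L Lop (ρ + ρ') ∘L adjoint d
  set B' := d ∘L Rop (ρ + ρ') ∘L adjoint d
  -- after the conjugation, the connection acts as `2 • T (ρ + ρ')` on the diagonal
  have hΛd : ∀ X, Λ A' B' (d X) = (2 : ℂ) • d (T (ρ + ρ') X) := by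
    have hd0 : ∀ X, d X = 0 → X = 0 := fun X h => by
      have := hdd X
      rw [h, map_zero] at this
      simpa using this.symm
    have : Λ A' B' ∘L d = (2 : ℂ) • d ∘L T (ρ + ρ') := by
      refine clm_ext_eig hs.1 fun p => ?_
      have h2 := hm A' B' (conj_adjoint_nonneg _ (Lop_nonneg hs))
        (conj_adjoint_nonneg _ (Rop_nonneg hs)) (d (eig hs.1 p)) (2 * hs.1.eigenvalues p.1)
        (2 * hs.1.eigenvalues p.2) (fun h => eig_ne_zero hs.1 p (hd0 _ h))
        (by
          simp only [A', ContinuousLinearMap.comp_apply, hdd, map_smul, Lop_eig, smul_smul]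
          push_cast; rfl)
        (by
          simp only [B', ContinuousLinearMap.comp_apply, hdd, map_smul, Rop_eig, smul_smul]
          push_cast; rfl)
      rw [ContinuousLinearMap.comp_apply, h2, smul_apply, ContinuousLinearMap.comp_apply,
        hT.apply_eig hs, map_smul, smul_smul, hw.homog 2 _ _ two_pos (hs.eigenvalues_nonneg _)
        (hs.eigenvalues_nonneg _)]
      push_cast; rfl
    exact fun X => congrArg (fun f : GNS n →L[ℂ] H => f X) this
  have hfin := re_inner_le_of_le htr (d X)
  have e1 : ⟪(C ∘L Λ A B ∘L C) (d X), d X⟫_ℂ = 4 * (⟪T ρ X, X⟫_ℂ + ⟪T ρ' X, X⟫_ℂ) := by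
    simp only [hC, ContinuousLinearMap.comp_apply, hdd, map_smul]
    have h1 : adjoint d (Λ A B (d X)) = T ρ X + T ρ' X := by
      rw [hdX, map_add, hΛι, hΛκ, map_add, hdι, hdκ]
    rw [h1, inner_smul_left, ← ContinuousLinearMap.adjoint_inner_right d, hdd, inner_smul_right,
      inner_add_left]
    simp only [map_ofNat]
    ring
  have e2 : ⟪Λ A' B' (d X), d X⟫_ℂ = 4 * ⟪T (ρ + ρ') X, X⟫_ℂ := by
    rw [hΛd, inner_smul_left, ← ContinuousLinearMap.adjoint_inner_right d, hdd, inner_smul_right]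
    simp only [map_ofNat]
    ring
  rw [e1, e2] at hfin
  have h4 : ∀ z : ℂ, (4 * z).re = 4 * z.re := fun z => by simp
  rw [h4, h4, Complex.add_re] at hfin
  linarith

end ConnBracket

open QTransport

/-! ### Lieb concavity for superadditive symbols -/

section Superadditive

variable {n : ℕ} {ρ : Mat n}

/-- The quadratic form (up to a factor `n`) of the operator with symbol `m` which acts on the matrix
units with respect to an eigenvector basis of `ρ`. -/
noncomputable def specForm (m : ℝ → ℝ → ℝ) (hρ : ρ.IsHermitian) (X : GNS n) : ℝ :=
  ∑ p : Fin n × Fin n, m (hρ.eigenvalues p.1) (hρ.eigenvalues p.2) * ‖coef hρ p X‖ ^ 2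

theorem IsSchur.re_inner_eq_specForm {m : ℝ → ℝ → ℝ} {T : Mat n → GNS n →L[ℂ] GNS n}
    (h : IsSchur m T) (hρ : ρ.PosSemidef) (X : GNS n) :
    (⟪T ρ X, X⟫_ℂ).re = specForm m hρ.1 X / n :=
  h.re_inner hρ X

/-- The quadratic forms with symbol `m` are superadditive functions of positive definite
matrices. -/
def IsSuperadd (n : ℕ) (m : ℝ → ℝ → ℝ) : Prop :=
  ∀ (ρ ρ' : Mat n) (hρ : ρ.PosDef) (hρ' : ρ'.PosDef) (X : GNS n),
    specForm m hρ.1 X + specForm m hρ'.1 X ≤ specForm m (hρ.add hρ').1 X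

theorem IsSuperadd.congr {m m' : ℝ → ℝ → ℝ} (h : IsSuperadd n m)
    (hmm : ∀ x y, 0 < x → 0 < y → m' x y = m x y) : IsSuperadd n m' := by
  intro ρ ρ' hρ hρ' X
  have hf : ∀ {ρ : Mat n} (hρ : ρ.PosDef), specForm m' hρ.1 X = specForm m hρ.1 X := fun hρ =>
    Finset.sum_congr rfl fun p _ => by rw [hmm _ _ (hρ.eigenvalues_pos _) (hρ.eigenvalues_pos _)]
  rw [hf hρ, hf hρ', hf (hρ.add hρ')]
  exact h ρ ρ' hρ hρ' X

theorem IsSuperadd.const_mul {m : ℝ → ℝ → ℝ} (h : IsSuperadd n m) {c : ℝ} (hc : 0 ≤ c) :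
    IsSuperadd n fun x y => c * m x y := by
  intro ρ ρ' hρ hρ' X
  have hf : ∀ {ρ : Mat n} (hρ : ρ.PosDef),
      specForm (fun x y => c * m x y) hρ.1 X = c * specForm m hρ.1 X := fun hρ => by
    simp only [specForm, Finset.mul_sum, mul_assoc]
  rw [hf hρ, hf hρ', hf (hρ.add hρ'), ← mul_add]
  exact mul_le_mul_of_nonneg_left (h ρ ρ' hρ hρ' X) hc

theorem IsSuperadd.integral {α : Type*} [MeasurableSpace α] {ν : Measure α}
    {f : α → ℝ → ℝ → ℝ} (hf : ∀ᵐ t ∂ν, IsSuperadd n (f t))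
    (hint : ∀ x y, 0 < x → 0 < y → Integrable (fun t => f t x y) ν) :
    IsSuperadd n fun x y => ∫ t, f t x y ∂ν := by
  intro ρ ρ' hρ hρ' X
  have hi : ∀ {ρ : Mat n} (hρ : ρ.PosDef), Integrable (fun t => specForm (f t) hρ.1 X) ν :=
    fun hρ => integrable_finsetSum _ fun p _ =>
      (hint _ _ (hρ.eigenvalues_pos _) (hρ.eigenvalues_pos _)).mul_const _
  have he : ∀ {ρ : Mat n} (hρ : ρ.PosDef),
      specForm (fun x y => ∫ t, f t x y ∂ν) hρ.1 X = ∫ t, specForm (f t) hρ.1 X ∂ν := fun hρ => by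
    simp only [specForm]
    rw [integral_finsetSum _ fun p _ =>
      (hint _ _ (hρ.eigenvalues_pos _) (hρ.eigenvalues_pos _)).mul_const _]
    exact Finset.sum_congr rfl fun p _ => (integral_mul_const _ _).symm
  rw [he hρ, he hρ', he (hρ.add hρ'), ← integral_add (hi hρ) (hi hρ')]
  refine integral_mono_ae ((hi hρ).add (hi hρ')) (hi (hρ.add hρ')) ?_
  filter_upwards [hf] with t ht
  exact ht ρ ρ' hρ hρ' X

theorem specForm_fst (hρ : ρ.PosSemidef) (X : GNS n) :
    specForm (fun x _ => x) hρ.1 X / n = (⟪Lop ρ X, X⟫_ℂ).re :=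
  (IsSchur.re_inner_eq_specForm (m := fun x _ => x) (T := Lop)
    (fun _ _ _ _ _ _ hx _ => hx) hρ X).symm

theorem specForm_snd (hρ : ρ.PosSemidef) (X : GNS n) :
    specForm (fun _ y => y) hρ.1 X / n = (⟪Rop ρ X, X⟫_ℂ).re :=
  (IsSchur.re_inner_eq_specForm (m := fun _ y => y) (T := Rop)
    (fun _ _ _ _ _ _ _ hy => hy) hρ X).symm

/-- The scalar parallel sum as a lower bound: completing the square in `w`. Equality holds for
`w = t y / (x + t y) z`. -/
theorem parallel_le {x y t : ℝ} (hx : 0 < x) (hy : 0 < y) (ht : 0 < t) (z w : ℂ) :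
    x * y / (x + t * y) * ‖z‖ ^ 2 ≤ t⁻¹ * (x * ‖w‖ ^ 2) + y * ‖z - w‖ ^ 2 := by
  have h1 : ‖z‖ ≤ ‖w‖ + ‖z - w‖ := by
    calc ‖z‖ = ‖w + (z - w)‖ := by rw [add_sub_cancel]
      _ ≤ _ := norm_add_le _ _
  have h2 : ‖z‖ ^ 2 ≤ (‖w‖ + ‖z - w‖) ^ 2 := pow_le_pow_left₀ (norm_nonneg _) h1 2
  set a := ‖w‖
  set b := ‖z - w‖
  have hpos : 0 < x + t * y := by positivity
  have hne : t ≠ 0 := ht.ne'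
  refine (mul_le_mul_of_nonneg_left h2 (by positivity)).trans ?_
  rw [div_mul_eq_mul_div, div_le_iff₀ hpos, ← sub_nonneg]
  have : (t⁻¹ * (x * a ^ 2) + y * b ^ 2) * (x + t * y) - x * y * (a + b) ^ 2
      = t⁻¹ * (x * a - t * y * b) ^ 2 := by
    field_simp
    ring
  rw [this]
  positivity

theorem parallel_eq {x y t : ℝ} (hx : 0 < x) (hy : 0 < y) (ht : 0 < t) (z : ℂ) :
    t⁻¹ * (x * ‖((t * y / (x + t * y) : ℝ) : ℂ) * z‖ ^ 2)
      + y * ‖z - ((t * y / (x + t * y) : ℝ) : ℂ) * z‖ ^ 2 = x * y / (x + t * y) * ‖z‖ ^ 2 := by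
  have hpos : 0 < x + t * y := by positivity
  have hne : t ≠ 0 := ht.ne'
  have h1 : z - ((t * y / (x + t * y) : ℝ) : ℂ) * z = ((x / (x + t * y) : ℝ) : ℂ) * z := by
    have : x / (x + t * y) = 1 - t * y / (x + t * y) := by field_simp; ring
    rw [this]
    push_cast
    ring
  rw [h1, norm_mul, norm_mul, Complex.norm_real, Complex.norm_real, mul_pow, mul_pow,
    Real.norm_eq_abs, Real.norm_eq_abs, sq_abs, sq_abs]
  field_simp
  ring

/-- The parallel sum is superadditive: its quadratic form at `X` is the minimum over `Y` of
`t⁻¹ ⟪ρ Y, Y⟫ + ⟪(X - Y) ρ, X - Y⟫`, which is linear in `ρ`. -/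
theorem isSuperadd_parallel {t : ℝ} (ht : 0 < t) :
    IsSuperadd n fun x y => x * y / (x + t * y) := by
  intro ρ ρ' hρ hρ' X
  have hs := hρ.add hρ'
  rcases Nat.eq_zero_or_pos n with hn | hn
  · subst hn
    simp [specForm]
  have hn' : (n : ℝ) ≠ 0 := by exact_mod_cast hn.ne'
  set G : Mat n → GNS n → ℝ := fun ρ Y =>
    t⁻¹ * (n * (⟪Lop ρ Y, Y⟫_ℂ).re) + n * (⟪Rop ρ (X - Y), X - Y⟫_ℂ).re with hG
  have hGs : ∀ {ρ : Mat n} (hρ : ρ.PosDef) (Y : GNS n), G ρ Y = ∑ p : Fin n × Fin n,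
      (t⁻¹ * (hρ.1.eigenvalues p.1 * ‖coef hρ.1 p Y‖ ^ 2)
        + hρ.1.eigenvalues p.2 * ‖coef hρ.1 p X - coef hρ.1 p Y‖ ^ 2) := by
    intro ρ hρ Y
    simp only [hG]
    rw [← specForm_fst hρ.posSemidef, ← specForm_snd hρ.posSemidef, mul_div_cancel₀ _ hn',
      mul_div_cancel₀ _ hn', Finset.sum_add_distrib, specForm, specForm, Finset.mul_sum]
    simp only [map_sub]
  have hle : ∀ {ρ : Mat n} (hρ : ρ.PosDef) (Y : GNS n),
      specForm (fun x y => x * y / (x + t * y)) hρ.1 X ≤ G ρ Y := by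
    intro ρ hρ Y
    rw [hGs hρ]
    exact Finset.sum_le_sum fun p _ =>
      parallel_le (hρ.eigenvalues_pos _) (hρ.eigenvalues_pos _) ht _ _
  -- the minimizer for the sum
  set Y : GNS n := ∑ p, (((t * hs.1.eigenvalues p.2 /
    (hs.1.eigenvalues p.1 + t * hs.1.eigenvalues p.2) : ℝ) : ℂ) * coef hs.1 p X) • eig hs.1 p
    with hY
  have hYc : ∀ p, coef hs.1 p Y = ((t * hs.1.eigenvalues p.2 /
      (hs.1.eigenvalues p.1 + t * hs.1.eigenvalues p.2) : ℝ) : ℂ) * coef hs.1 p X := by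
    intro p
    rw [hY, map_sum]
    simp only [map_smul, coef_eig, smul_eq_mul, mul_ite, mul_one, mul_zero, Finset.sum_ite_eq',
      Finset.mem_univ, if_true]
  have heq : G (ρ + ρ') Y = specForm (fun x y => x * y / (x + t * y)) hs.1 X := by
    rw [hGs hs]
    refine Finset.sum_congr rfl fun p _ => ?_
    rw [hYc]
    exact parallel_eq (hs.eigenvalues_pos _) (hs.eigenvalues_pos _) ht _
  have hadd : G (ρ + ρ') Y = G ρ Y + G ρ' Y := by
    have hL : Lop (ρ + ρ') Y = Lop ρ Y + Lop ρ' Y := by apply mat_injective; simp [add_mul]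
    have hR : Rop (ρ + ρ') (X - Y) = Rop ρ (X - Y) + Rop ρ' (X - Y) := by
      apply mat_injective; simp only [mat_Rop, mat_add, mul_add]
    simp only [hG]
    rw [hL, hR, inner_add_left, inner_add_left, Complex.add_re, Complex.add_re]
    ring
  rw [← heq, hadd]
  exact add_le_add (hle hρ Y) (hle hρ' Y)

/-- Lieb's concavity theorem, in superadditive form: `x ^ s * y ^ (1 - s)` is an integral of
parallel sums with positive weights. -/
theorem isSuperadd_rpow {s : ℝ} (hs : s ∈ Ioo (0 : ℝ) 1) :
    IsSuperadd n fun x y => x ^ s * y ^ (1 - s) := by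
  obtain ⟨μ, hμ⟩ := Real.exists_measure_rpow_eq_integral_rpowIntegrand₀₁ hs
  have hrep : ∀ t x y : ℝ, 0 < t → 0 < x → 0 < y →
      y * Real.rpowIntegrand₀₁ s t (x / y) = t ^ (s - 1) * (x * y / (x + t * y)) := by
    intro t x y ht hx hy
    rw [Real.rpowIntegrand₀₁_eq_pow_div hs ht.le (by positivity)]
    have : t + x / y ≠ 0 := by positivity
    have h2 : x + t * y ≠ 0 := by positivity
    field_simp
    ring
  have h := IsSuperadd.integral (n := n) (ν := μ.restrict (Ioi 0))
    (f := fun t x y => t ^ (s - 1) * (x * y / (x + t * y))) ?_ ?_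
  · refine h.congr fun x y hx hy => ?_
    have h1 := (hμ (x / y) (div_pos hx hy).le).2
    have h2 : x ^ s * y ^ (1 - s) = y * (x / y) ^ s := by
      rw [Real.div_rpow hx.le hy.le, Real.rpow_sub hy, Real.rpow_one]
      ring
    rw [h2, h1, ← integral_const_mul]
    refine setIntegral_congr_fun measurableSet_Ioi fun t ht => hrep t x y ht hx hy
  · filter_upwards [ae_restrict_mem measurableSet_Ioi] with t ht
    exact (isSuperadd_parallel ht).const_mul (Real.rpow_nonneg (le_of_lt ht) _)
  · intro x y hx hy
    refine (((hμ (x / y) (div_pos hx hy).le).1).const_mul y).congr ?_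
    filter_upwards [ae_restrict_mem measurableSet_Ioi] with t ht
    exact hrep t x y ht hx hy

end Superadditive

/-! ### The operators of Carlen and Maas -/

section ExpBracket

variable {n : ℕ} {ρ : Mat n}

theorem rpow_le_max {x s : ℝ} (hx : 0 ≤ x) (hs : s ∈ Icc (0 : ℝ) 1) : x ^ s ≤ max 1 x := by
  rcases le_total x 1 with h | h
  · exact (Real.rpow_le_one hx h hs.1).trans (le_max_left _ _)
  · refine le_trans ?_ (le_max_right _ _)
    simpa using Real.rpow_le_rpow_of_exponent_le h hs.2

theorem intervalIntegrable_expIntegrand (α : ℝ) {x y : ℝ} (hx : 0 ≤ x) (hy : 0 ≤ y) :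
    IntervalIntegrable (fun s : ℝ => Real.exp (α * (s - 1 / 2)) * (x ^ s * y ^ (1 - s)))
      volume 0 1 := by
  rw [intervalIntegrable_iff_integrableOn_Icc_of_le zero_le_one]
  refine Measure.integrableOn_of_bounded (M := Real.exp |α| * (max 1 x * max 1 y)) (by simp)
    (Measurable.aestronglyMeasurable (by fun_prop)) ?_
  filter_upwards [ae_restrict_mem measurableSet_Icc] with s hs
  rw [Real.norm_of_nonneg (by positivity)]
  have h1 : Real.exp (α * (s - 1 / 2)) ≤ Real.exp |α| := by
    refine Real.exp_le_exp.2 ((le_abs_self _).trans ?_)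
    rw [abs_mul]
    exact mul_le_of_le_one_right (abs_nonneg _) (abs_le.2 ⟨by linarith [hs.1], by linarith [hs.2]⟩)
  have h2 : y ^ (1 - s) ≤ max 1 y := rpow_le_max hy ⟨by linarith [hs.2], by linarith [hs.1]⟩
  exact mul_le_mul h1 (mul_le_mul (rpow_le_max hx hs) h2 (by positivity) (by positivity))
    (by positivity) (by positivity)

/-- The symbol of `expBracket α`. -/
noncomputable def expSymbol (α x y : ℝ) : ℝ :=
  ∫ s in (0 : ℝ)..1, Real.exp (α * (s - 1 / 2)) * (x ^ s * y ^ (1 - s))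

theorem isSchur_expBracket (α : ℝ) : IsSchur (expSymbol α) (expBracket (n := n) α) := by
  refine isSchur_of_eig fun ρ hρ p => ?_
  set l := hρ.1.eigenvalues
  -- the rank one operators onto the joint eigenvectors, which carry the integrand
  set E : Fin n × Fin n → GNS n →L[ℂ] GNS n := fun q =>
    LinearMap.toContinuousLinearMap ((coef hρ.1 q).smulRight (eig hρ.1 q)) with hE
  have hEq : ∀ q r, E q (eig hρ.1 r) = if r = q then eig hρ.1 q else 0 := fun q r => by
    simp only [hE, LinearMap.coe_toContinuousLinearMap', LinearMap.smulRight_apply, coef_eig]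
    split_ifs <;> simp
  have hF : ∀ s : ℝ, (Real.exp (α * (s - 1 / 2)) : ℂ) •
      (Lop (cfc (fun x : ℝ => x ^ s) ρ) ∘L Rop (cfc (fun x : ℝ => x ^ (1 - s)) ρ))
      = ∑ q, (Real.exp (α * (s - 1 / 2)) * (l q.1 ^ s * l q.2 ^ (1 - s))) • E q := by
    intro s
    refine clm_ext_eig hρ.1 fun r => ?_
    rw [smul_apply, ContinuousLinearMap.comp_apply, Rop_cfc_eig, map_smul, Lop_cfc_eig]
    simp only [sum_apply, smul_apply, hEq, smul_ite, smul_zero, Finset.sum_ite_eq,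
      Finset.mem_univ, if_true]
    rw [← Complex.coe_smul, smul_smul, smul_smul]
    push_cast
    congr 1
    ring
  have hint : expBracket α ρ = ∑ q, expSymbol α (l q.1) (l q.2) • E q := by
    unfold expBracket
    simp only [hF]
    have hi := fun q : Fin n × Fin n => intervalIntegrable_expIntegrand α
      (hρ.eigenvalues_nonneg q.1) (hρ.eigenvalues_nonneg q.2)
    rw [intervalIntegral.integral_finsetSum fun q _ =>
      ⟨(hi q).1.smul_const (E q), (hi q).2.smul_const (E q)⟩]
    refine Finset.sum_congr rfl fun q _ => ?_
    rw [intervalIntegral.integral_smul_const]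
    rfl
  rw [hint]
  simp only [sum_apply, smul_apply, hEq, smul_ite, smul_zero, Finset.sum_ite_eq,
    Finset.mem_univ, if_true, Complex.coe_smul]

theorem isWeight_expSymbol (α : ℝ) : IsWeight (expSymbol α) where
  nonneg x y hx hy := intervalIntegral.integral_nonneg zero_le_one fun s _ => by positivity
  mono x y x' y' hx hy hxx hyy := by
    refine intervalIntegral.integral_mono_on zero_le_one (intervalIntegrable_expIntegrand α hx hy)
      (intervalIntegrable_expIntegrand α (hx.trans hxx) (hy.trans hyy)) fun s hs => ?_
    have h1 : x ^ s ≤ x' ^ s := Real.rpow_le_rpow hx hxx hs.1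
    have h2 : y ^ (1 - s) ≤ y' ^ (1 - s) := Real.rpow_le_rpow hy hyy (by linarith [hs.2])
    have h3 : 0 ≤ x' := hx.trans hxx
    exact mul_le_mul_of_nonneg_left (mul_le_mul h1 h2 (by positivity) (by positivity))
      (by positivity)
  homog c x y hc hx hy := by
    unfold expSymbol
    rw [← intervalIntegral.integral_const_mul]
    refine intervalIntegral.integral_congr fun s _ => ?_
    have h1 : c ^ s * c ^ (1 - s) = c := by rw [← Real.rpow_add hc]; simp
    rw [Real.mul_rpow hc.le hx, Real.mul_rpow hc.le hy]
    calc _ = c ^ s * c ^ (1 - s) * (Real.exp (α * (s - 1 / 2)) * (x ^ s * y ^ (1 - s))) := by ring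
      _ = _ := by rw [h1]
  pos x y hx hy := intervalIntegral.intervalIntegral_pos_of_pos_on
    (intervalIntegrable_expIntegrand α hx.le hy.le) (fun s _ => by positivity) zero_lt_one

theorem expSymbol_neg (α x y : ℝ) : expSymbol (-α) x y = expSymbol α y x := by
  unfold expSymbol
  have := intervalIntegral.integral_comp_sub_left (a := 0) (b := 1)
    (fun s : ℝ => Real.exp (α * (s - 1 / 2)) * (y ^ s * x ^ (1 - s))) 1
  rw [sub_self, sub_zero] at this
  rw [← this]
  refine intervalIntegral.integral_congr fun s _ => ?_
  have h1 : -α * (s - 1 / 2) = α * (1 - s - 1 / 2) := by ring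
  simp only [sub_sub_cancel]
  rw [h1, mul_comm (x ^ s)]

theorem isSuperadd_expSymbol (α : ℝ) : IsSuperadd n (expSymbol α) := by
  have h := IsSuperadd.integral (n := n) (ν := volume.restrict (Ioo (0 : ℝ) 1))
    (f := fun s x y => Real.exp (α * (s - 1 / 2)) * (x ^ s * y ^ (1 - s))) ?_ ?_
  · refine h.congr fun x y _ _ => ?_
    rw [expSymbol, intervalIntegral.integral_of_le zero_le_one, integral_Ioc_eq_integral_Ioo]
  · filter_upwards [ae_restrict_mem measurableSet_Ioo] with s hs
    exact (isSuperadd_rpow hs).const_mul (Real.exp_nonneg _)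
  · intro x y hx hy
    have := intervalIntegrable_expIntegrand α hx.le hy.le
    rw [intervalIntegrable_iff_integrableOn_Ioo_of_le zero_le_one] at this
    exact this

end ExpBracket

open QTransport

/-! ### Symmetries of gradient and generator -/

section Symmetry

variable {n : ℕ} {𝒜 : StarSubalgebra ℂ (Mat n)} {J : Type*} [Fintype J]

theorem mat_mem (A : HA 𝒜) : mat (A : GNS n) ∈ 𝒜 := by
  obtain ⟨X, hX, h⟩ := A.2
  rw [← h]
  exact hX

/-- An element of the algebra, as a vector of its GNS space. -/
def vecOfMem {X : Mat n} (hX : X ∈ 𝒜) : HA 𝒜 := ⟨toGNS X, X, hX, rfl⟩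

@[simp] theorem mat_vecOfMem {X : Mat n} (hX : X ∈ 𝒜) : mat (vecOfMem hX : GNS n) = X := rfl

theorem vec_ext {A B : HA 𝒜} (h : mat (A : GNS n) = mat (B : GNS n)) : A = B :=
  Subtype.ext (mat_injective h)

/-- The adjoint of an element of the algebra, as a vector of the GNS space. -/
def vecStar (A : HA 𝒜) : HA 𝒜 := vecOfMem (star_mem (mat_mem A))

@[simp] theorem mat_vecStar (A : HA 𝒜) : mat (vecStar A : GNS n) = (mat (A : GNS n))ᴴ := rfl

theorem vecStar_eq_iff {A : HA 𝒜} : vecStar A = A ↔ (mat (A : GNS n)).IsHermitian :=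
  ⟨fun h => congrArg (fun B : HA 𝒜 => mat (B : GNS n)) h, fun h => vec_ext h⟩

theorem vecStar_vecStar (A : HA 𝒜) : vecStar (vecStar A) = A := vec_ext (by simp)

theorem tau_mul_comm (X Y : Mat n) : tau (X * Y) = tau (Y * X) := by
  rw [tau, tau, Matrix.trace_mul_comm]

theorem tau_conjTranspose (X : Mat n) : tau Xᴴ = (starRingEnd ℂ) (tau X) := by
  simp [tau, Matrix.trace_conjTranspose]

theorem inner_conjTranspose (X Y : GNS n) :
    ⟪toGNS (mat X)ᴴ, toGNS (mat Y)ᴴ⟫_ℂ = (starRingEnd ℂ) ⟪X, Y⟫_ℂ := by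
  rw [gns_inner, gns_inner, ← tau_conjTranspose, mat_toGNS, mat_toGNS, tau_mul_comm]
  simp

theorem inner_vecStar (A B : HA 𝒜) : ⟪vecStar A, vecStar B⟫_ℂ = (starRingEnd ℂ) ⟪A, B⟫_ℂ :=
  inner_conjTranspose (A : GNS n) (B : GNS n)

theorem nabla_apply (V : J → Mat n) (A : HA 𝒜) (j : J) :
    mat (nabla 𝒜 V A j) = V j * mat (A : GNS n) - mat (A : GNS n) * V j := rfl

/-- The involution of vector fields (for a permutation `s` of the index set) which intertwines the
gradients of an element of the algebra and of its adjoint. -/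
def fieldStar (s : Equiv.Perm J) (W : Field n J) : Field n J :=
  WithLp.toLp 2 fun j => -toGNS (mat (W (s j)))ᴴ

theorem inner_fieldStar (s : Equiv.Perm J) (W W' : Field n J) :
    ⟪fieldStar s W, fieldStar s W'⟫_ℂ = (starRingEnd ℂ) ⟪W, W'⟫_ℂ := by
  rw [PiLp.inner_apply, PiLp.inner_apply, map_sum,
    ← Equiv.sum_comp s fun j => (starRingEnd ℂ) ⟪W j, W' j⟫_ℂ]
  refine Finset.sum_congr rfl fun j _ => ?_
  rw [fieldStar, fieldStar, inner_neg_neg, inner_conjTranspose]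

/-- The properties of the gradient and of the generator on which the duality formula rests. The
permutation `s` sends an index `j` to the index of the adjoint of `V j`. -/
structure IsSymmetricFlow (V : J → Mat n) (ℒ : HA 𝒜 →ₗ[ℂ] HA 𝒜) (s : Equiv.Perm J) : Prop where
  pos : 0 < n
  adj : ∀ j, V (s j) = (V j)ᴴ
  map_one : ∀ A : HA 𝒜, mat (A : GNS n) = 1 → ℒ A = 0
  map_star : ∀ A, ℒ (vecStar A) = vecStar (ℒ A)
  ker : ∀ A, nabla 𝒜 V A = 0 → ∃ c : ℂ, mat (A : GNS n) = c • 1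

variable {V : J → Mat n} {ℒ : HA 𝒜 →ₗ[ℂ] HA 𝒜} {s : Equiv.Perm J}

theorem IsSymmetricFlow.nabla_vecStar (h : IsSymmetricFlow V ℒ s) (A : HA 𝒜) :
    nabla 𝒜 V (vecStar A) = fieldStar s (nabla 𝒜 V A) := by
  ext j : 1
  apply mat_injective
  rw [nabla_apply, mat_vecStar, fieldStar, mat_neg, mat_toGNS, nabla_apply, h.adj]
  simp [Matrix.conjTranspose_sub, Matrix.conjTranspose_mul]

theorem IsSymmetricFlow.adjoint_map_star (h : IsSymmetricFlow V ℒ s) (A : HA 𝒜) :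
    LinearMap.adjoint ℒ (vecStar A) = vecStar (LinearMap.adjoint ℒ A) := by
  refine ext_inner_right ℂ fun B => ?_
  rw [LinearMap.adjoint_inner_left, ← vecStar_vecStar B, h.map_star, inner_vecStar, inner_vecStar,
    LinearMap.adjoint_inner_left]

theorem IsSymmetricFlow.adjoint_nabla_fieldStar (h : IsSymmetricFlow V ℒ s) (W : Field n J) :
    LinearMap.adjoint (nabla 𝒜 V) (fieldStar s W) = vecStar (LinearMap.adjoint (nabla 𝒜 V) W) := by
  refine ext_inner_right ℂ fun B => ?_
  rw [LinearMap.adjoint_inner_left, ← vecStar_vecStar B, h.nabla_vecStar, inner_fieldStar,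
    inner_vecStar, LinearMap.adjoint_inner_left]

/-- The properties of the operators `B j ρ` on which the duality formula rests: they have a
homogeneous and monotone symbol and are superadditive in `ρ`, and taking adjoints exchanges the
roles of left and right multiplication. -/
structure IsKernelFamily (s : Equiv.Perm J) (m : J → ℝ → ℝ → ℝ)
    (B : J → Mat n → GNS n →L[ℂ] GNS n) : Prop where
  schur : ∀ j, IsSchur (m j) (B j)
  weight : ∀ j, IsWeight (m j)
  symm : ∀ j x y, 0 ≤ x → 0 ≤ y → m (s j) x y = m j y x
  superadd : ∀ j (ρ ρ' : Mat n), ρ.PosDef → ρ'.PosDef → ∀ X,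
    (⟪B j ρ X, X⟫_ℂ).re + (⟪B j ρ' X, X⟫_ℂ).re ≤ (⟪B j (ρ + ρ') X, X⟫_ℂ).re

variable {m : J → ℝ → ℝ → ℝ} {B : J → Mat n → GNS n →L[ℂ] GNS n} {ρ : Mat n}

theorem bracket_apply (ρ : Mat n) (W : Field n J) (j : J) : bracket B ρ W j = B j ρ (W j) := rfl

theorem IsKernelFamily.bracket_fieldStar (h : IsKernelFamily s m B) (hρ : ρ.PosSemidef)
    (W : Field n J) : bracket B ρ (fieldStar s W) = fieldStar s (bracket B ρ W) := by
  ext j : 1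
  rw [bracket_apply, fieldStar, fieldStar, map_neg]
  congr 1
  apply mat_injective
  rw [mat_toGNS, bracket_apply]
  exact (h.schur (s j)).conjTranspose (h.schur j)
    (fun x y hx hy => (h.symm j y x hy hx).symm) hρ (W (s j))

theorem inner_bracket (ρ : Mat n) (W W' : Field n J) :
    ⟪bracket B ρ W, W'⟫_ℂ = ∑ j, ⟪B j ρ (W j), W' j⟫_ℂ := by
  rw [PiLp.inner_apply]
  rfl

theorem IsKernelFamily.inner_symm (h : IsKernelFamily s m B) (hρ : ρ.PosSemidef)
    (W W' : Field n J) : ⟪bracket B ρ W, W'⟫_ℂ = ⟪W, bracket B ρ W'⟫_ℂ := by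
  rw [inner_bracket, PiLp.inner_apply]
  exact Finset.sum_congr rfl fun j _ => (h.schur j).inner_symm hρ _ _

theorem re_inner_bracket (ρ : Mat n) (W : Field n J) :
    (⟪bracket B ρ W, W⟫_ℂ).re = ∑ j, (⟪B j ρ (W j), W j⟫_ℂ).re := by
  rw [inner_bracket, Complex.re_sum]

theorem IsKernelFamily.re_inner_nonneg (h : IsKernelFamily s m B) (hρ : ρ.PosSemidef)
    (W : Field n J) : 0 ≤ (⟪bracket B ρ W, W⟫_ℂ).re := by
  rw [re_inner_bracket]
  exact Finset.sum_nonneg fun j _ => (h.schur j).re_inner_nonneg (h.weight j) hρ _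

theorem IsKernelFamily.re_inner_pos (h : IsKernelFamily s m B) (hρ : ρ.PosDef) {W : Field n J}
    (hW : W ≠ 0) : 0 < (⟪bracket B ρ W, W⟫_ℂ).re := by
  have hne : ∃ j, W j ≠ 0 := by
    by_contra! hall
    exact hW (by ext j : 1; exact hall j)
  obtain ⟨j, hj⟩ := hne
  rw [re_inner_bracket]
  exact Finset.sum_pos' (fun j _ => (h.schur j).re_inner_nonneg (h.weight j) hρ.posSemidef _)
    ⟨j, Finset.mem_univ _, (h.schur j).re_inner_pos (h.weight j) hρ hj⟩

/-- The operator `bracket B ρ` as a continuous linear map. -/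
noncomputable def bracketCLM (B : J → Mat n → GNS n →L[ℂ] GNS n) (ρ : Mat n) :
    Field n J →L[ℂ] Field n J :=
  LinearMap.toContinuousLinearMap
    { toFun := bracket B ρ
      map_add' := fun W W' => by ext j : 1; simp [bracket]
      map_smul' := fun c W => by ext j : 1; simp [bracket] }

end Symmetry

/-! ### Topology of the set of density matrices -/

section Density

variable {n : ℕ} {𝒜 : StarSubalgebra ℂ (Mat n)} {ρ : Mat n}

theorem continuous_mat : Continuous (mat : GNS n → Mat n) :=
  LinearMap.continuous_of_finiteDimensional ((toGNS (n := n)).symm : GNS n →ₗ[ℂ] Mat n)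

theorem isClosed_setOf_posSemidef : IsClosed {X : Mat n | X.PosSemidef} := by
  have : {X : Mat n | X.PosSemidef} = {X | X.IsHermitian} ∩
      ⋂ x : Fin n → ℂ, {X | 0 ≤ star x ⬝ᵥ (X *ᵥ x)} := by
    ext X
    rw [mem_inter_iff, mem_iInter]
    exact Matrix.posSemidef_iff_dotProduct_mulVec
  rw [this]
  refine (isClosed_eq continuous_id.matrix_conjTranspose continuous_id).inter
    (isClosed_iInter fun x => ?_)
  exact isClosed_Ici.preimage (f := fun X : Mat n => star x ⬝ᵥ (X *ᵥ x)) (by fun_prop)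

/-- Positive definiteness is an open condition among Hermitian matrices, by compactness of the unit
sphere. -/
theorem isOpen_setOf_posDef_of_isHermitian {Y : Type*} [TopologicalSpace Y] {f : Y → Mat n}
    (hf : Continuous f) (hherm : ∀ y, (f y).IsHermitian) : IsOpen {y | (f y).PosDef} := by
  rw [isOpen_iff_mem_nhds]
  intro y hy
  have hy' : (f y).PosDef := hy
  have hK : IsCompact (Metric.sphere (0 : Fin n → ℂ) 1) := isCompact_sphere 0 1
  have hcont : Continuous fun q : Y × (Fin n → ℂ) => (star q.2 ⬝ᵥ (f q.1 *ᵥ q.2)).re := by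
    have : Continuous fun q : Y × (Fin n → ℂ) => f q.1 := hf.comp continuous_fst
    fun_prop
  have hpos : ∀ x : Fin n → ℂ, x ≠ 0 → 0 < (star x ⬝ᵥ (f y *ᵥ x)).re := fun x hx =>
    (Complex.lt_def.1 ((Matrix.posDef_iff_dotProduct_mulVec.1 hy').2 hx)).1
  have hev := hK.eventually_forall_of_forall_eventually (x₀ := y)
    (P := fun y x => 0 < (star x ⬝ᵥ (f y *ᵥ x)).re) fun x hx => by
      have hx0 : x ≠ 0 := fun h => by simp [h] at hx
      exact hcont.continuousAt.eventually (lt_mem_nhds (hpos x hx0))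
  filter_upwards [hev] with z hz
  refine Matrix.posDef_iff_dotProduct_mulVec.2 ⟨hherm z, fun x hx => ?_⟩
  have him : (star x ⬝ᵥ (f z *ᵥ x)).im = 0 := (hherm z).im_star_dotProduct_mulVec_self x
  refine Complex.lt_def.2 ⟨?_, him.symm⟩
  have hn : 0 < ‖x‖ := norm_pos_iff.2 hx
  have h1 := hz (((‖x‖⁻¹ : ℝ) : ℂ) • x) (by
    rw [mem_sphere_zero_iff_norm, norm_smul, Complex.norm_real, norm_inv, norm_norm,
      inv_mul_cancel₀ hn.ne'])
  have h2 : star (((‖x‖⁻¹ : ℝ) : ℂ) • x) ⬝ᵥ (f z *ᵥ (((‖x‖⁻¹ : ℝ) : ℂ) • x))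
      = ((‖x‖⁻¹ * ‖x‖⁻¹ : ℝ) : ℂ) * (star x ⬝ᵥ (f z *ᵥ x)) := by
    rw [Matrix.mulVec_smul, star_smul, smul_dotProduct, dotProduct_smul, smul_smul,
      Complex.star_def, Complex.conj_ofReal, ← Complex.ofReal_mul, smul_eq_mul]
  rw [h2, Complex.re_ofReal_mul] at h1
  exact pos_of_mul_pos_right h1 (by positivity)

/-- Density matrices are bounded: the square of the norm is the normalized sum of the squares of the
eigenvalues. -/
theorem norm_sq_le_of_posSemidef (hρ : ρ.PosSemidef) :
    ‖toGNS ρ‖ ^ 2 ≤ n * (tau ρ).re ^ 2 := by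
  rcases Nat.eq_zero_or_pos n with hn | hn
  · subst hn
    have : toGNS ρ = 0 := Subsingleton.elim (α := Mat 0) _ _
    simp [this]
  have hn' : (0 : ℝ) < n := by exact_mod_cast hn
  set l := hρ.1.eigenvalues
  have hc : ∀ p, coef hρ.1 p (toGNS ρ) = if p.1 = p.2 then (l p.1 : ℂ) else 0 := by
    intro p
    have h1 : toGNS ρ = Lop ρ (toGNS 1) := by apply mat_injective; simp
    have h2 : coef hρ.1 p (toGNS 1) = if p.1 = p.2 then 1 else 0 := by
      simp only [coef, LinearMap.coe_mk, AddHom.coe_mk, mat_toGNS, mul_one]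
      rw [unitary_conjTranspose_mul, Matrix.one_apply]
    rw [h1, coef_Lop, h2]
    split_ifs <;> simp [l]
  have hnorm : ‖toGNS ρ‖ ^ 2 = (∑ i, l i ^ 2) / n := by
    have h1 : ((‖toGNS ρ‖ ^ 2 : ℝ) : ℂ) = ⟪toGNS ρ, toGNS ρ⟫_ℂ := by
      rw [inner_self_eq_norm_sq_to_K]; push_cast; rfl
    have h2 : ⟪toGNS ρ, toGNS ρ⟫_ℂ = (((∑ i, l i ^ 2) / n : ℝ) : ℂ) := by
      rw [inner_eq_coef hρ.1, Fintype.sum_prod_type]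
      simp only [hc, mul_ite, mul_zero, Finset.sum_ite_eq, Finset.mem_univ, if_true,
        Complex.conj_ofReal]
      push_cast
      simp [sq]
    exact_mod_cast h1.trans h2
  have htr : (tau ρ).re = (∑ i, l i) / n := by
    rw [tau, hρ.1.trace_eq_sum_eigenvalues, Complex.div_natCast_re, Complex.re_sum]
    simp [l]
  have hsq : ∑ i, l i ^ 2 ≤ (∑ i, l i) ^ 2 :=
    Finset.sum_sq_le_sq_sum_of_nonneg fun i _ => hρ.eigenvalues_nonneg i
  rw [hnorm, htr, div_pow]
  calc (∑ i, l i ^ 2) / n ≤ (∑ i, l i) ^ 2 / n := by gcongr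
    _ = n * ((∑ i, l i) ^ 2 / n ^ 2) := by field_simp

end Density

open QTransport

/-! ### The real Hilbert spaces of self-adjoint elements and of vector fields -/

section SelfAdjoint

variable {n : ℕ} {𝒜 : StarSubalgebra ℂ (Mat n)} {J : Type*} [Fintype J]

/-- The real inner product `Re ⟪A, B⟫` on the algebra. -/
@[reducible] noncomputable def realInnerVec (𝒜 : StarSubalgebra ℂ (Mat n)) :
    InnerProductSpace ℝ (HA 𝒜) := InnerProductSpace.rclikeToReal ℂ _

/-- The real inner product `Re ⟪W, W'⟫` on vector fields. -/
@[reducible] noncomputable def realInnerField (n : ℕ) (J : Type*) [Fintype J] :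
    InnerProductSpace ℝ (Field n J) := InnerProductSpace.rclikeToReal ℂ _

attribute [local instance] realInnerVec realInnerField

theorem inner_real_vec (A B : HA 𝒜) : ⟪A, B⟫_ℝ = (⟪A, B⟫_ℂ).re := rfl

theorem inner_real_field (W W' : Field n J) : ⟪W, W'⟫_ℝ = (⟪W, W'⟫_ℂ).re := rfl

theorem mat_real_smul (c : ℝ) (A : HA 𝒜) :
    mat ((c • A : HA 𝒜) : GNS n) = (c : ℂ) • mat (A : GNS n) := rfl

/-- The real subspace of self-adjoint elements. -/
def selfAdjSubmodule (𝒜 : StarSubalgebra ℂ (Mat n)) : Submodule ℝ (HA 𝒜) where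
  carrier := {A | vecStar A = A}
  add_mem' {A B} hA hB := by
    rw [mem_ofPred_eq, vecStar_eq_iff] at hA hB ⊢
    exact hA.add hB
  zero_mem' := vecStar_eq_iff.2 Matrix.isHermitian_zero
  smul_mem' c A hA := by
    rw [mem_ofPred_eq, vecStar_eq_iff] at hA ⊢
    rw [mat_real_smul, Matrix.IsHermitian, Matrix.conjTranspose_smul, hA, Complex.star_def,
      Complex.conj_ofReal]

noncomputable instance : FiniteDimensional ℝ (HA 𝒜) := FiniteDimensional.complexToReal _

noncomputable instance : FiniteDimensional ℝ (Field n J) := FiniteDimensional.complexToReal _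

/-- The real Hilbert space of self-adjoint elements. -/
def SelfAdj (𝒜 : StarSubalgebra ℂ (Mat n)) : Type := selfAdjSubmodule 𝒜

noncomputable instance : NormedAddCommGroup (SelfAdj 𝒜) :=
  inferInstanceAs (NormedAddCommGroup (selfAdjSubmodule 𝒜))

noncomputable instance : InnerProductSpace ℝ (SelfAdj 𝒜) :=
  inferInstanceAs (InnerProductSpace ℝ (selfAdjSubmodule 𝒜))

noncomputable instance : FiniteDimensional ℝ (SelfAdj 𝒜) :=
  inferInstanceAs (FiniteDimensional ℝ (selfAdjSubmodule 𝒜))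

/-- The inclusion of the self-adjoint elements. -/
noncomputable def saVal : SelfAdj 𝒜 →L[ℝ] HA 𝒜 := (selfAdjSubmodule 𝒜).subtypeL

theorem vecStar_saVal (A : SelfAdj 𝒜) : vecStar (saVal A) = saVal A := A.2

/-- A self-adjoint vector as an element of `SelfAdj`. -/
def saMk (A : HA 𝒜) (hA : vecStar A = A) : SelfAdj 𝒜 := ⟨A, hA⟩

theorem saVal_saMk (A : HA 𝒜) (hA : vecStar A = A) : saVal (saMk A hA) = A := rfl

theorem saVal_injective : Function.Injective (saVal : SelfAdj 𝒜 → HA 𝒜) := Subtype.val_injective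

theorem inner_saVal (A C : SelfAdj 𝒜) : ⟪A, C⟫_ℝ = (⟪saVal A, saVal C⟫_ℂ).re := rfl

/-- The matrix underlying a self-adjoint element. -/
noncomputable def saMat (A : SelfAdj 𝒜) : Mat n := mat (saVal A : GNS n)

theorem saMat_isHermitian (A : SelfAdj 𝒜) : (saMat A).IsHermitian := vecStar_eq_iff.1 A.2

theorem saMat_mem (A : SelfAdj 𝒜) : saMat A ∈ 𝒜 := mat_mem _

theorem saMat_add (A B : SelfAdj 𝒜) : saMat (A + B) = saMat A + saMat B := rfl

theorem saMat_smul (c : ℝ) (A : SelfAdj 𝒜) : saMat (c • A) = (c : ℂ) • saMat A := rfl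

theorem saMat_injective : Function.Injective (saMat : SelfAdj 𝒜 → Mat n) := fun _ _ h =>
  saVal_injective (vec_ext h)

theorem continuous_saMat : Continuous (saMat : SelfAdj 𝒜 → Mat n) :=
  continuous_mat.comp (continuous_subtype_val.comp saVal.continuous)

/-- A Hermitian matrix in the algebra, as a self-adjoint element. -/
noncomputable def saOfMem {X : Mat n} (hX : X ∈ 𝒜) (hh : X.IsHermitian) : SelfAdj 𝒜 :=
  saMk (vecOfMem hX) (vecStar_eq_iff.2 hh)

@[simp] theorem saMat_saOfMem {X : Mat n} (hX : X ∈ 𝒜) (hh : X.IsHermitian) :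
    saMat (saOfMem hX hh) = X := rfl

theorem inner_selfAdj (A B : SelfAdj 𝒜) : ⟪A, B⟫_ℝ = (tau (saMat A * saMat B)).re := by
  have : ⟪A, B⟫_ℝ = (tau ((saMat A)ᴴ * saMat B)).re := rfl
  rw [this, saMat_isHermitian A]

/-- The unit matrix as a self-adjoint element. -/
noncomputable def saOne (𝒜 : StarSubalgebra ℂ (Mat n)) : SelfAdj 𝒜 :=
  saOfMem (one_mem 𝒜) Matrix.isHermitian_one

/-- The density matrices. -/
def densities (𝒜 : StarSubalgebra ℂ (Mat n)) : Set (SelfAdj 𝒜) := {ρ | IsDensity 𝒜 (saMat ρ)}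

/-- The positive definite elements. -/
def posDefs (𝒜 : StarSubalgebra ℂ (Mat n)) : Set (SelfAdj 𝒜) := {ρ | (saMat ρ).PosDef}

/-- The gradient on self-adjoint elements. -/
noncomputable def saNabla (𝒜 : StarSubalgebra ℂ (Mat n)) (V : J → Mat n) :
    SelfAdj 𝒜 →L[ℝ] Field n J :=
  LinearMap.toContinuousLinearMap ((nabla 𝒜 V).restrictScalars ℝ) ∘L saVal

theorem saNabla_apply (V : J → Mat n) (A : SelfAdj 𝒜) : saNabla 𝒜 V A = nabla 𝒜 V (saVal A) := rfl

variable {V : J → Mat n} {ℒ : HA 𝒜 →ₗ[ℂ] HA 𝒜} {s : Equiv.Perm J}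

/-- The generator on self-adjoint elements. -/
noncomputable def saGen (h : IsSymmetricFlow V ℒ s) : SelfAdj 𝒜 →L[ℝ] SelfAdj 𝒜 :=
  LinearMap.toContinuousLinearMap
    { toFun := fun A => saMk (ℒ (saVal A))
        ((h.map_star (saVal A)).symm.trans (congrArg ℒ (vecStar_saVal A)))
      map_add' := fun A C => saVal_injective (map_add ℒ (saVal A) (saVal C))
      map_smul' := fun c A => saVal_injective (map_smul (ℒ.restrictScalars ℝ) c (saVal A)) }

theorem saVal_saGen (h : IsSymmetricFlow V ℒ s) (A : SelfAdj 𝒜) :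
    saVal (saGen h A) = ℒ (saVal A) := rfl

/-- The operator `bracket B ρ` as a real linear map. -/
noncomputable def saBracket (B : J → Mat n → GNS n →L[ℂ] GNS n) (ρ : SelfAdj 𝒜) :
    Field n J →L[ℝ] Field n J :=
  (bracketCLM B (saMat ρ)).restrictScalars ℝ

theorem saBracket_apply (B : J → Mat n → GNS n →L[ℂ] GNS n) (ρ : SelfAdj 𝒜) (W : Field n J) :
    saBracket B ρ W = bracket B (saMat ρ) W := rfl

theorem saVal_adjoint_saGen (h : IsSymmetricFlow V ℒ s) (A : SelfAdj 𝒜) :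
    saVal (ContinuousLinearMap.adjoint (saGen h) A) = LinearMap.adjoint ℒ (saVal A) := by
  have hmem : vecStar (LinearMap.adjoint ℒ (saVal A)) = LinearMap.adjoint ℒ (saVal A) := by
    rw [← h.adjoint_map_star, vecStar_saVal]
  have hs : ContinuousLinearMap.adjoint (saGen h) A = saMk _ hmem := by
    refine ext_inner_right ℝ fun C => ?_
    rw [ContinuousLinearMap.adjoint_inner_left, inner_saVal, inner_saVal, saVal_saMk, saVal_saGen,
      LinearMap.adjoint_inner_left]
  rw [hs, saVal_saMk]

theorem saVal_adjoint_saNabla (h : IsSymmetricFlow V ℒ s) {W : Field n J}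
    (hW : fieldStar s W = W) :
    saVal (ContinuousLinearMap.adjoint (saNabla 𝒜 V) W) = LinearMap.adjoint (nabla 𝒜 V) W := by
  have hmem : vecStar (LinearMap.adjoint (nabla 𝒜 V) W) = LinearMap.adjoint (nabla 𝒜 V) W := by
    rw [← h.adjoint_nabla_fieldStar, hW]
  have hs : ContinuousLinearMap.adjoint (saNabla 𝒜 V) W = saMk _ hmem := by
    refine ext_inner_right ℝ fun C => ?_
    rw [ContinuousLinearMap.adjoint_inner_left, inner_saVal, saVal_saMk, inner_real_field,
      saNabla_apply, LinearMap.adjoint_inner_left]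
  rw [hs, saVal_saMk]

theorem tau_one (hn : 0 < n) : tau (1 : Mat n) = 1 := by
  have : (n : ℂ) ≠ 0 := by exact_mod_cast hn.ne'
  rw [tau, Matrix.trace_one, Fintype.card_fin, div_self this]

theorem tau_add (X Y : Mat n) : tau (X + Y) = tau X + tau Y := by
  simp [tau, Matrix.trace_add, add_div]

theorem tau_smul (c : ℂ) (X : Mat n) : tau (c • X) = c * tau X := by
  simp [tau, Matrix.trace_smul, mul_div_assoc]

theorem continuous_tau : Continuous (tau : Mat n → ℂ) :=
  (continuous_id.matrix_trace).div_const _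

theorem isCompact_densities (𝒜 : StarSubalgebra ℂ (Mat n)) : IsCompact (densities 𝒜) := by
  refine Metric.isCompact_of_isClosed_isBounded ?_ ?_
  · have : densities 𝒜 = saMat ⁻¹' {X : Mat n | X.PosSemidef} ∩ (tau ∘ saMat) ⁻¹' {1} := by
      ext ρ
      exact ⟨fun h => ⟨h.2.1, h.2.2⟩, fun h => ⟨saMat_mem ρ, h.1, h.2⟩⟩
    rw [this]
    exact (isClosed_setOf_posSemidef.preimage continuous_saMat).inter
      (isClosed_singleton.preimage (continuous_tau.comp continuous_saMat))
  · refine isBounded_iff_forall_norm_le.2 ⟨Real.sqrt n, fun ρ hρ => ?_⟩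
    have h1 := norm_sq_le_of_posSemidef hρ.2.1
    rw [hρ.2.2, Complex.one_re, one_pow, mul_one] at h1
    exact Real.le_sqrt_of_sq_le h1

theorem convex_densities (𝒜 : StarSubalgebra ℂ (Mat n)) : Convex ℝ (densities 𝒜) := by
  intro ρ hρ ρ' hρ' a b ha hb hab
  refine ⟨saMat_mem _, ?_, ?_⟩
  · rw [saMat_add, saMat_smul, saMat_smul]
    exact (hρ.2.1.smul (by exact_mod_cast ha)).add (hρ'.2.1.smul (by exact_mod_cast hb))
  · rw [saMat_add, saMat_smul, saMat_smul, tau_add, tau_smul, tau_smul, hρ.2.2, hρ'.2.2, mul_one,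
      mul_one]
    exact_mod_cast hab

variable {m : J → ℝ → ℝ → ℝ} {B : J → Mat n → GNS n →L[ℂ] GNS n}

/-- The density matrices, the gradient, the generator and the operators `bracket B ρ` form data of
the kind for which the duality formula holds. -/
theorem transportData (h : IsSymmetricFlow V ℒ s) (hB : IsKernelFamily s m B) :
    TransportData (saOne 𝒜) (saNabla 𝒜 V) (saGen h) (densities 𝒜) (posDefs 𝒜) (saBracket B) where
  norm_u := by
    have h1 : ⟪saOne 𝒜, saOne 𝒜⟫_ℝ = 1 := by
      rw [inner_selfAdj, saOne, saMat_saOfMem, one_mul, tau_one h.pos, Complex.one_re]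
    rw [real_inner_self_eq_norm_sq] at h1
    exact (pow_eq_one_iff_of_nonneg (norm_nonneg _) two_ne_zero).1 h1
  N_u := by
    ext j : 1
    apply mat_injective
    rw [saNabla_apply, nabla_apply]
    change V j * 1 - 1 * V j = 0
    rw [mul_one, one_mul, sub_self]
  L_u := saVal_injective (h.map_one _ rfl)
  ker_N A hA := by
    obtain ⟨c, hc⟩ := h.ker (saVal A) hA
    refine ⟨c.re, saMat_injective ?_⟩
    have h1 : saMat A = c • 1 := hc
    -- the scalar is real since `A` is self-adjoint
    have h2 : (c.re : ℂ) = c := by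
      have h3 := saMat_isHermitian A
      rw [h1, Matrix.IsHermitian, Matrix.conjTranspose_smul, Matrix.conjTranspose_one] at h3
      have h4 := congrArg tau h3
      rw [tau_smul, tau_smul, tau_one h.pos, mul_one, mul_one] at h4
      exact Complex.conj_eq_iff_re.1 h4
    rw [saMat_smul, h1, h2]
    rfl
  compact := isCompact_densities 𝒜
  convex := convex_densities 𝒜
  inner_u ρ hρ := by
    rw [inner_selfAdj, saOne, saMat_saOfMem, one_mul, hρ.2.2, Complex.one_re]
  isOpen := isOpen_setOf_posDef_of_isHermitian continuous_saMat saMat_isHermitian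
  add_mem ρ hρ ρ' hρ' := Matrix.PosDef.add hρ hρ'
  smul_mem c hc ρ hρ := by
    change (saMat (c • ρ)).PosDef
    rw [saMat_smul]
    exact Matrix.PosDef.smul hρ (by exact_mod_cast hc)
  add_smul_mem ρ hρ η hη := by
    change (saMat (ρ + η • saOne 𝒜)).PosDef
    rw [saMat_add, saMat_smul]
    exact Matrix.PosDef.posSemidef_add hρ.2.1
      (Matrix.PosDef.smul Matrix.PosDef.one (by exact_mod_cast hη))
  symm ρ hρ X Y := congrArg Complex.re (hB.inner_symm (Matrix.PosDef.posSemidef hρ) X Y)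
  pos ρ hρ X hX := hB.re_inner_pos hρ hX
  superadd ρ hρ ρ' hρ' X := by
    simp only [inner_real_field, saBracket_apply, re_inner_bracket, ← Finset.sum_add_distrib]
    exact Finset.sum_le_sum fun j _ => hB.superadd j _ _ hρ hρ' _
  homog c hc ρ hρ X := by
    simp only [inner_real_field, saBracket_apply, re_inner_bracket, Finset.mul_sum, saMat_smul]
    refine Finset.sum_congr rfl fun j _ => ?_
    rw [(hB.schur j).smul (hB.weight j) (Matrix.PosDef.posSemidef hρ) hc, smul_apply,
      inner_smul_left, Complex.conj_ofReal, Complex.re_ofReal_mul]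
  le_add ρ hρ η hη X := by
    simp only [inner_real_field, saBracket_apply, re_inner_bracket]
    exact Finset.sum_le_sum fun j _ => (hB.schur j).le_add (hB.weight j) hρ.2.1 hη.le _

end SelfAdjoint

open QTransport

/-! ### The duality formula for general families of operators -/

section Duality

variable {n : ℕ} {𝒜 : StarSubalgebra ℂ (Mat n)} {J : Type*} [Fintype J]
  {V : J → Mat n} {ℒ : HA 𝒜 →ₗ[ℂ] HA 𝒜} {s : Equiv.Perm J}
  {m : J → ℝ → ℝ → ℝ} {B : J → Mat n → GNS n →L[ℂ] GNS n} {K : J → Submodule ℂ (GNS n)}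
  {ε : ℝ} {ρ₀ ρ₁ : Mat n}

attribute [local instance] realInnerVec realInnerField

theorem ofReal_integral_le_lintegral {α : Type*} [MeasurableSpace α] {μ : Measure α} {f : α → ℝ}
    (hf : Integrable f μ) : ENNReal.ofReal (∫ a, f a ∂μ) ≤ ∫⁻ a, ENNReal.ofReal (f a) ∂μ := by
  rw [integral_eq_lintegral_pos_part_sub_lintegral_neg_part hf]
  exact (ENNReal.ofReal_le_ofReal (sub_le_self _ ENNReal.toReal_nonneg)).trans
    ENNReal.ofReal_toReal_le

theorem QTransport.HasH1Deriv.intervalIntegrable {E : Type*} [NormedAddCommGroup E]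
    [NormedSpace ℝ E] {f g : ℝ → E} (h : HasH1Deriv f g) : IntervalIntegrable g volume 0 1 :=
  intervalIntegrable_iff_unitMeasure.2 (h.1.integrable one_le_two)

theorem re_tau_mul_of_isHermitian (X : HA 𝒜) {ρ : HA 𝒜} (hρ : (mat (ρ : GNS n)).IsHermitian) :
    (tau (mat (X : GNS n) * mat (ρ : GNS n))).re = ⟪X, ρ⟫_ℝ := by
  have h1 : ⟪X, ρ⟫_ℝ = (tau ((mat (X : GNS n))ᴴ * mat (ρ : GNS n))).re := rfl
  have h2 : (mat (X : GNS n))ᴴ * mat (ρ : GNS n) = (mat (ρ : GNS n) * mat (X : GNS n))ᴴ := by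
    rw [Matrix.conjTranspose_mul, hρ]
  rw [h1, h2, tau_conjTranspose, Complex.conj_re, tau_mul_comm]

theorem dualValue_eq {A : ℝ → HA 𝒜} {r₀ r₁ : HA 𝒜} (h₀ : (mat (r₀ : GNS n)).IsHermitian)
    (h₁ : (mat (r₁ : GNS n)).IsHermitian) :
    dualValue (mat (r₀ : GNS n)) (mat (r₁ : GNS n)) A = ⟪A 1, r₁⟫_ℝ - ⟪A 0, r₀⟫_ℝ := by
  rw [dualValue, Complex.sub_re, re_tau_mul_of_isHermitian _ h₀, re_tau_mul_of_isHermitian _ h₁]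

theorem dualValue_saVal (A : ℝ → SelfAdj 𝒜) (r₀ r₁ : SelfAdj 𝒜) :
    dualValue (saMat r₀) (saMat r₁) (fun t => saVal (A t)) = ⟪A 1, r₁⟫_ℝ - ⟪A 0, r₀⟫_ℝ :=
  dualValue_eq (saMat_isHermitian r₀) (saMat_isHermitian r₁)

theorem exists_saMat_eq {ρ : Mat n} (hρ : IsInvDensity 𝒜 ρ) :
    ∃ r ∈ densities 𝒜 ∩ posDefs 𝒜, saMat r = ρ :=
  ⟨saOfMem hρ.1.1 hρ.1.2.1.1, ⟨hρ.1, hρ.1.2.1.posDef_iff_isUnit.2 hρ.2⟩, rfl⟩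

/-- Young's inequality for the quadratic form of `bracket B ρ`. -/
theorem IsKernelFamily.two_mul_re_inner_le (hB : IsKernelFamily s m B) {ρ : Mat n}
    (hρ : ρ.PosSemidef) (X U : Field n J) :
    2 * (⟪X, bracket B ρ U⟫_ℂ).re
      ≤ (⟪X, bracket B ρ X⟫_ℂ).re + (⟪bracket B ρ U, U⟫_ℂ).re := by
  have h1 := hB.re_inner_nonneg hρ (X - U)
  have h2 : bracket B ρ (X - U) = bracket B ρ X - bracket B ρ U := map_sub (bracketCLM B ρ) X U
  have h3 : (⟪bracket B ρ U, X⟫_ℂ).re = (⟪X, bracket B ρ U⟫_ℂ).re := by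
    rw [← inner_conj_symm, Complex.conj_re]
  rw [h2, inner_sub_left, inner_sub_right, inner_sub_right, hB.inner_symm hρ X X,
    hB.inner_symm hρ X U] at h1
  simp only [Complex.sub_re] at h1
  linarith

/-- Weak duality: the value of a subsolution is bounded by the action of any admissible path. -/
theorem ofReal_two_mul_dualValue_le (hB : IsKernelFamily s m B) {A : ℝ → HA 𝒜}
    (hA : IsHJB 𝒜 V ℒ ε B A) {ρ : ℝ → HA 𝒜} {W : ℝ → Field n J}
    (hρ : IsAdmissiblePath 𝒜 V K ℒ ε ρ₀ ρ₁ ρ W) :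
    ENNReal.ofReal (2 * dualValue ρ₀ ρ₁ A)
      ≤ ∫⁻ t in Icc (0 : ℝ) 1, invQuad B (mat (ρ t)) (W t) := by
  obtain ⟨-, A', hA', hsub⟩ := hA
  obtain ⟨ρ', hρ', heq⟩ := hρ.continuity
  have hherm : ∀ t ∈ Icc (0 : ℝ) 1, (mat (ρ t : GNS n)).IsHermitian := fun t ht =>
    (hρ.density t ht).1.2.1.1
  obtain ⟨hint, hval⟩ := integral_inner_add_inner hA'.intervalIntegrable hρ'.intervalIntegrable
    hA'.2 hρ'.2
  have hdual : 2 * dualValue ρ₀ ρ₁ A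
      = ∫ t, 2 * (⟪A' t, ρ t⟫_ℝ + ⟪A t, ρ' t⟫_ℝ) ∂unitMeasure := by
    rw [integral_const_mul, integral_unitMeasure, hval, ← hρ.start, ← hρ.finish,
      dualValue_eq (hherm 0 ⟨le_rfl, zero_le_one⟩) (hherm 1 ⟨zero_le_one, le_rfl⟩)]
  rw [hdual]
  refine (ofReal_integral_le_lintegral
    ((intervalIntegrable_iff_unitMeasure.1 hint).const_mul 2)).trans (lintegral_mono_ae ?_)
  filter_upwards [hsub, heq, ae_mem_Icc] with t h1 h2 ht
  refine le_iInf₂ fun U hU => ENNReal.ofReal_le_ofReal ?_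
  have hd := (hρ.density t ht).1
  have h3 := h1 _ hd
  rw [re_tau_mul_of_isHermitian _ (hherm t ht)] at h3
  have h4 : ρ' t = LinearMap.adjoint (nabla 𝒜 V) (W t) + (ε : ℂ) • LinearMap.adjoint ℒ (ρ t) := by
    rw [← h2, divergence, LinearMap.neg_apply]
    abel
  have h5 : ⟪A t, ρ' t⟫_ℝ = (⟪nabla 𝒜 V (A t), W t⟫_ℂ).re + ⟪(ε : ℂ) • ℒ (A t), ρ t⟫_ℝ := by
    have h6 : ⟪A t, (ε : ℂ) • LinearMap.adjoint ℒ (ρ t)⟫_ℂ = ⟪(ε : ℂ) • ℒ (A t), ρ t⟫_ℂ := by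
      have h7 := LinearMap.adjoint_inner_right ((ε : ℂ) • ℒ) (A t) (ρ t)
      rwa [map_smulₛₗ, Complex.conj_ofReal] at h7
    rw [h4, inner_real_vec, inner_real_vec, inner_add_right, Complex.add_re, h6,
      LinearMap.adjoint_inner_right]
  have h6 := hB.two_mul_re_inner_le hd.2.1 (nabla 𝒜 V (A t)) U
  rw [hU] at h6 ⊢
  rw [inner_add_left] at h3
  linarith

/-- Smooth subsolutions are subsolutions in `H¹`. -/
theorem isHJB_of_isSmoothSub (h : IsSymmetricFlow V ℒ s) (hB : IsKernelFamily s m B)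
    {A : ℝ → SelfAdj 𝒜}
    (hA : TransportData.IsSmoothSub (saNabla 𝒜 V) (saGen h) (densities 𝒜) (saBracket B) ε A) :
    IsHJB 𝒜 V ℒ ε B (fun t => saVal (A t)) := by
  refine ⟨fun t _ => saMat_isHermitian (A t), fun t => saVal (deriv A t), ⟨?_, fun t _ => ?_⟩, ?_⟩
  · exact (saVal (𝒜 := 𝒜)).comp_memLp'
      (memLp_of_continuous (hA.smooth.continuous_deriv (by simp)))
  · have h1 := congrArg (saVal (𝒜 := 𝒜)) (eq_add_integral_deriv hA.smooth t)
    rw [map_add, ← ContinuousLinearMap.intervalIntegral_comp_comm _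
      ((hA.smooth.continuous_deriv (by simp)).intervalIntegrable _ _)] at h1
    exact h1
  · filter_upwards [ae_mem_Icc] with t ht ρ hρ
    have h1 := hA.le t ht (saOfMem hρ.1 hρ.2.1.1) hρ
    have h2 := re_tau_mul_of_isHermitian (saVal (deriv A t) + (ε : ℂ) • ℒ (saVal (A t)))
      (ρ := vecOfMem hρ.1) hρ.2.1.1
    rw [mat_vecOfMem] at h2
    rw [h2, ← hB.inner_symm hρ.2.1]
    exact h1

/-- A path driven by a gradient field is admissible, and its action is bounded by its energy. -/
theorem isAdmissiblePath_of_isPath (h : IsSymmetricFlow V ℒ s) (hB : IsKernelFamily s m B)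
    (hK : IsAdmissible 𝒜 V K) {r₀ r₁ : SelfAdj 𝒜} {ρ A : ℝ → SelfAdj 𝒜}
    (hρ : TransportData.IsPath (saNabla 𝒜 V) (saGen h) (densities 𝒜) (posDefs 𝒜) (saBracket B) ε
      r₀ r₁ ρ A) :
    IsAdmissiblePath 𝒜 V K ℒ ε (saMat r₀) (saMat r₁) (fun t => saVal (ρ t))
      (fun t => bracket B (saMat (ρ t)) (nabla 𝒜 V (saVal (A t)))) where
  density t ht := ⟨(hρ.density t ht).1, Matrix.PosDef.isUnit (hρ.density t ht).2⟩
  start := congrArg saMat hρ.start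
  finish := congrArg saMat hρ.finish
  memLp := hρ.memLp_flux
  values := by
    filter_upwards [ae_mem_Icc] with t ht j
    exact (hB.schur j).apply_mem (hρ.density t ht).1.2.1 (saMat_mem (ρ t)) (hK.left_mem j)
      (hK.right_mem j) (hK.grad_mem j _)
  continuity := by
    let g : ℝ → SelfAdj 𝒜 := fun t => ContinuousLinearMap.adjoint (saNabla 𝒜 V)
      (saBracket B (ρ t) (saNabla 𝒜 V (A t))) + ε • ContinuousLinearMap.adjoint (saGen h) (ρ t)
    refine ⟨fun t => saVal (g t), ⟨?_, fun t ht => ?_⟩, ?_⟩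
    · exact (saVal (𝒜 := 𝒜)).comp_memLp' hρ.memLp_deriv
    · have h1 := congrArg (saVal (𝒜 := 𝒜)) (hρ.eq_integral t ht)
      have h2 : IntervalIntegrable g volume 0 t :=
        (intervalIntegrable_iff_unitMeasure.2 (hρ.memLp_deriv.integrable one_le_two)).mono_set (by
          rw [uIcc_of_le ht.1, uIcc_of_le zero_le_one]
          exact Icc_subset_Icc_right ht.2)
      rw [map_add, ← ContinuousLinearMap.intervalIntegral_comp_comm _ h2] at h1
      exact h1
    · filter_upwards [ae_mem_Icc] with t ht
      have hfix : fieldStar s (bracket B (saMat (ρ t)) (nabla 𝒜 V (saVal (A t))))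
          = bracket B (saMat (ρ t)) (nabla 𝒜 V (saVal (A t))) := by
        rw [← hB.bracket_fieldStar (hρ.density t ht).1.2.1, ← h.nabla_vecStar]
        rw [show vecStar (saVal (A t)) = saVal (A t) from vecStar_saVal _]
      have h1 := saVal_adjoint_saNabla h hfix
      have h2 := saVal_adjoint_saGen h (ρ t)
      rw [divergence, LinearMap.neg_apply, ← h1, ← h2, Complex.coe_smul, ← sub_eq_add_neg,
        sub_eq_iff_eq_add']
      rfl

theorem lintegral_invQuad_le (h : IsSymmetricFlow V ℒ s) (hB : IsKernelFamily s m B)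
    {r₀ r₁ : SelfAdj 𝒜} {ρ A : ℝ → SelfAdj 𝒜}
    (hρ : TransportData.IsPath (saNabla 𝒜 V) (saGen h) (densities 𝒜) (posDefs 𝒜) (saBracket B) ε
      r₀ r₁ ρ A) :
    ∫⁻ t in Icc (0 : ℝ) 1,
        invQuad B (saMat (ρ t)) (bracket B (saMat (ρ t)) (nabla 𝒜 V (saVal (A t))))
      ≤ ENNReal.ofReal (∫ t, ⟪saBracket B (ρ t) (saNabla 𝒜 V (A t)), saNabla 𝒜 V (A t)⟫_ℝ
        ∂unitMeasure) := by
  rw [ofReal_integral_eq_lintegral_ofReal hρ.integrable_energy]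
  · exact lintegral_mono fun t => iInf_le_of_le (nabla 𝒜 V (saVal (A t))) (iInf_le_of_le rfl le_rfl)
  · filter_upwards [ae_mem_Icc] with t ht
    exact hB.re_inner_nonneg (hρ.density t ht).1.2.1 _

/-- The duality formula for a family of operators with a symbol. The upper bound is weak duality,
the lower bound is the strong duality of the abstract problem formed by the self-adjoint elements. -/
theorem duality (h : IsSymmetricFlow V ℒ s) (hB : IsKernelFamily s m B)
    (hK : IsAdmissible 𝒜 V K) (ε : ℝ) {ρ₀ ρ₁ : Mat n} (hρ₀ : IsInvDensity 𝒜 ρ₀)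
    (hρ₁ : IsInvDensity 𝒜 ρ₁) :
    transportDist 𝒜 V K ℒ ε B ρ₀ ρ₁ ≠ ∞ ∧
      IsLUB {x : ℝ | ∃ A : ℝ → HA 𝒜, IsHJB 𝒜 V ℒ ε B A ∧ x = dualValue ρ₀ ρ₁ A}
        (1 / 2 * (transportDist 𝒜 V K ℒ ε B ρ₀ ρ₁).toReal ^ 2) ∧
      IsLUB {x : ℝ | ∃ A : ℝ → HA 𝒜, IsHJB 𝒜 V ℒ ε B A ∧
          ContDiffOn ℝ (⊤ : ℕ∞) A (Icc 0 1) ∧ x = dualValue ρ₀ ρ₁ A}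
        (1 / 2 * (transportDist 𝒜 V K ℒ ε B ρ₀ ρ₁).toReal ^ 2) := by
  obtain ⟨r₀, hr₀, rfl⟩ := exists_saMat_eq hρ₀
  obtain ⟨r₁, hr₁, rfl⟩ := exists_saMat_eq hρ₁
  set T : ℝ≥0∞ := ⨅ (ρ : ℝ → HA 𝒜) (W : ℝ → Field n J)
    (_ : IsAdmissiblePath 𝒜 V K ℒ ε (saMat r₀) (saMat r₁) ρ W),
    ∫⁻ t in Icc (0 : ℝ) 1, invQuad B (mat (ρ t)) (W t) with hT
  have hdist : transportDist 𝒜 V K ℒ ε B (saMat r₀) (saMat r₁) = T ^ (1 / 2 : ℝ) := rfl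
  have hsq : (transportDist 𝒜 V K ℒ ε B (saMat r₀) (saMat r₁)).toReal ^ 2 = T.toReal := by
    rw [hdist, ← ENNReal.toReal_rpow, ← Real.rpow_natCast, ← Real.rpow_mul ENNReal.toReal_nonneg]
    norm_num
  have hD := transportData (𝒜 := 𝒜) h hB
  have hTle : ∀ {ρ A : ℝ → SelfAdj 𝒜}, TransportData.IsPath (saNabla 𝒜 V) (saGen h) (densities 𝒜)
      (posDefs 𝒜) (saBracket B) ε r₀ r₁ ρ A → T ≤ ENNReal.ofReal (∫ t, (⟪bracket B (saMat (ρ t))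
        (nabla 𝒜 V (saVal (A t))), nabla 𝒜 V (saVal (A t))⟫_ℂ).re ∂unitMeasure) := by
    intro ρ A hρ
    refine iInf_le_of_le (fun t => saVal (ρ t)) (iInf_le_of_le
      (fun t => bracket B (saMat (ρ t)) (nabla 𝒜 V (saVal (A t)))) (iInf_le_of_le
        (isAdmissiblePath_of_isPath h hB hK hρ) (lintegral_invQuad_le h hB hρ)))
  have hfin : T ≠ ∞ := by
    obtain ⟨A, hA⟩ := hD.exists_isPath_segment ε hr₀ hr₁
    exact ne_top_of_le_ne_top ENNReal.ofReal_ne_top (hTle hA)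
  have hup : ∀ A : ℝ → HA 𝒜, IsHJB 𝒜 V ℒ ε B A →
      dualValue (saMat r₀) (saMat r₁) A ≤ 1 / 2 * T.toReal := by
    intro A hA
    have h1 : ENNReal.ofReal (2 * dualValue (saMat r₀) (saMat r₁) A) ≤ T :=
      le_iInf fun ρ => le_iInf₂ fun W hW => ofReal_two_mul_dualValue_le hB hA hW
    have h2 := (ENNReal.ofReal_le_iff_le_toReal hfin).1 h1
    linarith
  have hlow : ∀ D : ℝ, (∀ A : ℝ → HA 𝒜, IsHJB 𝒜 V ℒ ε B A → ContDiffOn ℝ (⊤ : ℕ∞) A (Icc 0 1) →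
      dualValue (saMat r₀) (saMat r₁) A ≤ D) → 1 / 2 * T.toReal ≤ D := by
    intro D hDle
    refine le_of_forall_pos_le_add fun γ hγ => ?_
    have hDle' : ∀ A : ℝ → SelfAdj 𝒜, TransportData.IsSmoothSub (saNabla 𝒜 V) (saGen h)
        (densities 𝒜) (saBracket B) ε A → ⟪A 1, r₁⟫_ℝ - ⟪A 0, r₀⟫_ℝ ≤ D := by
      intro A hA
      have h1 := hDle _ (isHJB_of_isSmoothSub h hB hA)
        ((saVal (𝒜 := 𝒜)).contDiff.comp hA.smooth).contDiffOn
      rwa [dualValue_saVal] at h1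
    obtain ⟨ρ, A, hρ, hact⟩ := hD.exists_isPath_action_le (ε := ε) hr₀ hr₁ hDle' hγ
    have h2 := ENNReal.toReal_mono ENNReal.ofReal_ne_top (hTle hρ)
    rw [ENNReal.toReal_ofReal (integral_nonneg_of_ae (by
      filter_upwards [ae_mem_Icc] with t ht
      exact hB.re_inner_nonneg (hρ.density t ht).1.2.1 _))] at h2
    exact (mul_le_mul_of_nonneg_left h2 (by norm_num)).trans hact
  rw [hsq]
  refine ⟨?_, ⟨?_, ?_⟩, ⟨?_, ?_⟩⟩
  · rw [hdist]
    exact ENNReal.rpow_ne_top_of_nonneg (by norm_num) hfin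
  · rintro x ⟨A, hA, rfl⟩
    exact hup A hA
  · intro D hDub
    exact hlow D fun A hA _ => hDub ⟨A, hA, rfl⟩
  · rintro x ⟨A, hA, -, rfl⟩
    exact hup A hA
  · intro D hDub
    exact hlow D fun A hA hs => hDub ⟨A, hA, hs, rfl⟩

end Duality

open QTransport

/-! ### Verification of the hypotheses for operator connections and for the Carlen-Maas operators -/

section Verification

variable {n : ℕ} {𝒜 : StarSubalgebra ℂ (Mat n)} {J : Type*} [Fintype J] {σ : Mat n}
  {ℒ : HA 𝒜 →ₗ[ℂ] HA 𝒜} {ω : J → ℝ} {V : J → Mat n}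

theorem pos_of_isDensity {X : Mat n} (hX : IsDensity 𝒜 X) : 0 < n := by
  rcases Nat.eq_zero_or_pos n with hn | hn
  · subst hn
    have := hX.2.2
    simp [tau] at this
  · exact hn

/-- The permutation of the indices given by taking adjoints of the jump operators. -/
theorem QTransport.IsAlicki.exists_perm (hV : IsAlicki 𝒜 σ ℒ ω V) :
    ∃ s : Equiv.Perm J, ∀ j, V (s j) = (V j)ᴴ := by
  have hinj : Function.Injective V := hV.orthonormal.linearIndependent.injective
  have hex : ∀ j, ∃ k, V k = (V j)ᴴ := fun j => by
    have : (V j)ᴴ ∈ range V := by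
      rw [hV.star_closed]
      exact ⟨j, rfl⟩
    exact this
  choose f hf using hex
  have hff : Function.Involutive f := fun j => hinj (by
    rw [hf, hf, Matrix.conjTranspose_conjTranspose])
  exact ⟨hff.toPerm f, hf⟩

/-- The Bohr frequencies of adjoint jump operators are opposite. -/
theorem QTransport.IsAlicki.freq_neg (hV : IsAlicki 𝒜 σ ℒ ω V) (hσ : IsInvDensity 𝒜 σ) {j k : J}
    (hjk : V k = (V j)ᴴ) : ω k = -ω j := by
  have hdet : IsUnit σ.det := (Matrix.isUnit_iff_isUnit_det σ).1 hσ.2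
  have hcomm : ∀ i, σ * V i = (Real.exp (-ω i) : ℂ) • (V i * σ) := fun i => by
    rw [← smul_mul_assoc, ← hV.modular i, Matrix.nonsing_inv_mul_cancel_right _ _ hdet]
  have h1 := congrArg Matrix.conjTranspose (hcomm j)
  rw [Matrix.conjTranspose_mul, Matrix.conjTranspose_smul, Matrix.conjTranspose_mul,
    hσ.1.2.1.1.eq, ← hjk, Complex.star_def, Complex.conj_ofReal, hcomm k, smul_smul,
    ← Complex.ofReal_mul, ← Real.exp_add] at h1
  have hne : V k * σ ≠ 0 := fun h0 => by
    have h2 : V k = 0 := by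
      rw [← Matrix.mul_nonsing_inv_cancel_right _ (V k) hdet, h0, zero_mul]
    exact hV.orthonormal.ne_zero k h2
  have h3 : (1 : ℂ) = (Real.exp (-ω j + -ω k) : ℂ) :=
    smul_left_injective ℂ hne (by simpa only [one_smul] using h1)
  have h4 : Real.exp (-ω j + -ω k) = 1 := by exact_mod_cast h3.symm
  have h5 := (Real.exp_eq_one_iff _).1 h4
  linarith

/-- The reality of the generator follows from the symmetry of the jump operators under adjoints and
the opposite signs of their frequencies. An element with vanishing gradient lies in the kernel of
the generator, hence is a scalar by ergodicity. -/
theorem QTransport.IsAlicki.isSymmetricFlow (hV : IsAlicki 𝒜 σ ℒ ω V) (hσ : IsInvDensity 𝒜 σ)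
    (hErg : Module.finrank ℂ (LinearMap.ker ℒ) = 1) {s : Equiv.Perm J}
    (hs : ∀ j, V (s j) = (V j)ᴴ) : IsSymmetricFlow V ℒ s := by
  have hn := pos_of_isDensity hσ.1
  have hcomm : ∀ A : HA 𝒜, (∀ j, mat (A : GNS n) * V j - V j * mat (A : GNS n) = 0) → ℒ A = 0 :=
    fun A hA => vec_ext (by
      rw [hV.generator]
      simp [hA])
  have hone : ∀ A : HA 𝒜, mat (A : GNS n) = 1 → ℒ A = 0 := fun A hA =>
    hcomm A fun j => by rw [hA, one_mul, mul_one, sub_self]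
  refine ⟨hn, hs, hone, fun A => vec_ext ?_, fun A hA => ?_⟩
  · rw [mat_vecStar, hV.generator, hV.generator, Matrix.conjTranspose_sum, ← Equiv.sum_comp s]
    refine Finset.sum_congr rfl fun j _ => ?_
    have hω := hV.freq_neg hσ (hs j)
    simp only [hω, hs, mat_vecStar, Matrix.conjTranspose_sub, Matrix.conjTranspose_smul,
      Matrix.conjTranspose_mul, Matrix.conjTranspose_conjTranspose, Complex.star_def,
      Complex.conj_ofReal, neg_neg]
    rw [← neg_sub ((mat (A : GNS n))ᴴ * (V j)ᴴ) ((V j)ᴴ * (mat (A : GNS n))ᴴ), mul_neg, neg_mul,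
      smul_neg, smul_neg]
    abel
  · have hker : A ∈ LinearMap.ker ℒ := hcomm A fun j => by
      have h1 := nabla_apply V A j
      rw [hA] at h1
      rw [← neg_sub, ← h1]
      exact neg_zero
    set e : HA 𝒜 := vecOfMem (one_mem 𝒜)
    have he : e ∈ LinearMap.ker ℒ := hone e rfl
    have he0 : (⟨e, he⟩ : LinearMap.ker ℒ) ≠ 0 := fun h0 => by
      have h1 : (1 : Mat n) = 0 :=
        congrArg (fun x : LinearMap.ker ℒ => mat ((x : HA 𝒜) : GNS n)) h0
      have h2 := congrArg tau h1
      rw [tau_one hn] at h2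
      simp [tau] at h2
    obtain ⟨c, hc⟩ := (finrank_eq_one_iff_of_nonzero' _ he0).1 hErg ⟨A, hker⟩
    exact ⟨c, (congrArg (fun x : LinearMap.ker ℒ => mat ((x : HA 𝒜) : GNS n)) hc).symm⟩

theorem isKernelFamily_expBracket {s : Equiv.Perm J} (hω : ∀ j, ω (s j) = -ω j) :
    IsKernelFamily (n := n) s (fun j => expSymbol (ω j)) (fun j => expBracket (ω j)) where
  schur j := isSchur_expBracket (ω j)
  weight j := isWeight_expSymbol (ω j)
  symm j x y _ _ := by rw [hω, expSymbol_neg]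
  superadd j ρ ρ' hρ hρ' X := by
    have h := isSchur_expBracket (n := n) (ω j)
    rw [h.re_inner_eq_specForm hρ.posSemidef, h.re_inner_eq_specForm hρ'.posSemidef,
      h.re_inner_eq_specForm (hρ.add hρ').posSemidef, ← add_div]
    exact div_le_div_of_nonneg_right (isSuperadd_expSymbol (ω j) ρ ρ' hρ hρ' X) (Nat.cast_nonneg n)

theorem exists_isKernelFamily_connBracket {H : Type*} [NormedAddCommGroup H]
    [InnerProductSpace ℂ H] [CompleteSpace H] (hH : ¬ FiniteDimensional ℂ H) (ι : GNS n →ₗᵢ[ℂ] H)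
    {Λ : J → (H →L[ℂ] H) → (H →L[ℂ] H) → (H →L[ℂ] H)} (hΛ : ∀ j, IsOperatorConnection (Λ j))
    (hΛ0 : ∀ j, ∃ A B, 0 ≤ A ∧ 0 ≤ B ∧ Λ j A B ≠ 0) {s : Equiv.Perm J}
    (hsymm : ∀ j A B, 0 ≤ A → 0 ≤ B → Λ (s j) A B = Λ j B A) :
    ∃ m, IsKernelFamily s m (fun j => connBracket ι (Λ j)) := by
  have hnt : Nontrivial H := by
    by_contra hcon
    have := not_nontrivial_iff_subsingleton.1 hcon
    exact hH inferInstance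
  choose m hm using fun j => (hΛ j).exists_isSymbol
  have hw := fun j => (hm j).isWeight (hΛ j) (hΛ0 j)
  refine ⟨m, fun j => (hm j).isSchur_connBracket ι, hw, fun j x y hx hy => ?_,
    fun j ρ ρ' hρ hρ' X => (hm j).superadditive (hΛ j) (hw j) hH ((hm j).isSchur_connBracket ι)
      hρ.posSemidef hρ'.posSemidef X⟩
  have h1 : (0 : H →L[ℂ] H) ≤ 1 := zero_le_one
  have h2 := hsymm j ((x : ℂ) • 1) ((y : ℂ) • 1) (smul_nonneg (by exact_mod_cast hx) h1)
    (smul_nonneg (by exact_mod_cast hy) h1)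
  rw [(hm (s j)).apply_smul_one hx hy, (hm j).apply_smul_one hy hx] at h2
  exact le_antisymm (smul_one_le_iff.1 h2.le) (smul_one_le_iff.1 h2.ge)

end Verification

theorem mainTheorem1 {n : ℕ} (𝒜 : StarSubalgebra ℂ (Mat n))
    (σ : Mat n) (hσ : IsInvDensity 𝒜 σ)
    (P : ℝ≥0 → Mat n →ₗ[ℂ] Mat n) (hP : IsQMS P) (hDBC : DetailedBalance σ P)
    (hP𝒜 : ∀ t, ∀ X ∈ 𝒜, P t X ∈ 𝒜)
    (ℒ : HA 𝒜 →ₗ[ℂ] HA 𝒜) (hℒ : IsGenerator 𝒜 P ℒ)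
    (hErg : Module.finrank ℂ (LinearMap.ker ℒ) = 1)
    {J : Type*} [Fintype J] (ω : J → ℝ) (V : J → Mat n) (hV : IsAlicki 𝒜 σ ℒ ω V)
    (K : J → Submodule ℂ (GNS n)) (hK : IsAdmissible 𝒜 V K)
    {H : Type*} [NormedAddCommGroup H] [InnerProductSpace ℂ H] [CompleteSpace H]
    (hH : ¬ FiniteDimensional ℂ H) (ι : GNS n →ₗᵢ[ℂ] H)
    (Λ : J → (H →L[ℂ] H) → (H →L[ℂ] H) → (H →L[ℂ] H))
    (hΛ : ∀ j, IsOperatorConnection (Λ j))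
    (hΛ0 : ∀ j, ∃ A B, 0 ≤ A ∧ 0 ≤ B ∧ Λ j A B ≠ 0)
    (hΛsymm : ∀ j k, V k = (V j)ᴴ → ∀ A B, 0 ≤ A → 0 ≤ B → Λ k A B = Λ j B A)
    (ε : ℝ) (hε : 0 ≤ ε)
    (ρ₀ ρ₁ : Mat n) (hρ₀ : IsInvDensity 𝒜 ρ₀) (hρ₁ : IsInvDensity 𝒜 ρ₁) :
    (transportDist 𝒜 V K ℒ ε (fun j => connBracket ι (Λ j)) ρ₀ ρ₁ ≠ ∞ ∧
      IsLUB {x : ℝ | ∃ A : ℝ → HA 𝒜, IsHJB 𝒜 V ℒ ε (fun j => connBracket ι (Λ j)) A ∧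
          x = dualValue ρ₀ ρ₁ A}
        (1 / 2 * (transportDist 𝒜 V K ℒ ε (fun j => connBracket ι (Λ j)) ρ₀ ρ₁).toReal ^ 2) ∧
      IsLUB {x : ℝ | ∃ A : ℝ → HA 𝒜, IsHJB 𝒜 V ℒ ε (fun j => connBracket ι (Λ j)) A ∧
          ContDiffOn ℝ (⊤ : ℕ∞) A (Icc 0 1) ∧ x = dualValue ρ₀ ρ₁ A}
        (1 / 2 * (transportDist 𝒜 V K ℒ ε (fun j => connBracket ι (Λ j)) ρ₀ ρ₁).toReal ^ 2)) ∧
    (transportDist 𝒜 V K ℒ ε (fun j => expBracket (ω j)) ρ₀ ρ₁ ≠ ∞ ∧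
      IsLUB {x : ℝ | ∃ A : ℝ → HA 𝒜, IsHJB 𝒜 V ℒ ε (fun j => expBracket (ω j)) A ∧
          x = dualValue ρ₀ ρ₁ A}
        (1 / 2 * (transportDist 𝒜 V K ℒ ε (fun j => expBracket (ω j)) ρ₀ ρ₁).toReal ^ 2) ∧
      IsLUB {x : ℝ | ∃ A : ℝ → HA 𝒜, IsHJB 𝒜 V ℒ ε (fun j => expBracket (ω j)) A ∧
          ContDiffOn ℝ (⊤ : ℕ∞) A (Icc 0 1) ∧ x = dualValue ρ₀ ρ₁ A}
        (1 / 2 * (transportDist 𝒜 V K ℒ ε (fun j => expBracket (ω j)) ρ₀ ρ₁).toReal ^ 2)) := by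
  obtain ⟨s, hs⟩ := hV.exists_perm
  have hflow := hV.isSymmetricFlow hσ hErg hs
  obtain ⟨m, hm⟩ := exists_isKernelFamily_connBracket hH ι hΛ hΛ0 (s := s)
    fun j A B hA hB => hΛsymm j (s j) (hs j) A B hA hB
  exact ⟨duality hflow hm hK ε hρ₀ hρ₁,
    duality hflow (isKernelFamily_expBracket fun j => hV.freq_neg hσ (hs j)) hK ε hρ₀ hρ₁⟩
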